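/- Let $p$ be a prime number. Let $\mathcal G$ be a finitely presented pro-$p$ group (i.e. $\mathcal G\cong F/R$ with $F$ a free pro-$p$ group of finite rank and $R$ the closed normal subgroup generated by finitely many elements) of cohomological dimension at most $2$, and let $\mathcal H$ be a closed normal subgroup of $\mathcal G$ with $H^2(\mathcal H,\mathbb Q_p/\mathbb Z_p)=0$ (continuous cohomology, trivial action). Put $G=\mathcal G/\mathcal H$, let $\Lambda(G)=\varprojlim_U\mathbb Z_p[G/U]$ ($U$ running over the open normal subgroups of $G$) be the completed group algebra of $G$, and let $\mathcal X=\mathcal H^{ab}$ be the quotient of $\mathcal H$ by the closure of its commutator subgroup, regarded as a $\Lambda(G)$-module via the action of $G$ induced by conjugation, extended by continuity. Here, for a pro-$p$ group $P$, $cd(P)\le 2$ means that $H^k(P,\mathbb F_p)=0$ for all $k>2$, and $H_2(P,\mathbb Z_p)$ denotes the profinite homology of $P$ with trivial coefficients $\mathbb Z_p$. Suppose that $\mathcal X$ is finitely generated over $\Lambda(G)$, that $cd(G)\le 2$, and that $H_2(\mathcal G,\mathbb Z_p)=H_2(G,\mathbb Z_p)=0$. Then $\mathcal X$ is a free $\Lambda(G)$-module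 if and only if the natural map $\mathrm{Tor}_{\mathbb Z_p}\,\mathcal G^{ab}\to G^{ab}$, the restriction of $\mathcal G^{ab}\to G^{ab}$ to the $\mathbb Z_p$-torsion subgroup of $\mathcal G^{ab}$, is injective. -/

import Mathlib

open Filter Topology

section CompletedGroupAlgebra

set_option linter.unusedSectionVars false

variable (p : ℕ) [Fact p.Prime] (G : Type*) [Group G] [TopologicalSpace G]

/-- The completed group algebra `ℤ_p[[G]] = lim_U ℤ_p[G/U]`, the limit running over the open normal
subgroups `U` of `G`: families of elements of the `ℤ_p[G/U]` compatible with all the projections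
`ℤ_p[G/U] → ℤ_p[G/V]`, `U ≤ V`. -/
def CompletedGroupAlgebra.subring :
    Subring (∀ U : OpenNormalSubgroup G, MonoidAlgebra ℤ_[p] (G ⧸ U.toSubgroup)) where
  carrier := {x | ∀ (U V : OpenNormalSubgroup G) (h : U.toSubgroup ≤ V.toSubgroup),
    MonoidAlgebra.mapDomainRingHom ℤ_[p]
      (QuotientGroup.map U.toSubgroup V.toSubgroup (MonoidHom.id G) h) (x U) = x V}
  mul_mem' hx hy U V h := by
    rw [Pi.mul_apply, map_mul, hx U V h, hy U V h, Pi.mul_apply]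
  one_mem' U V h := by rw [Pi.one_apply, map_one, Pi.one_apply]
  add_mem' hx hy U V h := by
    rw [Pi.add_apply, map_add, hx U V h, hy U V h, Pi.add_apply]
  zero_mem' U V h := by rw [Pi.zero_apply, map_zero, Pi.zero_apply]
  neg_mem' hx U V h := by rw [Pi.neg_apply, map_neg, hx U V h, Pi.neg_apply]

/-- The completed group algebra `Λ(G) = ℤ_p[[G]]` as a ring. -/
abbrev CompletedGroupAlgebra : Type _ := CompletedGroupAlgebra.subring p G

namespace CompletedGroupAlgebra

variable {G}

/-- The natural ring homomorphism `ℤ[G] → ℤ_p[G/U]`. -/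
noncomputable def groupRingMap (U : OpenNormalSubgroup G) :
    MonoidAlgebra ℤ G →+* MonoidAlgebra ℤ_[p] (G ⧸ U.toSubgroup) :=
  (MonoidAlgebra.mapDomainRingHom ℤ_[p] (QuotientGroup.mk' U.toSubgroup)).comp
    (MonoidAlgebra.mapRingHom G (Int.castRingHom ℤ_[p]))

variable {p}

theorem coeff_groupRingMap (U : OpenNormalSubgroup G) (r : MonoidAlgebra ℤ G)
    (q : G ⧸ U.toSubgroup) :
    (groupRingMap p U r).coeff q = ((r.coeff.mapDomain QuotientGroup.mk q : ℤ) : ℤ_[p]) := by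
  classical
  induction r using MonoidAlgebra.induction_on with
  | of g => simp [groupRingMap, MonoidAlgebra.of_apply, Finsupp.single_apply]
  | add r s hr hs => simp [map_add, Finsupp.mapDomain_add, hr, hs]
  | smul n r hr =>
    rw [map_zsmul, MonoidAlgebra.coeff_smul, Finsupp.smul_apply, hr, MonoidAlgebra.coeff_smul,
      Finsupp.mapDomain_smul, Finsupp.smul_apply, smul_eq_mul, Int.cast_mul, zsmul_eq_mul]

/-- The elements of `ℤ[G]` that agree with `x ∈ Λ(G)` in `(ℤ_p/p^n)[G/U]`. -/
def approx (x : CompletedGroupAlgebra p G) (i : OpenNormalSubgroup G × ℕ) :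
    Set (MonoidAlgebra ℤ G) :=
  {r | ∃ c : MonoidAlgebra ℤ_[p] (G ⧸ i.1.toSubgroup),
    x.1 i.1 = groupRingMap p i.1 r + (p ^ i.2 : ℕ) • c}

/-- The filter on `ℤ[G]` of neighbourhoods of `x ∈ Λ(G)`. -/
def approxFilter (x : CompletedGroupAlgebra p G) : Filter (MonoidAlgebra ℤ G) :=
  ⨅ i : OpenNormalSubgroup G × ℕ, 𝓟 (approx x i)

theorem map_groupRingMap (U V : OpenNormalSubgroup G) (h : U.toSubgroup ≤ V.toSubgroup)
    (r : MonoidAlgebra ℤ G) :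
    MonoidAlgebra.mapDomainRingHom ℤ_[p]
      (QuotientGroup.map U.toSubgroup V.toSubgroup (MonoidHom.id G) h) (groupRingMap p U r) =
      groupRingMap p V r := by
  have : (MonoidAlgebra.mapDomainRingHom ℤ_[p]
      (QuotientGroup.map U.toSubgroup V.toSubgroup (MonoidHom.id G) h)).comp (groupRingMap p U) =
      groupRingMap p V := by
    unfold groupRingMap
    rw [← RingHom.comp_assoc, ← MonoidAlgebra.mapDomainRingHom_comp]
    rfl
  exact RingHom.congr_fun this r

theorem approx_anti (x : CompletedGroupAlgebra p G) {U V : OpenNormalSubgroup G} {n m : ℕ}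
    (h : U.toSubgroup ≤ V.toSubgroup) (hnm : m ≤ n) : approx x (U, n) ⊆ approx x (V, m) := by
  rintro r ⟨c, hc⟩
  refine ⟨(p ^ (n - m) : ℕ) • MonoidAlgebra.mapDomainRingHom ℤ_[p]
      (QuotientGroup.map U.toSubgroup V.toSubgroup (MonoidHom.id G) h) c, ?_⟩
  rw [← x.2 U V h, hc, map_add, map_groupRingMap, map_nsmul, smul_smul, ← pow_add]
  congr 4
  simp only
  omega

theorem hasBasis_approxFilter (x : CompletedGroupAlgebra p G) :
    (approxFilter x).HasBasis (fun _ => True) (approx x) := by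
  have : Nonempty (OpenNormalSubgroup G × ℕ) := ⟨({ toSubgroup := ⊤, isOpen' := isOpen_univ }, 0)⟩
  refine hasBasis_iInf_principal fun i j => ⟨(i.1 ⊓ j.1, max i.2 j.2), ?_, ?_⟩
  · exact approx_anti x (fun g hg => hg.1) (le_max_left _ _)
  · exact approx_anti x (fun g hg => hg.2) (le_max_right _ _)

theorem approx_nonempty (x : CompletedGroupAlgebra p G) (i : OpenNormalSubgroup G × ℕ) :
    (approx x i).Nonempty := by
  suffices h : ∀ y : MonoidAlgebra ℤ_[p] (G ⧸ i.1.toSubgroup), ∃ r,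
      ∃ c : MonoidAlgebra ℤ_[p] (G ⧸ i.1.toSubgroup), y = groupRingMap p i.1 r + (p ^ i.2 : ℕ) • c
    from h _
  intro y
  induction y using MonoidAlgebra.induction_on with
  | of q =>
    obtain ⟨g, rfl⟩ := QuotientGroup.mk_surjective q
    exact ⟨MonoidAlgebra.single g 1, 0, by simp [groupRingMap]⟩
  | add y z hy hz =>
    obtain ⟨r, c, rfl⟩ := hy
    obtain ⟨s, d, rfl⟩ := hz
    exact ⟨r + s, c + d, by rw [map_add, smul_add]; abel⟩
  | smul a y hy =>
    obtain ⟨r, c, rfl⟩ := hy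
    obtain ⟨b, hb⟩ := Ideal.mem_span_singleton'.1 (PadicInt.appr_spec i.2 a)
    have ha : a = (a.appr i.2 : ℤ_[p]) + b * (p ^ i.2 : ℕ) := by
      rw [Nat.cast_pow, hb]; ring
    refine ⟨a.appr i.2 • r, a • c + b • groupRingMap p i.1 r, ?_⟩
    rw [smul_add, smul_add, map_nsmul]
    conv_lhs => enter [1]; rw [ha, add_smul, mul_smul, Nat.cast_smul_eq_nsmul,
      Nat.cast_smul_eq_nsmul, smul_comm]
    rw [smul_comm a]
    abel

instance approxFilter_neBot (x : CompletedGroupAlgebra p G) : (approxFilter x).NeBot :=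
  (hasBasis_approxFilter x).neBot_iff.2 fun _ => approx_nonempty x _

theorem approx_inf_left (x : CompletedGroupAlgebra p G) (i j : OpenNormalSubgroup G × ℕ) :
    approx x (i.1 ⊓ j.1, max i.2 j.2) ⊆ approx x i :=
  approx_anti x (fun _ hg => hg.1) (le_max_left _ _)

theorem approx_inf_right (x : CompletedGroupAlgebra p G) (i j : OpenNormalSubgroup G × ℕ) :
    approx x (i.1 ⊓ j.1, max i.2 j.2) ⊆ approx x j :=
  approx_anti x (fun _ hg => hg.2) (le_max_right _ _)

theorem approx_zero (i : OpenNormalSubgroup G × ℕ) :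
    0 ∈ approx (0 : CompletedGroupAlgebra p G) i :=
  ⟨0, by simp⟩

theorem approx_one (i : OpenNormalSubgroup G × ℕ) :
    1 ∈ approx (1 : CompletedGroupAlgebra p G) i :=
  ⟨0, by simp⟩

theorem approx_add {x y : CompletedGroupAlgebra p G} {i : OpenNormalSubgroup G × ℕ}
    {r s : MonoidAlgebra ℤ G} (hr : r ∈ approx x i) (hs : s ∈ approx y i) :
    r + s ∈ approx (x + y) i := by
  obtain ⟨c, hc⟩ := hr
  obtain ⟨d, hd⟩ := hs
  refine ⟨c + d, ?_⟩
  rw [Subring.coe_add, Pi.add_apply, hc, hd, map_add, smul_add]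
  abel

theorem approx_mul {x y : CompletedGroupAlgebra p G} {i : OpenNormalSubgroup G × ℕ}
    {r s : MonoidAlgebra ℤ G} (hr : r ∈ approx x i) (hs : s ∈ approx y i) :
    r * s ∈ approx (x * y) i := by
  obtain ⟨c, hc⟩ := hr
  obtain ⟨d, hd⟩ := hs
  refine ⟨groupRingMap p i.1 r * d + c * y.1 i.1, ?_⟩
  rw [Subring.coe_mul, Pi.mul_apply, hc, add_mul]
  conv_lhs => enter [1]; rw [hd]
  rw [mul_add, map_mul, mul_smul_comm, smul_mul_assoc, smul_add, add_assoc]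

end CompletedGroupAlgebra

/-- An abelian pro-`p` group, written additively: a compact Hausdorff abelian group
in which the open subgroups of `p`-power index form a neighbourhood basis of `0`. -/
class IsProPAddCommGroup (p : ℕ) (A : Type*) [AddCommGroup A] [TopologicalSpace A] : Prop where
  nonarchimedean : NonarchimedeanAddGroup A
  compactSpace : CompactSpace A
  t2Space : T2Space A
  exists_pow_smul_mem : ∀ V : AddSubgroup A, IsOpen (V : Set A) → ∃ n : ℕ, ∀ a : A, p ^ n • a ∈ V

namespace CompletedGroupAlgebra

variable {p G}
variable {A : Type*} [AddCommGroup A]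

variable (G A) in
/-- The action of the group ring `ℤ[G]` on a `G`-module `A`. -/
noncomputable def groupRingAct [DistribMulAction G A] : MonoidAlgebra ℤ G →+* AddMonoid.End A :=
  (MonoidAlgebra.lift ℤ (AddMonoid.End A) G (DistribMulAction.toAddMonoidEnd G A)).toRingHom

theorem groupRingAct_single [DistribMulAction G A] (g : G) (n : ℤ) (a : A) :
    groupRingAct G A (MonoidAlgebra.single g n) a = n • g • a := by
  simp only [groupRingAct, AlgHom.toRingHom_eq_coe, RingHom.coe_coe, MonoidAlgebra.lift_single]
  rfl

/-- The action of `Λ(G)` on an abelian pro-`p` group `A` with continuous `G`-action, obtained from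
the action of `ℤ[G]` by continuity: `x • a = lim r • a`, for `r ∈ ℤ[G]` tending to `x`. -/
noncomputable def act [DistribMulAction G A] [TopologicalSpace A] (x : CompletedGroupAlgebra p G)
    (a : A) : A :=
  haveI : Nonempty A := ⟨a⟩
  limUnder (approxFilter x) fun r => groupRingAct G A r a

/-- `V` is a `G`-stable open subgroup of `A` such that `A/V` is killed by `p^n` and on which the
subgroup `U` acts trivially, where `i = (U, n)`. -/
structure Controls [DistribMulAction G A] [TopologicalSpace A] (i : OpenNormalSubgroup G × ℕ)
    (p : ℕ) (V : AddSubgroup A) : Prop where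
  isOpen : IsOpen (V : Set A)
  smul_mem : ∀ (g : G) (a : A), a ∈ V → g • a ∈ V
  sub_mem : ∀ g ∈ i.1.toSubgroup, ∀ a : A, g • a - a ∈ V
  pow_mem : ∀ a : A, p ^ i.2 • a ∈ V

theorem groupRingAct_mem_of_stable [DistribMulAction G A] {V : AddSubgroup A}
    (hV : ∀ (g : G) (a : A), a ∈ V → g • a ∈ V) (r : MonoidAlgebra ℤ G) {a : A} (ha : a ∈ V) :
    groupRingAct G A r a ∈ V := by
  induction r using MonoidAlgebra.induction_on with
  | of g => simpa [MonoidAlgebra.of_apply, groupRingAct_single] using hV g a ha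
  | add r s hr hs => rw [map_add]; exact V.add_mem hr hs
  | smul n r hr => rw [map_zsmul]; exact V.zsmul_mem hr n

theorem Controls.act_mem [DistribMulAction G A] [TopologicalSpace A]
    {i : OpenNormalSubgroup G × ℕ} {V : AddSubgroup A} (hV : Controls i p V)
    {r : MonoidAlgebra ℤ G} (hr : r ∈ approx (0 : CompletedGroupAlgebra p G) i) (a : A) :
    groupRingAct G A r a ∈ V := by
  classical
  obtain ⟨c, hc⟩ := hr
  -- the action on `a` modulo `V` factors through `ℤ[G/U]`
  let φ : (G ⧸ i.1.toSubgroup) → A ⧸ V := fun q => QuotientAddGroup.mk (q.out • a)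
  have hφ : ∀ g : G, (QuotientAddGroup.mk (g • a) : A ⧸ V) = φ (QuotientGroup.mk g) := by
    intro g
    obtain ⟨h, hh⟩ := QuotientGroup.mk_out_eq_mul i.1.toSubgroup g
    simp only [φ, hh]
    rw [QuotientAddGroup.eq, mul_smul]
    have := hV.smul_mem g _ (hV.sub_mem h.1 h.2 a)
    rw [smul_sub] at this
    rwa [neg_add_eq_sub]
  let Φ : ((G ⧸ i.1.toSubgroup) →₀ ℤ) →+ A ⧸ V :=
    Finsupp.liftAddHom fun q => (zmultiplesHom (A ⧸ V)) (φ q)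
  have hΦ : ∀ s : MonoidAlgebra ℤ G, (QuotientAddGroup.mk (groupRingAct G A s a) : A ⧸ V) =
      Φ (s.coeff.mapDomain (QuotientGroup.mk)) := by
    intro s
    induction s using MonoidAlgebra.induction_on with
    | of g => simp [MonoidAlgebra.of_apply, groupRingAct_single, hφ, Φ]
    | add r s hr hs =>
      rw [map_add, MonoidAlgebra.coeff_add, Finsupp.mapDomain_add, map_add, ← hr, ← hs]; rfl
    | smul n r hr =>
      rw [map_zsmul, MonoidAlgebra.coeff_smul, Finsupp.mapDomain_smul, map_zsmul, ← hr]; rfl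
  rw [← QuotientAddGroup.eq_zero_iff, hΦ]
  -- its coefficients are divisible by `p ^ n`
  have hdvd : ∀ q, ((p ^ i.2 : ℕ) : ℤ) ∣ (r.coeff.mapDomain QuotientGroup.mk :
      (G ⧸ i.1.toSubgroup) →₀ ℤ) q := by
    intro q
    have h := congrArg (fun y => y.coeff q) hc
    simp only [ZeroMemClass.coe_zero, Pi.zero_apply, MonoidAlgebra.coeff_add,
      MonoidAlgebra.coeff_zero, Finsupp.add_apply, Finsupp.zero_apply, MonoidAlgebra.coeff_smul,
      Finsupp.smul_apply, coeff_groupRingMap] at h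
    rw [nsmul_eq_mul, Nat.cast_pow] at h
    rw [Nat.cast_pow, ← PadicInt.norm_int_le_pow_iff_dvd, PadicInt.norm_le_pow_iff_mem_span_pow,
      Ideal.mem_span_singleton]
    exact ⟨-c.coeff q, by rw [mul_neg]; exact eq_neg_of_add_eq_zero_left h.symm⟩
  rw [Finsupp.liftAddHom_apply]
  refine Finset.sum_eq_zero fun q _ => ?_
  obtain ⟨k, hk⟩ := hdvd q
  simp only [hk, zmultiplesHom_apply, mul_comm _ k, mul_smul, natCast_zsmul]
  rw [← QuotientAddGroup.mk_nsmul, (QuotientAddGroup.eq_zero_iff _).2 (hV.pow_mem _), smul_zero]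

variable [TopologicalSpace A]

theorem exists_controls [IsTopologicalGroup G] [CompactSpace G] [IsProPAddCommGroup p A]
    [DistribMulAction G A] [ContinuousSMul G A] {W : Set A} (hW : W ∈ 𝓝 (0 : A)) :
    ∃ (i : OpenNormalSubgroup G × ℕ) (V : AddSubgroup A), Controls i p V ∧ (V : Set A) ⊆ W := by
  have := IsProPAddCommGroup.nonarchimedean p (A := A)
  have := IsProPAddCommGroup.compactSpace p (A := A)
  obtain ⟨V₀, hV₀⟩ := NonarchimedeanAddGroup.is_nonarchimedean W hW
  let V : AddSubgroup A :=
    { carrier := {a | ∀ g : G, g • a ∈ V₀}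
      zero_mem' := fun g => by simp [zero_mem]
      add_mem' := fun ha hb g => by rw [smul_add]; exact add_mem (ha g) (hb g)
      neg_mem' := fun ha g => by rw [smul_neg]; exact neg_mem (ha g) }
  have hVs : ∀ (g : G) (a : A), a ∈ V → g • a ∈ V := fun g a ha h => by
    rw [smul_smul]; exact ha _
  have hVo : IsOpen (V : Set A) := by
    refine AddSubgroup.isOpen_of_mem_nhds V (g := 0) ?_
    obtain ⟨_, v, _, hv, hu, h0, huv⟩ := generalized_tube_lemma (isCompact_univ (X := G))
      (isCompact_singleton (x := (0 : A)))
      (n := (fun x : G × A => x.1 • x.2) ⁻¹' V₀) (V₀.isOpen.preimage continuous_smul) (by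
        rintro ⟨g, a⟩ ⟨-, ha⟩
        obtain rfl : a = 0 := ha
        simp [zero_mem])
    refine mem_of_superset (hv.mem_nhds (h0 rfl)) fun a ha g => ?_
    exact huv (Set.mk_mem_prod (hu trivial) ha)
  let K : Subgroup G :=
    { carrier := {g | ∀ a : A, g • a - a ∈ V}
      one_mem' := fun a => by simp [zero_mem]
      mul_mem' := fun {g h} hg hh a => by
        have := add_mem (hg (h • a)) (hh a)
        rwa [sub_add_sub_cancel, smul_smul] at this
      inv_mem' := fun {g} hg a => by
        have := neg_mem (hg (g⁻¹ • a))
        rwa [smul_inv_smul, neg_sub] at this }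
  have hK : IsOpen (K : Set G) := by
    refine Subgroup.isOpen_of_mem_nhds K (g := 1) ?_
    obtain ⟨u, _, hu, _, h1, hv, huv⟩ := generalized_tube_lemma
      (isCompact_singleton (x := (1 : G))) (isCompact_univ (X := A))
      (n := (fun x : G × A => x.1 • x.2 - x.2) ⁻¹' V)
      (hVo.preimage (continuous_smul.sub continuous_snd)) (by
        rintro ⟨g, a⟩ ⟨hg, -⟩
        obtain rfl : g = 1 := hg
        simp [zero_mem])
    refine mem_of_superset (hu.mem_nhds (h1 rfl)) fun g hg a => ?_
    exact huv (Set.mk_mem_prod hg (hv trivial))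
  have hKn : K.Normal := ⟨fun g hg h a => by
    have := hVs h _ (hg (h⁻¹ • a))
    rwa [smul_sub, smul_inv_smul, smul_smul, smul_smul] at this⟩
  obtain ⟨n, hn⟩ := IsProPAddCommGroup.exists_pow_smul_mem (p := p) V hVo
  exact ⟨({ toSubgroup := K, isOpen' := hK, isNormal' := hKn }, n), V,
    ⟨hVo, hVs, fun g hg a => hg a, hn⟩, fun a ha => hV₀ (by simpa using ha 1)⟩

theorem Controls.sub_mem_of_approx [DistribMulAction G A]
    {i : OpenNormalSubgroup G × ℕ} {V : AddSubgroup A} (hV : Controls i p V)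
    {x : CompletedGroupAlgebra p G} {r s : MonoidAlgebra ℤ G} (hr : r ∈ approx x i)
    (hs : s ∈ approx x i) (a : A) : groupRingAct G A r a - groupRingAct G A s a ∈ V := by
  have h : r - s ∈ approx (0 : CompletedGroupAlgebra p G) i := by
    obtain ⟨c, hc⟩ := hr
    obtain ⟨d, hd⟩ := hs
    refine ⟨c - d, ?_⟩
    rw [map_sub, smul_sub, eq_sub_of_add_eq hc.symm, eq_sub_of_add_eq hd.symm]
    simp only [ZeroMemClass.coe_zero, Pi.zero_apply]
    abel
  have := hV.act_mem h a
  rwa [map_sub] at this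

variable [IsTopologicalGroup G] [CompactSpace G] [IsProPAddCommGroup p A]
variable [DistribMulAction G A] [ContinuousSMul G A]

theorem tendsto_act (x : CompletedGroupAlgebra p G) (a : A) :
    Tendsto (fun r => groupRingAct G A r a) (approxFilter x) (𝓝 (act x a)) := by
  have := IsProPAddCommGroup.nonarchimedean p (A := A)
  have := IsProPAddCommGroup.compactSpace p (A := A)
  refine tendsto_nhds_limUnder ?_
  obtain ⟨y, hy⟩ := exists_clusterPt_of_compactSpace
    (map (fun r => groupRingAct G A r a) (approxFilter x))
  refine ⟨y, fun W hW => ?_⟩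
  have hW' : (fun b => y + b) ⁻¹' W ∈ 𝓝 (0 : A) :=
    (continuous_const_add y).continuousAt.preimage_mem_nhds (by simpa using hW)
  obtain ⟨i, V, hV, hVW⟩ := exists_controls (p := p) (G := G) hW'
  have hyV : (fun b => b - y) ⁻¹' (V : Set A) ∈ 𝓝 y :=
    (continuous_sub_right y).continuousAt.preimage_mem_nhds
      (by simpa using hV.isOpen.mem_nhds V.zero_mem)
  have hi := (hasBasis_approxFilter x).mem_of_mem (i := i) trivial
  obtain ⟨_, hb, s, hs, rfl⟩ := clusterPt_iff_nonempty.1 hy hyV (image_mem_map hi)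
  refine mem_map.2 (mem_of_superset hi fun r hr => ?_)
  have h := V.add_mem (hV.sub_mem_of_approx hr hs a) hb
  rw [sub_add_sub_cancel] at h
  simpa using hVW h

theorem exists_approx_act (x : CompletedGroupAlgebra p G) (a : A) {W : Set A}
    (hW : W ∈ 𝓝 (0 : A)) : ∃ i, ∀ r ∈ approx x i, groupRingAct G A r a - act x a ∈ W := by
  have := IsProPAddCommGroup.nonarchimedean p (A := A)
  have hW' : (fun b => b - act x a) ⁻¹' W ∈ 𝓝 (act x a) :=
    (continuous_sub_right _).continuousAt.preimage_mem_nhds (by simpa using hW)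
  obtain ⟨i, -, hi⟩ := (hasBasis_approxFilter x).mem_iff.1 (tendsto_act x a hW')
  exact ⟨i, fun r hr => hi hr⟩

variable (p G) in
theorem eq_of_forall_sub_mem {a b : A}
    (h : ∀ (i : OpenNormalSubgroup G × ℕ) (V : AddSubgroup A), Controls i p V → a - b ∈ V) :
    a = b := by
  have := IsProPAddCommGroup.t2Space p (A := A)
  by_contra hab
  obtain ⟨i, V, hV, hVW⟩ := exists_controls (p := p) (G := G)
    (isOpen_compl_singleton.mem_nhds (Ne.symm (sub_ne_zero.2 hab)))
  exact hVW (h i V hV) rfl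

theorem eq_act_of_forall {x : CompletedGroupAlgebra p G} {a b : A}
    (h : ∀ (i : OpenNormalSubgroup G × ℕ) (V : AddSubgroup A), Controls i p V →
      ∀ j, ∃ r ∈ approx x j, groupRingAct G A r a - b ∈ V) : act x a = b := by
  refine eq_of_forall_sub_mem p G fun i V hV => ?_
  obtain ⟨j, hj⟩ := exists_approx_act x a (hV.isOpen.mem_nhds V.zero_mem)
  obtain ⟨r, hr, hrV⟩ := h i V hV j
  have := V.sub_mem hrV (hj r hr)
  rwa [sub_sub_sub_cancel_left] at this

variable (p G A) in
/-- The `Λ(G)`-module structure on an abelian pro-`p` group with a continuous action of `G`. -/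
noncomputable abbrev module : Module (CompletedGroupAlgebra p G) A where
  smul := act
  one_smul a := eq_act_of_forall fun i V _ j => ⟨1, approx_one j, by
    rw [map_one, AddMonoid.End.one_apply, sub_self]; exact V.zero_mem⟩
  mul_smul x y a := eq_act_of_forall fun i V hV j => by
    obtain ⟨k, hk⟩ := exists_approx_act y a (hV.isOpen.mem_nhds V.zero_mem)
    obtain ⟨l, hl⟩ := exists_approx_act x (act y a) (hV.isOpen.mem_nhds V.zero_mem)
    obtain ⟨r, hr⟩ := approx_nonempty x (j.1 ⊓ l.1, max j.2 l.2)
    obtain ⟨s, hs⟩ := approx_nonempty y (j.1 ⊓ k.1, max j.2 k.2)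
    refine ⟨r * s, approx_mul (approx_inf_left x j l hr) (approx_inf_left y j k hs), ?_⟩
    have h1 := groupRingAct_mem_of_stable hV.smul_mem r (hk s (approx_inf_right y j k hs))
    have h2 := V.add_mem h1 (hl r (approx_inf_right x j l hr))
    rw [map_sub, sub_add_sub_cancel] at h2
    rw [map_mul]
    exact h2
  smul_zero x := eq_act_of_forall fun i V _ j => by
    obtain ⟨r, hr⟩ := approx_nonempty x j
    exact ⟨r, hr, by rw [map_zero, sub_self]; exact V.zero_mem⟩
  smul_add x a b := eq_act_of_forall fun i V hV j => by
    obtain ⟨k, hk⟩ := exists_approx_act x a (hV.isOpen.mem_nhds V.zero_mem)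
    obtain ⟨l, hl⟩ := exists_approx_act x b (hV.isOpen.mem_nhds V.zero_mem)
    obtain ⟨r, hr⟩ := approx_nonempty x
      (j.1 ⊓ (k.1 ⊓ l.1), max j.2 (max k.2 l.2))
    have hr' := approx_inf_right x j (k.1 ⊓ l.1, max k.2 l.2) hr
    refine ⟨r, approx_inf_left x j (k.1 ⊓ l.1, max k.2 l.2) hr, ?_⟩
    have := V.add_mem (hk r (approx_inf_left x k l hr')) (hl r (approx_inf_right x k l hr'))
    rw [sub_add_sub_comm, ← map_add] at this
    exact this
  add_smul x y a := eq_act_of_forall fun i V hV j => by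
    obtain ⟨k, hk⟩ := exists_approx_act x a (hV.isOpen.mem_nhds V.zero_mem)
    obtain ⟨l, hl⟩ := exists_approx_act y a (hV.isOpen.mem_nhds V.zero_mem)
    obtain ⟨r, hr⟩ := approx_nonempty x (j.1 ⊓ k.1, max j.2 k.2)
    obtain ⟨s, hs⟩ := approx_nonempty y (j.1 ⊓ l.1, max j.2 l.2)
    refine ⟨r + s, approx_add (approx_inf_left x j k hr) (approx_inf_left y j l hs), ?_⟩
    have := V.add_mem (hk r (approx_inf_right x j k hr)) (hl s (approx_inf_right y j l hs))
    rw [sub_add_sub_comm] at this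
    rw [map_add]
    exact this
  zero_smul a := eq_act_of_forall fun i V _ j => ⟨0, approx_zero j, by
    rw [map_zero, AddMonoid.End.zero_apply, sub_self]; exact V.zero_mem⟩

end CompletedGroupAlgebra

end CompletedGroupAlgebra
section ProP

/-- A pro-`p` group: a compact totally disconnected topological group
all of whose quotients by open normal subgroups are (finite) `p`-groups. -/
class IsProP (p : ℕ) (G : Type*) [Group G] [TopologicalSpace G] [IsTopologicalGroup G] : Prop where
  compactSpace : CompactSpace G
  totallyDisconnectedSpace : TotallyDisconnectedSpace G
  isPGroup_quotient : ∀ U : OpenNormalSubgroup G, IsPGroup p (G ⧸ U.toSubgroup)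

/-- `F` is a free pro-`p` group with basis `x₁, …, x_n`: it is a pro-`p` group and every map from the
basis to a finite `p`-group extends uniquely to a continuous homomorphism. -/
structure IsFreeProP (p : ℕ) {n : ℕ} {F : Type*} [Group F] [TopologicalSpace F]
    [IsTopologicalGroup F] (x : Fin n → F) : Prop where
  isProP : IsProP p F
  existsUnique_lift : ∀ (P : Type) [Group P] [Finite P] [TopologicalSpace P] [DiscreteTopology P],
    IsPGroup p P → ∀ y : Fin n → P, ∃! φ : F →ₜ* P, ∀ i, φ (x i) = y i

/-- `G` is finitely presented as a pro-`p` group: it is the quotient of a free pro-`p` group `F` of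
finite rank by the closed normal subgroup generated by a finite set of relators. -/
def IsFinitelyPresentedProP (p : ℕ) (G : Type*) [Group G] [TopologicalSpace G]
    [IsTopologicalGroup G] : Prop :=
  ∃ (n : ℕ) (F : Type) (_ : Group F) (_ : TopologicalSpace F) (_ : IsTopologicalGroup F)
    (x : Fin n → F) (π : F →ₜ* G) (R : Set F), IsFreeProP p x ∧ Function.Surjective π ∧
      R.Finite ∧ π.toMonoidHom.ker = (Subgroup.normalClosure R).topologicalClosure

end ProP

section Cohomology

universe u

/-- The abelian group `A`, as a discrete topological group. -/
def DiscreteCoeff (A : Type) : Type u := ULift.{u} A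

namespace DiscreteCoeff

variable (A : Type)

instance [AddCommGroup A] : AddCommGroup (DiscreteCoeff.{u} A) :=
  inferInstanceAs (AddCommGroup (ULift.{u} A))

instance : TopologicalSpace (DiscreteCoeff.{u} A) := ⊥

instance : DiscreteTopology (DiscreteCoeff.{u} A) := ⟨rfl⟩

end DiscreteCoeff

/-- The continuous cohomology group `H^n(G, A)` of a topological group `G` with values in a discrete
abelian group `A` with trivial action. -/
noncomputable abbrev trivialCohomology (G : Type u) [Group G] [TopologicalSpace G]
    [IsTopologicalGroup G] (A : Type) [AddCommGroup A] (n : ℕ) : TopModuleCat ℤ :=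
  continuousCohomology n
    (TopRep.of (ContRepresentation.trivial ℤ G (DiscreteCoeff.{u} A)))

/-- The abelian group `ℚ_p/ℤ_p`. -/
abbrev QpModZp (p : ℕ) [Fact p.Prime] : Type := ℚ_[p] ⧸ (PadicInt.subring p).toAddSubgroup

/-- `cd(G) ≤ n` for a pro-`p` group `G`: the groups `H^k(G, 𝔽_p)`, `k > n`, vanish. -/
def CohomologicalDimensionLE (p : ℕ) (G : Type u) [Group G] [TopologicalSpace G]
    [IsTopologicalGroup G] (n : ℕ) : Prop :=
  ∀ k, n < k → Subsingleton (trivialCohomology G (ZMod p) k)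

end Cohomology

section Homology

variable (p : ℕ) [Fact p.Prime]

/-- The differential of the bar complex (inhomogeneous chains) of a group `Q` with coefficients in
the trivial module `ℤ_p`:
`d(g_0, …, g_n) = (g_1, …, g_n) + ∑_{j<n} (-1)^{j+1} (…, g_j g_{j+1}, …) + (-1)^{n+1} (g_0, …, g_{n-1})`.
-/
noncomputable def barDifferential (Q : Type*) [Group Q] (n : ℕ) :
    ((Fin (n + 1) → Q) →₀ ℤ_[p]) →ₗ[ℤ_[p]] ((Fin n → Q) →₀ ℤ_[p]) :=
  Finsupp.lsum ℤ_[p] fun g => Finsupp.lsingle (fun i => g i.succ) +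
    ∑ j : Fin (n + 1), (-1 : ℤ_[p]) ^ ((j : ℕ) + 1) • Finsupp.lsingle (Fin.contractNth j (· * ·) g)

theorem barDifferential_single (Q : Type*) [Group Q] (n : ℕ) (g : Fin (n + 1) → Q) (a : ℤ_[p]) :
    barDifferential p Q n (Finsupp.single g a) = Finsupp.single (fun i => g i.succ) a +
      ∑ j : Fin (n + 1),
        (-1 : ℤ_[p]) ^ ((j : ℕ) + 1) • Finsupp.single (Fin.contractNth j (· * ·) g) a := by
  simp [barDifferential]

theorem barDifferential_mapDomain {Q R : Type*} [Group Q] [Group R] (f : Q →* R) (n : ℕ)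
    (z : (Fin (n + 1) → Q) →₀ ℤ_[p]) :
    barDifferential p R n (z.mapDomain (f ∘ ·)) = (barDifferential p Q n z).mapDomain (f ∘ ·) := by
  induction z using Finsupp.induction_linear with
  | zero => simp
  | add x y hx hy => simp [Finsupp.mapDomain_add, hx, hy]
  | single g a =>
    simp only [Finsupp.mapDomain_single, barDifferential_single, Finsupp.mapDomain_add,
      Finsupp.mapDomain_finsetSum, Finsupp.mapDomain_smul]
    congr 1
    refine Finset.sum_congr rfl fun j _ => ?_
    congr 2
    exact (Fin.comp_contractNth _ _ (map_mul f) _ _).symm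

variable (G : Type*) [Group G] [TopologicalSpace G]

/-- `ℤ_p[[G^n]] = lim_U ℤ_p[(G/U)^n]`, the limit running over the open normal subgroups `U` of `G`,
as a submodule of the product. -/
def profiniteChains (n : ℕ) :
    Submodule ℤ_[p] (∀ U : OpenNormalSubgroup G, (Fin n → G ⧸ U.toSubgroup) →₀ ℤ_[p]) where
  carrier := {z | ∀ (U V : OpenNormalSubgroup G) (h : U.toSubgroup ≤ V.toSubgroup),
    (z U).mapDomain (QuotientGroup.map U.toSubgroup V.toSubgroup (MonoidHom.id G) h ∘ ·) = z V}
  add_mem' hx hy U V h := by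
    rw [Pi.add_apply, Finsupp.mapDomain_add, hx U V h, hy U V h, Pi.add_apply]
  zero_mem' U V h := by rw [Pi.zero_apply, Finsupp.mapDomain_zero, Pi.zero_apply]
  smul_mem' a x hx U V h := by
    rw [Pi.smul_apply, Finsupp.mapDomain_smul, hx U V h, Pi.smul_apply]

/-- The module `ℤ_p[[G^n]]` of profinite `n`-chains of `G`. -/
def ProfiniteChains (n : ℕ) : Type _ := profiniteChains p G n

noncomputable instance (n : ℕ) : AddCommGroup (ProfiniteChains p G n) :=
  inferInstanceAs (AddCommGroup (profiniteChains p G n))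

noncomputable instance (n : ℕ) : Module ℤ_[p] (ProfiniteChains p G n) :=
  inferInstanceAs (Module ℤ_[p] (profiniteChains p G n))

/-- The differential `ℤ_p[[G^{n+1}]] → ℤ_p[[G^n]]`, the inverse limit of the bar differentials. -/
noncomputable def profiniteDifferential (n : ℕ) :
    ProfiniteChains p G (n + 1) →ₗ[ℤ_[p]] ProfiniteChains p G n where
  toFun z := ⟨fun U => barDifferential p (G ⧸ U.toSubgroup) n (z.1 U), fun U V h => by
    rw [← barDifferential_mapDomain, z.2 U V h]⟩
  map_add' x y := Subtype.ext <| funext fun U => map_add (barDifferential p (G ⧸ U.toSubgroup) n) _ _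
  map_smul' a x := Subtype.ext <| funext fun U =>
    map_smul (barDifferential p (G ⧸ U.toSubgroup) n) a _

/-- The `n`-cycles in the complex of profinite chains. -/
noncomputable def profiniteCycles : (n : ℕ) → Submodule ℤ_[p] (ProfiniteChains p G n)
  | 0 => ⊤
  | n + 1 => LinearMap.ker (profiniteDifferential p G n)

/-- The homology group `H_n(G, ℤ_p)` of a profinite group `G` with coefficients in the trivial
compact module `ℤ_p`, computed by the bar complex `⋯ → ℤ_p[[G^2]] → ℤ_p[[G]] → ℤ_p`. -/
abbrev ProfiniteHomology (n : ℕ) : Type _ :=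
  profiniteCycles p G n ⧸
    (LinearMap.range (profiniteDifferential p G n)).submoduleOf (profiniteCycles p G n)

end Homology

section Abelianization

theorem commutatorClosure_le_comap {G K : Type*} [Group G] [TopologicalSpace G]
    [IsTopologicalGroup G] [Group K] [TopologicalSpace K] [IsTopologicalGroup K] (f : G →* K)
    (hf : Continuous f) :
    (commutator G).topologicalClosure ≤ (commutator K).topologicalClosure.comap f := by
  refine Subgroup.topologicalClosure_minimal _ ?_
    ((Subgroup.isClosed_topologicalClosure _).preimage hf)
  rw [commutator_def, Subgroup.commutator_le]
  intro a _ b _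
  rw [Subgroup.mem_comap, map_commutatorElement]
  exact Subgroup.le_topologicalClosure _
    (Subgroup.commutator_mem_commutator (Subgroup.mem_top _) (Subgroup.mem_top _))

/-- The homomorphism `G^ab → K^ab` of topological abelianizations induced by a continuous
homomorphism `G → K`. -/
noncomputable def abelianizationMap {G K : Type*} [Group G] [TopologicalSpace G]
    [IsTopologicalGroup G] [Group K] [TopologicalSpace K] [IsTopologicalGroup K] (f : G →* K)
    (hf : Continuous f) : TopologicalAbelianization G →* TopologicalAbelianization K :=
  QuotientGroup.map _ _ f (commutatorClosure_le_comap f hf)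

/-- The `ℤ_p`-torsion subgroup of an abelian pro-`p` group: since every nonzero element of `ℤ_p` is a
unit times a power of `p`, it consists of the elements killed by some power of `p`. -/
abbrev zpTorsion (p : ℕ) (A : Type*) [CommGroup A] : Subgroup A := CommGroup.primaryComponent A p

/-- The natural map `Tor_{ℤ_p} G^ab → (G/H)^ab`. -/
noncomputable def torsionMap (p : ℕ) {G : Type*} [Group G] [TopologicalSpace G]
    [IsTopologicalGroup G] (H : Subgroup G) [H.Normal] :
    zpTorsion p (TopologicalAbelianization G) →* TopologicalAbelianization (G ⧸ H) :=
  (abelianizationMap (QuotientGroup.mk' H) QuotientGroup.continuous_mk).comp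
    (zpTorsion p (TopologicalAbelianization G)).subtype

variable {G : Type*} [Group G] [TopologicalSpace G] [IsTopologicalGroup G]

/-- The topological abelianization `H^ab` of a subgroup `H` of `G`, written additively. -/
abbrev AbSubgroup (H : Subgroup G) : Type _ := Additive (TopologicalAbelianization H)

namespace AbSubgroup

variable (H : Subgroup G)

theorem continuous_conjNormal [H.Normal] (g : G) : Continuous (MulAut.conjNormal (H := H) g) :=
  Continuous.subtype_mk (by fun_prop) _

/-- The action of `G` on `H^ab` by conjugation. -/
noncomputable def conjHom [H.Normal] : G →* AddMonoid.End (AbSubgroup H) where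
  toFun g := MonoidHom.toAdditive (abelianizationMap (MulAut.conjNormal (H := H) g).toMonoidHom
    (continuous_conjNormal H g))
  map_one' := by
    refine AddMonoidHom.ext fun x => ?_
    obtain ⟨h, hh⟩ := QuotientGroup.mk_surjective x.toMul
    obtain rfl : x = Additive.ofMul (QuotientGroup.mk h) := by rw [hh]; rfl
    change Additive.ofMul (QuotientGroup.mk (MulAut.conjNormal 1 h)) = _
    rw [map_one]
    rfl
  map_mul' g₁ g₂ := by
    refine AddMonoidHom.ext fun x => ?_
    obtain ⟨h, hh⟩ := QuotientGroup.mk_surjective x.toMul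
    obtain rfl : x = Additive.ofMul (QuotientGroup.mk h) := by rw [hh]; rfl
    change Additive.ofMul (QuotientGroup.mk (MulAut.conjNormal (g₁ * g₂) h)) = _
    rw [map_mul]
    rfl

theorem conjHom_mk [H.Normal] (g : G) (h : H) :
    conjHom H g (Additive.ofMul (QuotientGroup.mk h)) =
      Additive.ofMul (QuotientGroup.mk (MulAut.conjNormal g h)) := rfl

theorem conjHom_eq_one [H.Normal] {g : G} (hg : g ∈ H) : conjHom H g = 1 := by
  refine AddMonoidHom.ext fun x => ?_
  obtain ⟨h, hh⟩ := QuotientGroup.mk_surjective x.toMul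
  obtain rfl : x = Additive.ofMul (QuotientGroup.mk h) := by rw [hh]; rfl
  change Additive.ofMul (QuotientGroup.mk (MulAut.conjNormal g h)) =
    Additive.ofMul (QuotientGroup.mk h)
  congr 1
  have : MulAut.conjNormal g h = (⟨g, hg⟩ : H) * h * (⟨g, hg⟩ : H)⁻¹ := Subtype.ext (by simp)
  rw [this]
  change (QuotientGroup.mk (⟨g, hg⟩ : H) : TopologicalAbelianization H) * QuotientGroup.mk h *
    (QuotientGroup.mk (⟨g, hg⟩ : H))⁻¹ = QuotientGroup.mk h
  rw [mul_comm, inv_mul_cancel_left]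

/-- The action of `G/H` on `H^ab` induced by conjugation. -/
noncomputable instance [H.Normal] : DistribMulAction (G ⧸ H) (AbSubgroup H) :=
  DistribMulAction.compHom (AbSubgroup H) (QuotientGroup.lift H (conjHom H) fun _ => conjHom_eq_one H)

theorem mk_smul [H.Normal] (g : G) (h : H) :
    (QuotientGroup.mk g : G ⧸ H) • (Additive.ofMul (QuotientGroup.mk h) : AbSubgroup H) =
      Additive.ofMul (QuotientGroup.mk (MulAut.conjNormal g h)) := rfl

instance [H.Normal] : ContinuousSMul (G ⧸ H) (AbSubgroup H) where
  continuous_smul := by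
    have hq : IsOpenQuotientMap (Prod.map (QuotientGroup.mk : G → G ⧸ H)
        (QuotientGroup.mk : H → TopologicalAbelianization H)) :=
      QuotientGroup.isOpenQuotientMap_mk.prodMap QuotientGroup.isOpenQuotientMap_mk
    refine hq.isQuotientMap.continuous_iff.2 ?_
    have hc : Continuous fun x : G × H => MulAut.conjNormal (H := H) x.1 x.2 := by
      refine continuous_induced_rng.2 ?_
      have : Continuous fun x : G × H => x.1 * (x.2 : G) * x.1⁻¹ := by fun_prop
      exact this.congr fun x => (MulAut.conjNormal_apply x.1 x.2).symm
    exact QuotientGroup.continuous_mk.comp hc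

instance (p : ℕ) [Fact p.Prime] [hp : IsProP p G] [hH : IsClosed (H : Set G)] :
    IsProPAddCommGroup p (AbSubgroup H) := by
  have := hp.compactSpace
  have := hp.totallyDisconnectedSpace
  have : CompactSpace H := isCompact_iff_compactSpace.1 hH.isCompact
  have : IsClosed ((commutator H).topologicalClosure : Set H) :=
    Subgroup.isClosed_topologicalClosure _
  refine ⟨⟨fun W hW => ?_⟩, inferInstanceAs (CompactSpace (TopologicalAbelianization H)),
    inferInstanceAs (T2Space (TopologicalAbelianization H)), fun V hV => ?_⟩
  · have hW' : (QuotientGroup.mk : H → TopologicalAbelianization H) ⁻¹' W ∈ 𝓝 1 :=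
      QuotientGroup.continuous_mk.continuousAt.preimage_mem_nhds hW
    obtain ⟨W₀, hW₀, hWo, h1⟩ := mem_nhds_iff.1 hW'
    obtain ⟨N, hN⟩ := ProfiniteGrp.exist_openNormalSubgroup_sub_open_nhds_of_one hWo h1
    refine ⟨{ toAddSubgroup := Subgroup.toAddSubgroup
                (N.toSubgroup.map (QuotientGroup.mk' (commutator H).topologicalClosure))
              isOpen' := QuotientGroup.isOpenMap_coe _ N.isOpen }, ?_⟩
    rintro _ ⟨h, hh, rfl⟩
    exact hW₀ (hN hh)
  · let f : H →* Multiplicative (AbSubgroup H) := QuotientGroup.mk' _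
    have hVo : IsOpen ((V.toSubgroup.comap f : Subgroup H) : Set H) :=
      hV.preimage QuotientGroup.continuous_mk
    obtain ⟨O, hO, hOV⟩ := isOpen_induced_iff.1 hVo
    have h1 : (1 : G) ∈ O := by
      have : (1 : H) ∈ ((↑) : H → G) ⁻¹' O := hOV ▸ one_mem (V.toSubgroup.comap f)
      exact this
    obtain ⟨N, hN⟩ := ProfiniteGrp.exist_openNormalSubgroup_sub_open_nhds_of_one hO h1
    have : Finite (G ⧸ N.toSubgroup) := Subgroup.quotient_finite_of_isOpen _ N.isOpen
    obtain ⟨n, hn⟩ := IsPGroup.iff_card.1 (hp.isPGroup_quotient N)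
    refine ⟨n, fun a => ?_⟩
    obtain ⟨h, hh⟩ := QuotientGroup.mk_surjective a.toMul
    obtain rfl : a = Additive.ofMul (QuotientGroup.mk h) := by rw [hh]; rfl
    have hpow : (h : G) ^ p ^ n ∈ N.toSubgroup := by
      rw [← QuotientGroup.eq_one_iff, QuotientGroup.mk_pow, ← hn]
      exact pow_card_eq_one'
    have hmem : h ^ p ^ n ∈ V.toSubgroup.comap f := by
      have : h ^ p ^ n ∈ ((↑) : H → G) ⁻¹' O := by
        rw [Set.mem_preimage, Subgroup.coe_pow]
        exact hN hpow
      rw [hOV] at this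
      exact this
    exact hmem

/-- The `Λ(G/H)`-module structure on `H^ab`. -/
noncomputable instance (p : ℕ) [Fact p.Prime] [H.Normal] [IsProP p G] [IsClosed (H : Set G)] :
    Module (CompletedGroupAlgebra p (G ⧸ H)) (AbSubgroup H) :=
  haveI := IsProP.compactSpace p (G := G)
  CompletedGroupAlgebra.module p (G ⧸ H) (AbSubgroup H)

end AbSubgroup

end Abelianization

/-!
Write `G` for the quotient `𝒢/ℋ`, `X` for `ℋ^ab`, `Λ` for `Λ(G)` and `X_I` for the closed subgroup
of `X` generated by the elements `g x - x`. Both sides of the equivalence say that the coinvariants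
`X / X_I` have no `p`-torsion.

*Torsion of `𝒢^ab`.* The kernel of `𝒢^ab → G^ab` is the image of `ℋ`. An invariant character of `ℋ`
extends to a function on `𝒢` whose coboundary is a `2`-cocycle of `G` with values in `ℚ_p/ℤ_p`;
as `H_2(G, ℤ_p) = 0` makes such a cocycle a coboundary, the character extends to `𝒢`
(`eq_zero_of_mem_commutator_closure`). So `X / X_I → 𝒢^ab` is injective, and its image contains a
nontrivial torsion element exactly when the map on torsion is not injective
(`forall_nsmul_mem_iff_injective_torsionMap`).

*Freeness.* If `X` is free of finite rank `d`, then `X / X_I = ℤ_p^d`. For the converse, choose a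
surjection `π : Λ^d → X` with `d` minimal. By Nakayama's lemma the augmentations of the coefficients
of a relation are divisible by `p`, and if `X / X_I` has no `p`-torsion they can be divided by `p`
again and again, hence vanish: `ker π ⊆ I Λ^d`, where `I` is
the augmentation ideal
(`CompletedGroupAlgebra.exists_ker_combination_le_closedAugmentation`). The point is that then
`ker π = 0` (`injective_of_ker_le_closedAugmentation`). Otherwise there is a nonzero invariant
character `φ : ker π → 𝔽_p`, because `G` is pro-`p`. The obstruction to extending `φ` to an
invariant character of `Λ^d` lies in cohomology. On the fibre product of `Λ^d` and `ℋ` over `X`, it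
is first a class in `H³(G, 𝔽_p)`, which is zero because `cd(G) ≤ 2`, and then, after inflation to
`𝒢`, a class in `H²(𝒢, ℚ_p/ℤ_p)`, which is zero because `H_2(𝒢, ℤ_p) = 0`
(`exists_character_fibreProduct`, `exists_character_of_fibreProduct`). The extended character is
invariant; as an invariant character of the fibre product kills the commutators of `ℋ`, it descends
to `Λ^d`, where it kills `I Λ^d ⊇ ker π`, a contradiction.

The cohomological vanishing is used through explicit locally constant cochains:
`exists_coboundary_three_QZ` extracts it from the homogeneous cochain complex, and
`exists_coboundary_two` deduces it from the profinite bar complex by compactness and the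
divisibility of `ℚ/ℤ`, which serves as the group of values of all characters.
-/

/-! ### Exactness of the complex of continuous cochains -/

section ContinuousCochains

open CategoryTheory Limits

/-- In a complex of topological modules, vanishing homology means that every cycle is a boundary. -/
theorem TopModuleCat.exists_of_subsingleton_homology {R : Type*} [Ring R] [TopologicalSpace R]
    (S : ShortComplex (TopModuleCat R)) (h : Subsingleton S.homology) (x : S.X₂)
    (hx : S.g.hom x = 0) : ∃ y : S.X₁, S.f.hom y = x := by
  let D : S.LeftHomologyData :=
    ⟨_, _, _, _, _, TopModuleCat.isLimitKer _, by simp, TopModuleCat.isColimitCoker _⟩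
  let e : S.homology ≅ D.H := D.homologyIso
  have hD : Subsingleton D.H := by
    refine ⟨fun a b => ?_⟩
    have ha : e.hom.hom (e.inv.hom a) = a := ConcreteCategory.congr_hom e.inv_hom_id a
    have hb : e.hom.hom (e.inv.hom b) = b := ConcreteCategory.congr_hom e.inv_hom_id b
    rw [← ha, ← hb, Subsingleton.elim (e.inv.hom a) (e.inv.hom b)]
  let k : D.K := ⟨x, hx⟩
  have hk : D.π.hom k = 0 := Subsingleton.elim _ _
  obtain ⟨y, hy⟩ := (Submodule.Quotient.mk_eq_zero _).1 hk
  refine ⟨y, ?_⟩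
  have hi : D.i.hom (D.f'.hom y) = S.f.hom y := ConcreteCategory.congr_hom D.f'_i y
  rw [← hi]
  exact congrArg (fun t => D.i.hom t) hy

universe u

variable {G : Type u} [Group G] [TopologicalSpace G] [IsTopologicalGroup G]

/-- Vanishing of `H^{n+1}(G, X)` in terms of homogeneous cochains: an invariant cocycle is the
coboundary of an invariant cochain. -/
theorem exists_of_subsingleton_continuousCohomology (X : TopRep ℤ G) (n : ℕ)
    (h : Subsingleton (continuousCohomology (n + 1) X))
    (σ : TopRep.resolutionX X (n + 2))
    (hσ : ∀ g, (TopRep.resolutionX X (n + 2)).ρ g σ = σ)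
    (hd : (TopRep.d X (n + 2)).hom σ = 0) :
    ∃ τ : TopRep.resolutionX X (n + 1), (∀ g, (TopRep.resolutionX X (n + 1)).ρ g τ = τ) ∧
      (TopRep.d X (n + 1)).hom τ = σ := by
  let K := TopRep.homogeneousCochains X
  let S := K.sc' n (n + 1) (n + 2)
  have e : K.homology (n + 1) ≅ S.homology :=
    ShortComplex.homologyMapIso (K.isoSc' n (n + 1) (n + 2) (by simp) (by simp))
  have hS : Subsingleton S.homology := by
    refine ⟨fun a b => ?_⟩
    have ha : e.hom.hom (e.inv.hom a) = a := ConcreteCategory.congr_hom e.inv_hom_id a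
    have hb : e.hom.hom (e.inv.hom b) = b := ConcreteCategory.congr_hom e.inv_hom_id b
    rw [← ha, ← hb, Subsingleton.elim (e.inv.hom a) (e.inv.hom b)]
  let x : K.X (n + 1) := ⟨σ, fun g => hσ g⟩
  obtain ⟨y, hy⟩ := TopModuleCat.exists_of_subsingleton_homology S hS x (by
    refine Subtype.ext ?_
    refine (TopRep.homogeneousCochains.d_apply X (n + 1) x).trans hd)
  refine ⟨y.1, fun g => y.2 g, ?_⟩
  rw [← TopRep.homogeneousCochains.d_apply X n y]
  exact congrArg Subtype.val hy

/-- The continuous map on `G` given by a function on the discrete quotient `G/U`. -/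
def ContinuousMap.ofQuotient (U : OpenNormalSubgroup G) {Y : Type*} [TopologicalSpace Y]
    (f : G ⧸ U.toSubgroup → Y) : C(G, Y) where
  toFun g := f g
  continuous_toFun := by
    have : DiscreteTopology (G ⧸ U.toSubgroup) := QuotientGroup.discreteTopology U.isOpen
    exact continuous_of_discreteTopology.comp QuotientGroup.continuous_mk

/-- If `H³(G, A) = 0`, then an inhomogeneous continuous `3`-cocycle (given at a finite level `G/U`)
is the coboundary of a continuous inhomogeneous `2`-cochain. -/
theorem exists_coboundary_three [CompactSpace G] {A : Type} [AddCommGroup A]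
    (h : Subsingleton (trivialCohomology G A 3)) (U : OpenNormalSubgroup G)
    (u : G ⧸ U.toSubgroup → G ⧸ U.toSubgroup → G ⧸ U.toSubgroup → A)
    (hu : ∀ g h k l, u h k l - u (g * h) k l + u g (h * k) l - u g h (k * l) + u g h k = 0) :
    ∃ b : G → G → A, IsLocallyConstant (fun x : G × G => b x.1 x.2) ∧
      ∀ g h k : G, u g h k = b h k - b (g * h) k + b g (h * k) - b g h := by
  let X : TopRep ℤ G := TopRep.of (ContRepresentation.trivial ℤ G (DiscreteCoeff.{u} A))
  let up : A → DiscreteCoeff.{u} A := ULift.up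
  let dn : DiscreteCoeff.{u} A → A := ULift.down
  let σ : C(G, C(G, C(G, C(G, DiscreteCoeff.{u} A)))) :=
    .ofQuotient U fun q₀ => .ofQuotient U fun q₁ => .ofQuotient U fun q₂ => .ofQuotient U fun q₃ =>
      up (u (q₀⁻¹ * q₁) (q₁⁻¹ * q₂) (q₂⁻¹ * q₃))
  obtain ⟨τ, hτ, hd⟩ := exists_of_subsingleton_continuousCohomology X 2 h σ (fun g => by
    refine ContinuousMap.ext fun g₀ => ContinuousMap.ext fun g₁ => ContinuousMap.ext fun g₂ =>
      ContinuousMap.ext fun g₃ => ?_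
    change up (u _ _ _) = up (u _ _ _)
    congr 2 <;> simp [mul_assoc]) (by
    refine ContinuousMap.ext fun g₀ => ContinuousMap.ext fun g₁ => ContinuousMap.ext fun g₂ =>
      ContinuousMap.ext fun g₃ => ContinuousMap.ext fun g₄ => ?_
    have := hu ((g₀ : G ⧸ U.toSubgroup)⁻¹ * g₁) ((g₁ : G ⧸ U.toSubgroup)⁻¹ * g₂)
      ((g₂ : G ⧸ U.toSubgroup)⁻¹ * g₃) ((g₃ : G ⧸ U.toSubgroup)⁻¹ * g₄)
    simp only [mul_assoc, mul_inv_cancel_left] at this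
    refine Eq.trans ?_ (congrArg up this)
    change up _ - (up _ - (up _ - (up _ - up _))) = _
    change _ = up _ - up _ + up _ - up _ + up _
    abel)
  let t : C(G, C(G, C(G, DiscreteCoeff.{u} A))) := τ
  refine ⟨fun g h => dn (t 1 g (g * h)), ?_, fun g h k => ?_⟩
  · have h1 : Continuous fun x : G × G => t 1 x.1 (x.1 * x.2) := by
      have h2 : Continuous fun x : G × G => t 1 x.1 x.2 :=
        ContinuousMap.continuous_uncurry_of_continuous (t 1)
      exact h2.comp (continuous_fst.prodMk (continuous_fst.mul continuous_snd))
    exact ((IsLocallyConstant.iff_continuous _).2 h1).comp dn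
  · have h1 := DFunLike.congr_fun (DFunLike.congr_fun (DFunLike.congr_fun
      (DFunLike.congr_fun hd (1 : G)) g) (g * h)) (g * h * k)
    have h2 : t g (g * h) (g * (h * k)) = t 1 h (h * k) := by
      have := DFunLike.congr_fun (DFunLike.congr_fun (DFunLike.congr_fun (hτ g) g) (g * h))
        (g * (h * k))
      refine this.symm.trans ?_
      change t (g⁻¹ * g) (g⁻¹ * (g * h)) (g⁻¹ * (g * (h * k))) = _
      simp
    have h3 : up (u g h k) = t g (g * h) (g * h * k) -
        (t 1 (g * h) (g * h * k) - (t 1 g (g * h * k) - t 1 g (g * h))) := by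
      refine Eq.trans ?_ h1.symm
      change up _ = up (u _ _ _)
      congr 2 <;> simp [mul_assoc]
    rw [mul_assoc, h2] at h3
    refine (congrArg dn h3).trans ?_
    change dn _ - (dn _ - (dn _ - dn _)) = _
    simp only [mul_assoc]
    abel

end ContinuousCochains

/-! ### Profinite groups and locally constant functions -/

section LocallyConstant

theorem IsProP.exists_openNormalSubgroup_le (p : ℕ) {G : Type*} [Group G] [TopologicalSpace G]
    [IsTopologicalGroup G] [hG : IsProP p G] {W : Set G} (hW : W ∈ 𝓝 (1 : G)) :
    ∃ U : OpenNormalSubgroup G, ∀ g ∈ U.toSubgroup, g ∈ W := by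
  have := hG.compactSpace
  have := hG.totallyDisconnectedSpace
  obtain ⟨O, hO, hOo, h1⟩ := mem_nhds_iff.1 hW
  obtain ⟨U, hU⟩ := ProfiniteGrp.exist_openNormalSubgroup_sub_open_nhds_of_one hOo h1
  exact ⟨U, fun g hg => hO (hU hg)⟩

/-- The quotient of a pro-`p` group by a closed normal subgroup is pro-`p`. -/
theorem IsProP.quotient (p : ℕ) {G : Type*} [Group G] [TopologicalSpace G]
    [IsTopologicalGroup G] [hG : IsProP p G] (H : Subgroup G) [H.Normal]
    [hH : IsClosed (H : Set G)] : IsProP p (G ⧸ H) := by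
  have := hG.compactSpace
  have hmap : ∀ U : OpenNormalSubgroup G, ∃ V : OpenNormalSubgroup (G ⧸ H),
      V.toSubgroup = U.toSubgroup.map (QuotientGroup.mk' H) := fun U =>
    ⟨{ toSubgroup := U.toSubgroup.map (QuotientGroup.mk' H)
       isOpen' := QuotientGroup.isOpenMap_coe _ U.isOpen
       isNormal' := Subgroup.Normal.map inferInstance _ (QuotientGroup.mk'_surjective H) }, rfl⟩
  refine ⟨inferInstance, ?_, fun V => ?_⟩
  · suffices h : TotallySeparatedSpace (G ⧸ H) from inferInstance
    refine totallySeparatedSpace_iff_exists_isClopen.2 fun x y hxy => ?_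
    have hW : (QuotientGroup.mk : G → G ⧸ H) ⁻¹' {x⁻¹ * y}ᶜ ∈ 𝓝 (1 : G) := by
      refine QuotientGroup.continuous_mk.continuousAt.preimage_mem_nhds
        (isOpen_compl_singleton.mem_nhds fun h => hxy ?_)
      exact (inv_mul_eq_one.1 h.symm)
    obtain ⟨U, hU⟩ := IsProP.exists_openNormalSubgroup_le p hW
    obtain ⟨V, hV⟩ := hmap U
    refine ⟨(fun z => x⁻¹ * z) ⁻¹' V.toSubgroup,
      V.toOpenSubgroup.isClopen.preimage (continuous_const_mul _), ?_, fun hy => ?_⟩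
    · simp [one_mem]
    · rw [Set.mem_preimage, SetLike.mem_coe, hV] at hy
      obtain ⟨u, hu, huy⟩ := hy
      exact hU u hu huy
  · let U : OpenNormalSubgroup G :=
      { toSubgroup := V.toSubgroup.comap (QuotientGroup.mk' H)
        isOpen' := V.isOpen.preimage QuotientGroup.continuous_mk }
    refine (hG.isPGroup_quotient U).of_surjective
      (QuotientGroup.map U.toSubgroup V.toSubgroup (QuotientGroup.mk' H) le_rfl) ?_
    intro q
    obtain ⟨q, rfl⟩ := QuotientGroup.mk_surjective q
    obtain ⟨g, rfl⟩ := QuotientGroup.mk_surjective q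
    exact ⟨QuotientGroup.mk g, rfl⟩

/-- A locally constant function on a compact space on which a pro-`p` group acts (continuously, from
the right) is invariant under an open normal subgroup. -/
theorem IsLocallyConstant.exists_openNormalSubgroup (p : ℕ) {G Y D : Type*} [Group G]
    [TopologicalSpace G] [IsTopologicalGroup G] [IsProP p G] [TopologicalSpace Y]
    [CompactSpace Y] {f : Y → D} (hf : IsLocallyConstant f) (m : Y → G → Y)
    (hm : Continuous fun x : Y × G => m x.1 x.2) (hm1 : ∀ y, m y 1 = y) :
    ∃ U : OpenNormalSubgroup G, ∀ u ∈ U.toSubgroup, ∀ y, f (m y u) = f y := by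
  let _ : TopologicalSpace D := ⊥
  have : DiscreteTopology D := ⟨rfl⟩
  have hfc : Continuous f := hf.continuous
  have ho : IsOpen {x : Y × G | f (m x.1 x.2) = f x.1} :=
    (isOpen_discrete {d : D × D | d.1 = d.2}).preimage
      ((hfc.comp hm).prodMk (hfc.comp continuous_fst))
  obtain ⟨u, v, _, hv, hu, h1, huv⟩ := generalized_tube_lemma (isCompact_univ (X := Y))
    (isCompact_singleton (x := (1 : G))) ho (by
      rintro ⟨y, g⟩ ⟨-, hg⟩
      obtain rfl : g = 1 := hg
      simp [hm1])
  obtain ⟨U, hU⟩ := IsProP.exists_openNormalSubgroup_le p (hv.mem_nhds (h1 rfl))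
  exact ⟨U, fun g hg y => huv (Set.mk_mem_prod (hu trivial) (hU g hg))⟩

end LocallyConstant

/-! ### The group `ℚ/ℤ` and extension of characters -/

section QZ

/-- The divisible group `ℚ/ℤ`. -/
abbrev QZ : Type := AddCircle (1 : ℚ)

/-- The element `1/n` of `ℚ/ℤ`. -/
def QZ.frac (n : ℕ) : QZ := ((1 / n : ℚ) : AddCircle (1 : ℚ))

theorem QZ.zsmul_frac_eq_zero_iff {n : ℕ} (hn : n ≠ 0) (m : ℤ) :
    m • QZ.frac n = 0 ↔ (n : ℤ) ∣ m := by
  have hn' : (n : ℚ) ≠ 0 := Nat.cast_ne_zero.2 hn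
  rw [QZ.frac, ← AddCircle.coe_zsmul, AddCircle.coe_eq_zero_iff]
  constructor
  · rintro ⟨k, hk⟩
    refine ⟨k, ?_⟩
    rw [zsmul_eq_mul, zsmul_eq_mul, mul_one, mul_one_div, eq_div_iff hn'] at hk
    rw [mul_comm]
    exact_mod_cast hk.symm
  · rintro ⟨k, rfl⟩
    refine ⟨k, ?_⟩
    rw [zsmul_eq_mul, zsmul_eq_mul, mul_one]
    push_cast
    field_simp

theorem QZ.exists_zsmul_frac {n : ℕ} (hn : n ≠ 0) {x : QZ} (hx : n • x = 0) :
    ∃ m : ℤ, x = m • QZ.frac n := by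
  have hn' : (n : ℚ) ≠ 0 := Nat.cast_ne_zero.2 hn
  induction x using QuotientAddGroup.induction_on with
  | H q =>
    change n • (q : AddCircle (1 : ℚ)) = 0 at hx
    rw [← AddCircle.coe_nsmul, AddCircle.coe_eq_zero_iff] at hx
    obtain ⟨k, hk⟩ := hx
    refine ⟨k, ?_⟩
    rw [QZ.frac, ← AddCircle.coe_zsmul]
    change (q : AddCircle (1 : ℚ)) = _
    congr 1
    rw [zsmul_eq_mul, nsmul_eq_mul, mul_one] at hk
    rw [zsmul_eq_mul, mul_one_div, eq_div_iff hn', hk, mul_comm]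

/-- The embedding `ℤ/n → ℚ/ℤ`, `1 ↦ 1/n`. -/
def QZ.ofZMod (n : ℕ) [NeZero n] : ZMod n →+ QZ :=
  ZMod.lift n ⟨zmultiplesHom QZ (QZ.frac n), by
    rw [zmultiplesHom_apply, QZ.zsmul_frac_eq_zero_iff (NeZero.ne n)]⟩

theorem QZ.ofZMod_intCast (n : ℕ) [NeZero n] (m : ℤ) : QZ.ofZMod n m = m • QZ.frac n := by
  simp [QZ.ofZMod]

theorem QZ.ofZMod_injective (n : ℕ) [NeZero n] : Function.Injective (QZ.ofZMod n) := by
  rw [injective_iff_map_eq_zero]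
  intro a ha
  obtain ⟨m, rfl⟩ := ZMod.intCast_surjective a
  rw [QZ.ofZMod_intCast, QZ.zsmul_frac_eq_zero_iff (NeZero.ne n)] at ha
  exact (ZMod.intCast_zmod_eq_zero_iff_dvd m n).2 ha

theorem QZ.exists_ofZMod (n : ℕ) [NeZero n] {x : QZ} (hx : n • x = 0) :
    ∃ a, QZ.ofZMod n a = x := by
  obtain ⟨m, rfl⟩ := QZ.exists_zsmul_frac (NeZero.ne n) hx
  exact ⟨m, QZ.ofZMod_intCast n m⟩

theorem QZ.nsmul_ofZMod (n : ℕ) [NeZero n] (a : ZMod n) : n • QZ.ofZMod n a = 0 := by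
  rw [← map_nsmul]; simp

/-- As `ℚ/ℤ` is divisible, a character of `A` that vanishes on the kernel of `D : A → B` is induced
by a character of `B`. -/
theorem QZ.exists_factor {A B : Type*} [AddCommGroup A] [AddCommGroup B] (D : A →+ B) (F : A →+ QZ)
    (h : ∀ x, D x = 0 → F x = 0) : ∃ a : B →+ QZ, ∀ x, a (D x) = F x := by
  let i : (A ⧸ D.ker) →+ B := QuotientAddGroup.kerLift D
  have hi : Function.Injective i.toIntLinearMap := QuotientAddGroup.kerLift_injective D
  let c : CharacterModule (A ⧸ D.ker) := QuotientAddGroup.lift D.ker F fun x hx => h x hx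
  obtain ⟨a, ha⟩ := CharacterModule.dual_surjective_of_injective i.toIntLinearMap hi c
  refine ⟨a, fun x => ?_⟩
  exact DFunLike.congr_fun ha (QuotientAddGroup.mk x)

/-- If `H³(G, 𝔽_p) = 0`, then every `p`-torsion locally constant `3`-cocycle with values in `ℚ/ℤ`
is the coboundary of a `p`-torsion locally constant `2`-cochain. -/
theorem exists_coboundary_three_QZ (p : ℕ) [Fact p.Prime] {G : Type*} [Group G]
    [TopologicalSpace G] [IsTopologicalGroup G] [hG : IsProP p G]
    (h : Subsingleton (trivialCohomology G (ZMod p) 3)) (u : G → G → G → QZ)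
    (hlc : IsLocallyConstant fun x : G × G × G => u x.1 x.2.1 x.2.2)
    (hp : ∀ g h k, p • u g h k = 0)
    (hu : ∀ g h k l, u h k l - u (g * h) k l + u g (h * k) l - u g h (k * l) + u g h k = 0) :
    ∃ b : G → G → QZ, IsLocallyConstant (fun x : G × G => b x.1 x.2) ∧ (∀ g h, p • b g h = 0) ∧
      ∀ g h k : G, u g h k = b h k - b (g * h) k + b g (h * k) - b g h := by
  have := hG.compactSpace
  have : NeZero p := ⟨(Fact.out : p.Prime).ne_zero⟩
  choose w hw using fun g h k => QZ.exists_ofZMod p (hp g h k)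
  obtain ⟨U₁, h₁⟩ := hlc.exists_openNormalSubgroup p (G := G)
    (fun x g => (x.1 * g, x.2.1, x.2.2)) (by fun_prop) (by simp)
  obtain ⟨U₂, h₂⟩ := hlc.exists_openNormalSubgroup p (G := G)
    (fun x g => (x.1, x.2.1 * g, x.2.2)) (by fun_prop) (by simp)
  obtain ⟨U₃, h₃⟩ := hlc.exists_openNormalSubgroup p (G := G)
    (fun x g => (x.1, x.2.1, x.2.2 * g)) (by fun_prop) (by simp)
  let U := U₁ ⊓ U₂ ⊓ U₃
  have hU : ∀ {g h k g' h' k' : G}, (g : G ⧸ U.toSubgroup) = g' → (h : G ⧸ U.toSubgroup) = h' →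
      (k : G ⧸ U.toSubgroup) = k' → w g h k = w g' h' k' := by
    intro g h k g' h' k' hg hh hk
    rw [QuotientGroup.eq] at hg hh hk
    refine QZ.ofZMod_injective p ?_
    rw [hw, hw]
    have e₁ := h₁ _ hg.1.1 (g, h, k)
    have e₂ := h₂ _ hh.1.2 (g', h, k)
    have e₃ := h₃ _ hk.2 (g', h', k)
    simp only [mul_inv_cancel_left] at e₁ e₂ e₃
    rw [← e₁, ← e₂, ← e₃]
  have hout : ∀ g : G, (((g : G ⧸ U.toSubgroup).out : G) : G ⧸ U.toSubgroup) = g := fun g =>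
    QuotientGroup.out_eq' _
  obtain ⟨b, hb, hbu⟩ := exists_coboundary_three h U (fun q r s => w q.out r.out s.out) (by
    intro g h k l
    obtain ⟨g, rfl⟩ := QuotientGroup.mk_surjective g
    obtain ⟨h, rfl⟩ := QuotientGroup.mk_surjective h
    obtain ⟨k, rfl⟩ := QuotientGroup.mk_surjective k
    obtain ⟨l, rfl⟩ := QuotientGroup.mk_surjective l
    simp only [← QuotientGroup.mk_mul]
    rw [hU (hout h) (hout k) (hout l), hU (hout (g * h)) (hout k) (hout l),
      hU (hout g) (hout (h * k)) (hout l), hU (hout g) (hout h) (hout (k * l)),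
      hU (hout g) (hout h) (hout k)]
    refine QZ.ofZMod_injective p ?_
    simp only [map_sub, map_add, map_zero, hw]
    exact hu g h k l)
  refine ⟨fun g h => QZ.ofZMod p (b g h), hb.comp _, fun g h => QZ.nsmul_ofZMod p _,
    fun g h k => ?_⟩
  simp only [← map_sub, ← map_add, ← hbu]
  rw [hU (hout g) (hout h) (hout k), hw]

end QZ

/-! ### Vanishing of `H₂` and continuous `2`-cocycles -/

section SecondHomology

variable {p : ℕ} [Fact p.Prime]

theorem PadicInt.isClopen_setOf_pow_dvd (n : ℕ) : IsClopen {x : ℤ_[p] | (p : ℤ_[p]) ^ n ∣ x} := by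
  have h : {x : ℤ_[p] | (p : ℤ_[p]) ^ n ∣ x} = Metric.closedBall 0 ((p : ℝ) ^ (-n : ℤ)) := by
    ext x
    rw [Set.mem_ofPred_eq, mem_closedBall_zero_iff, PadicInt.norm_le_pow_iff_mem_span_pow,
      Ideal.mem_span_singleton]
  rw [h]
  refine IsUltrametricDist.isClopen_closedBall 0 ?_
  have : (p : ℝ) ≠ 0 := Nat.cast_ne_zero.2 (Fact.out : p.Prime).ne_zero
  positivity

theorem PadicInt.toZModPow_eq_zero_iff (n : ℕ) (x : ℤ_[p]) :
    PadicInt.toZModPow n x = 0 ↔ (p : ℤ_[p]) ^ n ∣ x := by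
  rw [← RingHom.mem_ker, PadicInt.ker_toZModPow, Ideal.mem_span_singleton]

theorem PadicInt.pow_dvd_intCast_iff (n : ℕ) (m : ℤ) :
    (p : ℤ_[p]) ^ n ∣ m ↔ ((p ^ n : ℕ) : ℤ) ∣ m := by
  rw [← PadicInt.toZModPow_eq_zero_iff, map_intCast, ZMod.intCast_zmod_eq_zero_iff_dvd]

theorem PadicInt.eq_zero_of_forall_pow_dvd {x : ℤ_[p]} (h : ∀ n : ℕ, (p : ℤ_[p]) ^ n ∣ x) :
    x = 0 :=
  PadicInt.ext_of_toZModPow.1 fun n => by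
    rw [map_zero, PadicInt.toZModPow_eq_zero_iff]; exact h n

theorem Finsupp.dvd_mapDomain_apply {α β R : Type*} [CommRing R] (f : α → β) (a : R) {z : α →₀ R}
    (hz : ∀ s, a ∣ z s) (t : β) : a ∣ z.mapDomain f t := by
  classical
  rw [Finsupp.mapDomain, Finsupp.sum_apply]
  refine Finset.dvd_sum fun s _ => ?_
  change a ∣ Finsupp.single (f s) (z s) t
  rw [Finsupp.single_apply]
  split_ifs
  · exact hz s
  · exact dvd_zero a

theorem barDifferential_one_single {Q : Type*} [Group Q] (g h : Q) (a : ℤ_[p]) :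
    barDifferential p Q 1 (Finsupp.single ![g, h] a) = Finsupp.single (fun _ => h) a -
      Finsupp.single (fun _ => g * h) a + Finsupp.single (fun _ => g) a := by
  refine ((barDifferential_single p Q 1 _ a).trans
    (congrArg (_ + ·) (Fin.sum_univ_two _))).trans ?_
  have e₀ : Fin.contractNth (0 : Fin 2) (· * ·) ![g, h] = fun _ => g * h := by
    funext i; fin_cases i; rfl
  have e₁ : Fin.contractNth (1 : Fin 2) (· * ·) ![g, h] = fun _ => g := by
    funext i; fin_cases i; rfl
  have e₂ : (fun i : Fin 1 => ![g, h] i.succ) = fun _ => h := by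
    funext i; fin_cases i; rfl
  rw [e₀, e₁, e₂]
  norm_num
  abel

theorem barDifferential_two_single {Q : Type*} [Group Q] (t : Fin 3 → Q) (a : ℤ_[p]) :
    barDifferential p Q 2 (Finsupp.single t a) = Finsupp.single ![t 1, t 2] a -
      Finsupp.single ![t 0 * t 1, t 2] a + Finsupp.single ![t 0, t 1 * t 2] a -
      Finsupp.single ![t 0, t 1] a := by
  refine ((barDifferential_single p Q 2 _ a).trans
    (congrArg (_ + ·) (Fin.sum_univ_three _))).trans ?_
  have e₀ : Fin.contractNth (0 : Fin 3) (· * ·) t = ![t 0 * t 1, t 2] := by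
    funext i; fin_cases i <;> rfl
  have e₁ : Fin.contractNth (1 : Fin 3) (· * ·) t = ![t 0, t 1 * t 2] := by
    funext i; fin_cases i <;> rfl
  have e₂ : Fin.contractNth (2 : Fin 3) (· * ·) t = ![t 0, t 1] := by
    funext i; fin_cases i <;> rfl
  have e₃ : (fun i : Fin 2 => t i.succ) = ![t 1, t 2] := by
    funext i; fin_cases i <;> rfl
  rw [e₀, e₁, e₂, e₃]
  norm_num
  abel

variable {G : Type*} [Group G] [TopologicalSpace G]

/-- Every chain at a finite level `G/V` lifts to a profinite chain. -/
theorem exists_profiniteChain (V : OpenNormalSubgroup G) (n : ℕ)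
    (z : (Fin n → G ⧸ V.toSubgroup) →₀ ℤ_[p]) : ∃ w : ProfiniteChains p G n, w.1 V = z := by
  refine ⟨⟨fun W => z.mapDomain fun t j => QuotientGroup.mk (t j).out, fun W W' h => ?_⟩, ?_⟩
  · rw [← Finsupp.mapDomain_comp]
    rfl
  · refine Eq.trans ?_ Finsupp.mapDomain_id
    change z.mapDomain _ = _
    congr 1
    funext t j
    exact QuotientGroup.out_eq' _

variable [IsTopologicalGroup G]

/-- A functional modulo `p^k` on the `2`-chains of `G/U` that vanishes on boundaries vanishes, at
some deeper level `G/V`, on every chain whose boundary is divisible by a high power of `p`. This is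
the continuity of the induced functional on the `1`-boundaries, proved by compactness. -/
theorem exists_level_of_subsingleton_homology [hG : IsProP p G]
    (hH : Subsingleton (ProfiniteHomology p G 2)) (U : OpenNormalSubgroup G) (k : ℕ)
    (ℓ : ((Fin 2 → G ⧸ U.toSubgroup) →₀ ℤ_[p]) →ₗ[ℤ_[p]] ℤ_[p])
    (hℓ : ∀ y, (p : ℤ_[p]) ^ k ∣ ℓ (barDifferential p (G ⧸ U.toSubgroup) 2 y)) :
    ∃ (V : OpenNormalSubgroup G) (n : ℕ) (h : V.toSubgroup ≤ U.toSubgroup),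
      ∀ z : (Fin 2 → G ⧸ V.toSubgroup) →₀ ℤ_[p],
        (∀ s, (p : ℤ_[p]) ^ n ∣ barDifferential p (G ⧸ V.toSubgroup) 1 z s) →
        (p : ℤ_[p]) ^ k ∣ ℓ (z.mapDomain
          (QuotientGroup.map V.toSubgroup U.toSubgroup (MonoidHom.id G) h ∘ ·)) := by
  have := hG.compactSpace
  have hfin : ∀ V : OpenNormalSubgroup G, Finite (G ⧸ V.toSubgroup) := fun V =>
    Subgroup.quotient_finite_of_isOpen _ V.isOpen
  by_contra! hbad
  let S := ∀ V : OpenNormalSubgroup G, (Fin 2 → G ⧸ V.toSubgroup) → ℤ_[p]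
  let e : ∀ (_ : S) (V : OpenNormalSubgroup G), (Fin 2 → G ⧸ V.toSubgroup) →₀ ℤ_[p] :=
    fun w V => (Finsupp.linearEquivFunOnFinite ℤ_[p] ℤ_[p] _).symm (w V)
  have hcont : ∀ (V : OpenNormalSubgroup G)
      (m : ((Fin 2 → G ⧸ V.toSubgroup) →₀ ℤ_[p]) →ₗ[ℤ_[p]] ℤ_[p]),
      Continuous fun w : S => m (e w V) := fun V m =>
    (LinearMap.continuous_on_pi
      (m ∘ₗ (Finsupp.linearEquivFunOnFinite ℤ_[p] ℤ_[p] _).symm.toLinearMap)).comp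
      (continuous_apply V)
  let C : Set S := {w | ∀ (V W : OpenNormalSubgroup G) (h : V.toSubgroup ≤ W.toSubgroup),
    (e w V).mapDomain (QuotientGroup.map V.toSubgroup W.toSubgroup (MonoidHom.id G) h ∘ ·) = e w W}
  have hC : IsClosed C := by
    simp only [C, Finsupp.ext_iff, Set.ofPred_forall]
    refine isClosed_iInter fun V => isClosed_iInter fun W => isClosed_iInter fun h =>
      isClosed_iInter fun s => isClosed_eq ?_ ?_
    · exact hcont V (Finsupp.lapply s ∘ₗ Finsupp.lmapDomain ℤ_[p] ℤ_[p] _)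
    · exact hcont W (Finsupp.lapply s)
  let Z : OpenNormalSubgroup G × ℕ → Set S := fun i => C ∩
    ({w | ∀ s, (p : ℤ_[p]) ^ i.2 ∣ barDifferential p (G ⧸ i.1.toSubgroup) 1 (e w i.1) s} ∩
      {w | ¬ (p : ℤ_[p]) ^ k ∣ ℓ (e w U)})
  have hZ : ∀ i, IsClosed (Z i) := by
    refine fun i => hC.inter (IsClosed.inter ?_ ?_)
    · rw [Set.ofPred_forall]
      exact isClosed_iInter fun s => (PadicInt.isClopen_setOf_pow_dvd i.2).isClosed.preimage
        (hcont i.1 (Finsupp.lapply s ∘ₗ barDifferential p _ 1))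
    · exact (PadicInt.isClopen_setOf_pow_dvd k).compl.isClosed.preimage (hcont U ℓ)
  have hanti : ∀ {V W : OpenNormalSubgroup G} {n m : ℕ}, V.toSubgroup ≤ W.toSubgroup → m ≤ n →
      ∀ w ∈ C, (∀ s, (p : ℤ_[p]) ^ n ∣ barDifferential p (G ⧸ V.toSubgroup) 1 (e w V) s) →
      ∀ s, (p : ℤ_[p]) ^ m ∣ barDifferential p (G ⧸ W.toSubgroup) 1 (e w W) s := by
    intro V W n m h hnm w hw hd s
    rw [← hw V W h, barDifferential_mapDomain]
    exact Finsupp.dvd_mapDomain_apply _ _ (fun s => (pow_dvd_pow _ hnm).trans (hd s)) s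
  have hne : ∀ i, (Z i).Nonempty := by
    intro i
    obtain ⟨z, hz, hzℓ⟩ := hbad (i.1 ⊓ U) i.2 (fun g hg => hg.2)
    obtain ⟨w, hw⟩ := exists_profiniteChain (i.1 ⊓ U) 2 z
    let w' : S := fun V => w.1 V
    have he : ∀ V, e w' V = w.1 V := fun V =>
      (Finsupp.linearEquivFunOnFinite ℤ_[p] ℤ_[p] _).symm_apply_apply (w.1 V)
    have hwC : w' ∈ C := fun V W h => by rw [he, he]; exact w.2 V W h
    refine ⟨w', hwC, ?_, ?_⟩
    · refine hanti (V := i.1 ⊓ U) (fun g hg => hg.1) le_rfl w' hwC fun s => ?_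
      rw [he, hw]
      exact hz s
    · rw [Set.mem_ofPred_eq, ← hwC (i.1 ⊓ U) U (fun g hg => hg.2), he, hw]
      exact hzℓ
  have : Nonempty (OpenNormalSubgroup G × ℕ) := ⟨(U, 0)⟩
  obtain ⟨w, hw⟩ := IsCompact.nonempty_iInter_of_directed_nonempty_isCompact_isClosed Z
    (fun i j => ⟨(i.1 ⊓ j.1, max i.2 j.2),
      fun w hw => ⟨hw.1, hanti (V := i.1 ⊓ j.1) (fun g hg => hg.1) (le_max_left _ _) w hw.1 hw.2.1,
        hw.2.2⟩,
      fun w hw => ⟨hw.1, hanti (V := i.1 ⊓ j.1) (fun g hg => hg.2) (le_max_right _ _) w hw.1 hw.2.1,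
        hw.2.2⟩⟩)
    hne (fun i => (hZ i).isCompact) hZ
  rw [Set.mem_iInter] at hw
  let z : ProfiniteChains p G 2 := ⟨fun V => e w V, (hw (U, 0)).1⟩
  have hz : z ∈ profiniteCycles p G 2 := by
    refine LinearMap.mem_ker.2 (Subtype.ext (funext fun V => Finsupp.ext fun s => ?_))
    exact PadicInt.eq_zero_of_forall_pow_dvd fun n => (hw (V, n)).2.1 s
  have hz0 : (Submodule.Quotient.mk ⟨z, hz⟩ : ProfiniteHomology p G 2) = 0 := Subsingleton.elim _ _
  obtain ⟨y, hy⟩ := (Submodule.Quotient.mk_eq_zero _).1 hz0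
  refine (hw (U, 0)).2.2 ?_
  have hyU : barDifferential p (G ⧸ U.toSubgroup) 2 (y.1 U) = e w U :=
    congrArg (fun c : ProfiniteChains p G 2 => c.1 U) hy
  rw [← hyU]
  exact hℓ _

/-- If `H₂(G, ℤ_p) = 0`, then `H²(G, ℚ_p/ℤ_p) = 0`: every locally constant `2`-cocycle with values
in `ℚ/ℤ`, killed by a power of `p`, is the coboundary of a locally constant function. -/
theorem exists_coboundary_two [hG : IsProP p G]
    (hH : Subsingleton (ProfiniteHomology p G 2)) (k : ℕ) (f : G → G → QZ)
    (hlc : IsLocallyConstant fun x : G × G => f x.1 x.2) (hk : ∀ g h, p ^ k • f g h = 0)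
    (hf : ∀ g h l, f h l - f (g * h) l + f g (h * l) - f g h = 0) :
    ∃ a : G → QZ, IsLocallyConstant a ∧ ∀ g h, f g h = a g + a h - a (g * h) := by
  have := hG.compactSpace
  have hp0 : p ^ k ≠ 0 := pow_ne_zero k (Fact.out : p.Prime).ne_zero
  obtain ⟨U₁, h₁⟩ := hlc.exists_openNormalSubgroup p (G := G)
    (fun x g => (x.1 * g, x.2)) (by fun_prop) (by simp)
  obtain ⟨U₂, h₂⟩ := hlc.exists_openNormalSubgroup p (G := G)
    (fun x g => (x.1, x.2 * g)) (by fun_prop) (by simp)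
  let U := U₁ ⊓ U₂
  have hU : ∀ {g h g' h' : G}, (g : G ⧸ U.toSubgroup) = g' → (h : G ⧸ U.toSubgroup) = h' →
      f g h = f g' h' := by
    intro g h g' h' hg hh
    rw [QuotientGroup.eq] at hg hh
    have e₁ := h₁ _ hg.1 (g, h)
    have e₂ := h₂ _ hh.2 (g', h)
    simp only [mul_inv_cancel_left] at e₁ e₂
    rw [← e₁, ← e₂]
  have hout : ∀ g : G, (((g : G ⧸ U.toSubgroup).out : G) : G ⧸ U.toSubgroup) = g := fun g =>
    QuotientGroup.out_eq' _
  -- write the cocycle as `m / p ^ k` with an integral cochain `m`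
  choose m' hm' using fun g h => QZ.exists_zsmul_frac hp0 (hk g h)
  let m : G ⧸ U.toSubgroup → G ⧸ U.toSubgroup → ℤ := fun q r => m' q.out r.out
  have hm : ∀ g h : G, f g h = m g h • QZ.frac (p ^ k) := fun g h => by
    rw [← hm', hU (hout g) (hout h)]
  let ℓ : ((Fin 2 → G ⧸ U.toSubgroup) →₀ ℤ_[p]) →ₗ[ℤ_[p]] ℤ_[p] :=
    Finsupp.linearCombination ℤ_[p] fun s => (m (s 0) (s 1) : ℤ_[p])
  have hℓ1 : ∀ s a, ℓ (Finsupp.single s a) = a * m (s 0) (s 1) := fun s a => by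
    rw [Finsupp.linearCombination_single, smul_eq_mul]
  obtain ⟨V, n, hVU, hV⟩ := exists_level_of_subsingleton_homology hH U k ℓ (fun y => by
    induction y using Finsupp.induction_linear with
    | zero => simp
    | add x y hx hy => rw [map_add, map_add]; exact dvd_add hx hy
    | single t a =>
      have hdvd : (p : ℤ_[p]) ^ k ∣ ((m (t 1) (t 2) - m (t 0 * t 1) (t 2) + m (t 0) (t 1 * t 2) -
          m (t 0) (t 1) : ℤ) : ℤ_[p]) := by
        rw [PadicInt.pow_dvd_intCast_iff, ← QZ.zsmul_frac_eq_zero_iff hp0]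
        obtain ⟨x, hx⟩ := QuotientGroup.mk_surjective (t 0)
        obtain ⟨y, hy⟩ := QuotientGroup.mk_surjective (t 1)
        obtain ⟨z, hz⟩ := QuotientGroup.mk_surjective (t 2)
        have := hf x y z
        rw [hm, hm, hm, hm, QuotientGroup.mk_mul, QuotientGroup.mk_mul, hx, hy, hz] at this
        rw [sub_smul, add_smul, sub_smul]
        exact this
      refine (hdvd.mul_left a).trans (dvd_of_eq ?_)
      rw [barDifferential_two_single]
      simp only [map_add, map_sub, hℓ1]
      push_cast
      change _ = a * (m (t 1) (t 2) : ℤ_[p]) - a * (m (t 0 * t 1) (t 2) : ℤ_[p]) +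
        a * (m (t 0) (t 1 * t 2) : ℤ_[p]) - a * (m (t 0) (t 1) : ℤ_[p])
      ring)
  -- extend the resulting character of the boundaries at the level `(V, n)`
  have : NeZero (p ^ k) := ⟨hp0⟩
  let E : ℤ_[p] →+ QZ := (QZ.ofZMod (p ^ k)).comp (PadicInt.toZModPow k).toAddMonoidHom
  have hE : ∀ x, (p : ℤ_[p]) ^ k ∣ x → E x = 0 := fun x hx => by
    change QZ.ofZMod (p ^ k) (PadicInt.toZModPow k x) = 0
    rw [(PadicInt.toZModPow_eq_zero_iff k x).2 hx, map_zero]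
  have hEm : ∀ j : ℤ, E (j : ℤ_[p]) = j • QZ.frac (p ^ k) := fun j => by
    change QZ.ofZMod (p ^ k) (PadicInt.toZModPow k j) = _
    rw [map_intCast, QZ.ofZMod_intCast]
  let F : ((Fin 2 → G ⧸ V.toSubgroup) →₀ ℤ_[p]) →+ QZ := E.comp (ℓ ∘ₗ Finsupp.lmapDomain _ _
    (QuotientGroup.map V.toSubgroup U.toSubgroup (MonoidHom.id G) hVU ∘ ·)).toAddMonoidHom
  let R : ((Fin 1 → G ⧸ V.toSubgroup) →₀ ℤ_[p]) →+ ((Fin 1 → G ⧸ V.toSubgroup) → ZMod (p ^ n)) :=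
    AddMonoidHom.pi fun s =>
      (PadicInt.toZModPow n).toAddMonoidHom.comp (Finsupp.applyAddHom s)
  obtain ⟨a, ha⟩ := QZ.exists_factor
    (R.comp (barDifferential p (G ⧸ V.toSubgroup) 1).toAddMonoidHom)
    F (fun z hz => hE _ (hV z fun s =>
      (PadicInt.toZModPow_eq_zero_iff n _).1 (congrFun hz s)))
  refine ⟨fun g => a (R (Finsupp.single (fun _ => QuotientGroup.mk g) 1)), ?_, fun g h => ?_⟩
  · have : DiscreteTopology (G ⧸ V.toSubgroup) := QuotientGroup.discreteTopology V.isOpen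
    exact ((IsLocallyConstant.of_discrete (X := G ⧸ V.toSubgroup)
      fun q => a (R (Finsupp.single (fun _ => q) 1))).comp_continuous QuotientGroup.continuous_mk)
  · have h1 := ha (Finsupp.single ![(g : G ⧸ V.toSubgroup), (h : G ⧸ V.toSubgroup)] 1)
    have h2 : F (Finsupp.single ![(g : G ⧸ V.toSubgroup), (h : G ⧸ V.toSubgroup)] 1) = f g h := by
      change E (ℓ (Finsupp.mapDomain _ (Finsupp.single _ _))) = _
      rw [Finsupp.mapDomain_single, hℓ1, one_mul, hEm, hm]
      rfl
    rw [← h2, ← h1, ← map_add, ← map_sub, ← map_add, ← map_sub]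
    change a (R (barDifferential p (G ⧸ V.toSubgroup) 1 _)) = _
    rw [barDifferential_one_single, QuotientGroup.mk_mul]
    congr 2
    abel

end SecondHomology

/-! ### Extending characters from a normal subgroup -/

section Extension

/-- A homomorphism that is trivial near `1` is locally constant. -/
theorem isLocallyConstant_of_eventually_eq_zero {G A : Type*} [Group G] [TopologicalSpace G]
    [IsTopologicalGroup G] [AddCommGroup A] (f : G → A) (hf : ∀ x y, f (x * y) = f x + f y)
    (h : ∀ᶠ x in 𝓝 (1 : G), f x = 0) : IsLocallyConstant f := by
  rw [IsLocallyConstant.iff_eventually_eq]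
  intro x
  have hx : Tendsto (fun y => x⁻¹ * y) (𝓝 x) (𝓝 1) := by
    have := (continuous_const_mul x⁻¹).tendsto x
    rwa [inv_mul_cancel] at this
  filter_upwards [hx.eventually h] with y hy
  have := hf x (x⁻¹ * y)
  rwa [mul_inv_cancel_left, hy, add_zero] at this

variable (p : ℕ) {G : Type*} [Group G] [TopologicalSpace G] [IsTopologicalGroup G]

/-- An equivariant locally constant homomorphism `ψ : H → A` from a normal subgroup `H` of `G` to a
`G/H`-module extends to a locally constant function `q` on `G` whose failure to be a `1`-cocycle is
measured by a function on `G/H × G/H`. On the double coset `H t O`, where `O` is a small open normal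
subgroup and `t` a chosen representative, `q` is given by `h t o ↦ ψ h`. -/
theorem exists_cochain_extending [hG : IsProP p G] (H : Subgroup G) [H.Normal]
    {A : Type*} [AddCommGroup A] (ρ : G ⧸ H →* AddMonoid.End A)
    (hρ : ∀ a, IsLocallyConstant fun g => ρ g a) (ψ : H → A) (hψ : IsLocallyConstant ψ)
    (hmul : ∀ h h', ψ (h * h') = ψ h + ψ h')
    (hconj : ∀ (g : G) (h : H), ψ (MulAut.conjNormal g h) = ρ g (ψ h)) :
    ∃ (q : G → A) (c : G ⧸ H → G ⧸ H → A), IsLocallyConstant q ∧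
      IsLocallyConstant (fun x : (G ⧸ H) × (G ⧸ H) => c x.1 x.2) ∧
      (∀ h : H, q h = ψ h) ∧ (∀ g, ∃ h, q g = ψ h) ∧
      ∀ g g' : G, q (g * g') = q g + ρ g (q g') + c g g' := by
  have hψ1 : ψ 1 = 0 := by simpa using hmul 1 1
  have hinv : ∀ h, ψ h⁻¹ = -ψ h := fun h => by
    rw [eq_neg_iff_add_eq_zero, ← hmul, inv_mul_cancel, hψ1]
  obtain ⟨O, hO⟩ : ∃ O : OpenNormalSubgroup G, ∀ h : H, (h : G) ∈ O.toSubgroup → ψ h = 0 := by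
    obtain ⟨W, hW, hWψ⟩ := isOpen_induced_iff.1 (hψ.isOpen_fiber 0)
    have h1 : (1 : G) ∈ W := by
      have : (1 : H) ∈ ((↑) : H → G) ⁻¹' W := by rw [hWψ]; exact hψ1
      exact this
    obtain ⟨O, hO⟩ := IsProP.exists_openNormalSubgroup_le p (hW.mem_nhds h1)
    refine ⟨O, fun h hh => ?_⟩
    have : h ∈ ((↑) : H → G) ⁻¹' W := hO _ hh
    rwa [hWψ] at this
  let N : Subgroup G := H ⊔ O.toSubgroup
  let t : G → G := fun g => (QuotientGroup.mk g : G ⧸ N).out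
  have ht : ∀ g, ∃ (h : H) (o : O.toSubgroup), g = h * t g * o := by
    intro g
    have h1 : g * (t g)⁻¹ ∈ N := by
      have h2 : (QuotientGroup.mk (t g) : G ⧸ N) = QuotientGroup.mk g := QuotientGroup.out_eq' _
      have := QuotientGroup.eq.1 h2
      have h3 := (inferInstance : N.Normal).conj_mem _ this (t g)
      rwa [mul_inv_cancel_left] at h3
    obtain ⟨h, hh, o, ho, heq⟩ := Subgroup.mem_sup_of_normal_left.1 h1
    refine ⟨⟨h, hh⟩, ⟨(t g)⁻¹ * o * t g, ?_⟩, ?_⟩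
    · simpa using O.isNormal'.conj_mem o ho (t g)⁻¹
    · simp only [mul_assoc, mul_inv_cancel_left]
      rw [← mul_assoc, heq, inv_mul_cancel_right]
  choose η ω hηω using ht
  have htN : ∀ g g' : G, (QuotientGroup.mk g : G ⧸ N) = QuotientGroup.mk g' → t g = t g' :=
    fun g g' h => by simp only [t, h]
  have huniq : ∀ (g : G) (h : H) (o : O.toSubgroup), g = h * t g * o → ψ (η g) = ψ h := by
    intro g h o hg
    have h1 : (h : G) * t g * o = η g * t g * ω g := hg.symm.trans (hηω g)
    have h2 : ((h⁻¹ * η g : H) : G) = t g * (o * (ω g : G)⁻¹) * (t g)⁻¹ := by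
      have h3 : (η g : G) = h * t g * o * (ω g : G)⁻¹ * (t g)⁻¹ := by rw [h1]; group
      rw [Subgroup.coe_mul, Subgroup.coe_inv, h3]
      group
    have h3 := hO (h⁻¹ * η g) (by
      rw [h2]
      exact O.isNormal'.conj_mem _ (mul_mem o.2 (inv_mem (ω g).2)) _)
    rw [hmul, hinv] at h3
    exact (neg_add_eq_zero.1 h3).symm
  have hleft : ∀ (h : H) (g : G), ψ (η (h * g)) = ψ h + ψ (η g) := by
    intro h g
    rw [← hmul]
    refine huniq _ _ (ω g) ?_
    have : t (h * g) = t g := htN _ _ (by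
      rw [eq_comm, QuotientGroup.eq]
      have : g⁻¹ * (h * g) ∈ H := by
        simpa [mul_assoc] using (inferInstance : H.Normal).conj_mem h h.2 g⁻¹
      exact Subgroup.mem_sup_left this)
    rw [this, Subgroup.coe_mul]
    conv_lhs => rw [hηω g]
    group
  have hright : ∀ (g : G) (o : O.toSubgroup), ψ (η (g * o)) = ψ (η g) := by
    intro g o
    refine huniq _ _ (ω g * o) ?_
    have : t (g * o) = t g := htN _ _ (by
      rw [eq_comm, QuotientGroup.eq, inv_mul_cancel_left]
      exact Subgroup.mem_sup_right o.2)
    rw [this, Subgroup.coe_mul, ← mul_assoc, ← hηω g]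
  let q : G → A := fun g => ψ (η g) - ψ (η 1)
  have hql : ∀ (h : H) (g : G), q (h * g) = ψ h + q g := fun h g => by
    simp only [q, hleft]; abel
  have hqH : ∀ h : H, q h = ψ h := fun h => by
    have := hql h 1
    rwa [mul_one, show q 1 = 0 from sub_self _, add_zero] at this
  have hq : IsLocallyConstant q := by
    rw [IsLocallyConstant.iff_eventually_eq]
    intro g
    have hg : Tendsto (fun y => g⁻¹ * y) (𝓝 g) (𝓝 1) := by
      have := (continuous_const_mul g⁻¹).tendsto g
      rwa [inv_mul_cancel] at this
    filter_upwards [hg (O.isOpen.mem_nhds (one_mem O.toSubgroup))] with y hy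
    have := hright g ⟨g⁻¹ * y, hy⟩
    simp only [mul_inv_cancel_left] at this
    simp only [q, this]
  let c₀ : G → G → A := fun g g' => q (g * g') - q g - ρ g (q g')
  have hc₀ : ∀ (h h' : H) (g g' : G), c₀ (h * g) (h' * g') = c₀ g g' := by
    intro h h' g g'
    have h1 : (h : G) * g * (h' * g') =
        ((h * MulAut.conjNormal g h' : H) : G) * (g * g') := by
      simp [mul_assoc]
    have h2 : ((h * g : G) : G ⧸ H) = g := by
      rw [QuotientGroup.mk_mul, (QuotientGroup.eq_one_iff _).2 h.2, one_mul]
    simp only [c₀, h1, hql, h2, hmul, hconj, map_add]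
    abel
  have hlift : ∀ g g' : G, (g : G ⧸ H) = g' → ∃ h : H, g = h * g' := by
    intro g g' h
    refine ⟨⟨g * g'⁻¹, ?_⟩, by simp⟩
    rw [← QuotientGroup.eq_one_iff, QuotientGroup.mk_mul, QuotientGroup.mk_inv, h, mul_inv_cancel]
  let c : G ⧸ H → G ⧸ H → A := fun x y => c₀ x.out y.out
  have hc : ∀ g g' : G, c g g' = c₀ g g' := by
    intro g g'
    obtain ⟨h, hh⟩ := hlift (g : G ⧸ H).out g (QuotientGroup.out_eq' _)
    obtain ⟨h', hh'⟩ := hlift (g' : G ⧸ H).out g' (QuotientGroup.out_eq' _)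
    simp only [c]
    rw [hh, hh', hc₀]
  refine ⟨q, c, hq, ?_, hqH, fun g => ⟨(η 1)⁻¹ * η g, ?_⟩, fun g g' => ?_⟩
  · have hopen : IsOpenQuotientMap (Prod.map (QuotientGroup.mk : G → G ⧸ H)
        (QuotientGroup.mk : G → G ⧸ H)) :=
      QuotientGroup.isOpenQuotientMap_mk.prodMap QuotientGroup.isOpenQuotientMap_mk
    have h1 : IsLocallyConstant fun x : G × G => c₀ x.1 x.2 := by
      rw [IsLocallyConstant.iff_eventually_eq]
      rintro ⟨g, g'⟩
      have e₁ := (hq.comp_continuous (continuous_mul (M := G))).eventually_eq (g, g')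
      have e₂ := (hq.comp_continuous (continuous_fst (X := G) (Y := G))).eventually_eq (g, g')
      have e₃ := (hq.comp_continuous (continuous_snd (X := G) (Y := G))).eventually_eq (g, g')
      have e₄ := ((hρ (q g')).comp_continuous ((QuotientGroup.continuous_mk (N := H)).comp
        (continuous_fst (X := G) (Y := G)))).eventually_eq (g, g')
      filter_upwards [e₁, e₂, e₃, e₄] with x h₁ h₂ h₃ h₄
      simp only [Function.comp_apply] at h₁ h₂ h₃ h₄
      simp only [c₀, h₁, h₂, h₃, h₄]
    intro s
    rw [← hopen.isQuotientMap.isOpen_preimage]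
    convert h1 s using 1
    ext ⟨g, g'⟩
    simp only [Set.mem_preimage, Prod.map_apply, hc]
  · simp only [q, hmul, hinv]
    abel
  · rw [hc]
    simp only [c₀]
    abel

/-- If `H₂(G/H, ℤ_p) = 0`, then every invariant character of `H` extends to `G`; in particular it
vanishes on `H ∩ cl[G, G]`. -/
theorem eq_zero_of_mem_commutator_closure [Fact p.Prime] [hG : IsProP p G] (H : Subgroup G)
    [H.Normal] [hcl : IsClosed (H : Set G)] (hH : Subsingleton (ProfiniteHomology p (G ⧸ H) 2))
    (ψ : H → QZ) (hψ : IsLocallyConstant ψ) (hmul : ∀ h h', ψ (h * h') = ψ h + ψ h')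
    (hconj : ∀ (g : G) (h : H), ψ (MulAut.conjNormal g h) = ψ h) (k : ℕ)
    (hk : ∀ h, p ^ k • ψ h = 0) (h : H) (hh : (h : G) ∈ (commutator G).topologicalClosure) :
    ψ h = 0 := by
  have := IsProP.quotient p H
  obtain ⟨q, c, hq, hc, hqH, hqψ, hqc⟩ := exists_cochain_extending p H
    (1 : G ⧸ H →* AddMonoid.End QZ) (fun a => IsLocallyConstant.const a) ψ hψ hmul hconj
  have hqc' : ∀ g g' : G, c g g' = q (g * g') - q g - q g' := fun g g' => by
    rw [hqc, MonoidHom.one_apply, AddMonoid.End.one_apply]; abel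
  have hqk : ∀ g, p ^ k • q g = 0 := fun g => by
    obtain ⟨h, hh⟩ := hqψ g
    rw [hh, hk]
  obtain ⟨a, ha, hac⟩ := exists_coboundary_two hH k c hc (fun g g' => by
    obtain ⟨g, rfl⟩ := QuotientGroup.mk_surjective g
    obtain ⟨g', rfl⟩ := QuotientGroup.mk_surjective g'
    rw [hqc', smul_sub, smul_sub, hqk, hqk, hqk, sub_zero, sub_zero]) (fun g g' l => by
    obtain ⟨g, rfl⟩ := QuotientGroup.mk_surjective g
    obtain ⟨g', rfl⟩ := QuotientGroup.mk_surjective g'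
    obtain ⟨l, rfl⟩ := QuotientGroup.mk_surjective l
    rw [← QuotientGroup.mk_mul, ← QuotientGroup.mk_mul, hqc', hqc', hqc', hqc', mul_assoc]
    abel)
  let Ψ : G →* Multiplicative QZ :=
    { toFun := fun g => Multiplicative.ofAdd (q g + a g)
      map_one' := by
        have h1 : q 1 = 0 := by
          have := hqH 1
          rw [Subgroup.coe_one] at this
          rw [this]
          simpa using hmul 1 1
        have h2 := hac 1 1
        have h3 := hqc' 1 1
        rw [mul_one, h1, sub_zero, sub_zero, QuotientGroup.mk_one, h2, mul_one,
          add_sub_cancel_right] at h3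
        rw [h1, QuotientGroup.mk_one, h3, add_zero, ofAdd_zero]
      map_mul' := fun g g' => by
        rw [← ofAdd_add]
        congr 1
        have h1 := hac g g'
        rw [hqc', ← QuotientGroup.mk_mul] at h1
        have h2 : q (g * g') = q g + q g' + (a g + a g' - a ((g * g' : G) : G ⧸ H)) := by
          rw [← h1]; abel
        rw [h2]
        abel }
  have hΨ : IsLocallyConstant Ψ :=
    (hq.comp₂ (ha.comp_continuous QuotientGroup.continuous_mk) (· + ·)).comp Multiplicative.ofAdd
  have hker : (commutator G).topologicalClosure ≤ Ψ.ker := by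
    refine Subgroup.topologicalClosure_minimal _ (Abelianization.commutator_subset_ker Ψ) ?_
    exact hΨ.isClosed_fiber 1
  have h1 : q h + a (h : G) = 0 := hker hh
  have h2 : a 1 = 0 := by
    have : Ψ 1 = 1 := map_one Ψ
    have h3 : q ((1 : H) : G) + a ((1 : G) : G ⧸ H) = 0 := this
    rwa [hqH, show ψ 1 = 0 by simpa using hmul 1 1, zero_add, QuotientGroup.mk_one] at h3
  rwa [hqH, (QuotientGroup.eq_one_iff _).2 h.2, h2, add_zero] at h1

end Extension

/-! ### Pro-`p` modules -/

section ProPModules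

open CompletedGroupAlgebra

section Separation

variable (p : ℕ) {A : Type*} [AddCommGroup A] [TopologicalSpace A]

theorem IsProPAddCommGroup.exists_openAddSubgroup [IsProPAddCommGroup p A] {W : Set A}
    (hW : W ∈ 𝓝 (0 : A)) :
    ∃ V : AddSubgroup A, IsOpen (V : Set A) ∧ (V : Set A) ⊆ W := by
  have := IsProPAddCommGroup.nonarchimedean p (A := A)
  obtain ⟨V, hV⟩ := NonarchimedeanAddGroup.is_nonarchimedean W hW
  exact ⟨V.toAddSubgroup, V.isOpen, hV⟩

/-- A closed subgroup of an abelian pro-`p` group is the intersection of the open subgroups that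
contain it. -/
theorem IsProPAddCommGroup.mem_of_forall_open [IsProPAddCommGroup p A] {B : AddSubgroup A}
    (hB : IsClosed (B : Set A))
    {x : A} (h : ∀ V : AddSubgroup A, IsOpen (V : Set A) → x ∈ B ⊔ V) : x ∈ B := by
  have := IsProPAddCommGroup.nonarchimedean p (A := A)
  by_contra hx
  have hW : (fun a => x - a) ⁻¹' (B : Set A)ᶜ ∈ 𝓝 (0 : A) :=
    (continuous_const.sub continuous_id).continuousAt.preimage_mem_nhds
      (hB.isOpen_compl.mem_nhds (by simpa using hx))
  obtain ⟨V, hV, hVW⟩ := IsProPAddCommGroup.exists_openAddSubgroup p hW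
  obtain ⟨b, hb, v, hv, rfl⟩ := AddSubgroup.mem_sup.1 (h V hV)
  exact hVW hv (by simpa using hb)

end Separation

section Augmentation

variable (G A : Type*) [Group G] [AddCommGroup A] [DistribMulAction G A] [TopologicalSpace A]
  [IsTopologicalAddGroup A]

/-- The closed subgroup of a topological `G`-module `A` generated by the elements `g • x - x`; the
quotient by it is the module of (profinite) coinvariants. -/
def closedAugmentation : AddSubgroup A :=
  (AddSubgroup.closure {a : A | ∃ (g : G) (x : A), g • x - x = a}).topologicalClosure

variable {G A}

theorem isClosed_closedAugmentation : IsClosed (closedAugmentation G A : Set A) :=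
  AddSubgroup.isClosed_topologicalClosure _

theorem smul_sub_mem_closedAugmentation (g : G) (x : A) : g • x - x ∈ closedAugmentation G A :=
  AddSubgroup.le_topologicalClosure _ (AddSubgroup.subset_closure ⟨g, x, rfl⟩)

theorem closedAugmentation_le {B : AddSubgroup A} (hB : IsClosed (B : Set A))
    (h : ∀ (g : G) (x : A), g • x - x ∈ B) : closedAugmentation G A ≤ B := by
  refine AddSubgroup.topologicalClosure_minimal _ ((AddSubgroup.closure_le _).2 ?_) hB
  rintro _ ⟨g, x, rfl⟩
  exact h g x

theorem map_mem_closedAugmentation {B : Type*} [AddCommGroup B] [DistribMulAction G B]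
    [TopologicalSpace B] [IsTopologicalAddGroup B] (f : A →+ B) (hf : Continuous f)
    (hfg : ∀ (g : G) (x : A), f (g • x) = g • f x) {x : A} (hx : x ∈ closedAugmentation G A) :
    f x ∈ closedAugmentation G B := by
  have : closedAugmentation G A ≤ (closedAugmentation G B).comap f := by
    refine closedAugmentation_le (isClosed_closedAugmentation.preimage hf) fun g x => ?_
    rw [AddSubgroup.mem_comap, map_sub, hfg]
    exact smul_sub_mem_closedAugmentation g _
  exact this hx

end Augmentation

section Invariants

variable (p : ℕ) [Fact p.Prime]

theorem exists_hom_zmod_apply_ne_zero_of_module {V : Type*} [AddCommGroup V] [Module (ZMod p) V]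
    {v : V} (hv : v ≠ 0) : ∃ f : V →+ ZMod p, f v ≠ 0 := by
  by_contra! h
  exact hv ((Module.forall_dual_apply_eq_zero_iff (ZMod p) v).1 fun f => h f.toAddMonoidHom)

theorem exists_hom_zmod_apply_ne_zero {V : Type*} [AddCommGroup V] (hV : ∀ v : V, p • v = 0) {v : V}
    (hv : v ≠ 0) : ∃ f : V →+ ZMod p, f v ≠ 0 := by
  have := AddCommGroup.zmodModule hV
  exact exists_hom_zmod_apply_ne_zero_of_module p hv

/-- A nonzero finite abelian group of `p`-power exponent has a nonzero homomorphism to `ℤ/p`. -/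
theorem exists_ne_zero_hom_zmod {M : Type*} [AddCommGroup M] [Nontrivial M] (n : ℕ)
    (hn : ∀ m : M, p ^ n • m = 0) : ∃ φ : M →+ ZMod p, φ ≠ 0 := by
  let B : AddSubgroup M := (nsmulAddMonoidHom p : M →+ M).range
  have hB : ∃ m, m ∉ B := by
    by_contra! h
    have hsurj : ∀ k : ℕ, ∀ m : M, ∃ m', p ^ k • m' = m := by
      intro k
      induction k with
      | zero => exact fun m => ⟨m, by simp⟩
      | succ k ih =>
        intro m
        obtain ⟨m₁, rfl⟩ := h m
        obtain ⟨m₂, rfl⟩ := ih m₁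
        exact ⟨m₂, by rw [nsmulAddMonoidHom_apply, smul_smul, pow_succ']⟩
    obtain ⟨m, hm⟩ := exists_ne (0 : M)
    obtain ⟨m', rfl⟩ := hsurj n m
    exact hm (hn m')
  obtain ⟨m, hm⟩ := hB
  obtain ⟨f, hf⟩ := exists_hom_zmod_apply_ne_zero p (V := M ⧸ B) (fun x => by
    obtain ⟨y, rfl⟩ := QuotientAddGroup.mk_surjective x
    rw [← QuotientAddGroup.mk_nsmul, QuotientAddGroup.eq_zero_iff]
    exact ⟨y, rfl⟩) (v := QuotientAddGroup.mk m)
    (fun h => hm ((QuotientAddGroup.eq_zero_iff m).1 h))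
  refine ⟨f.comp (QuotientAddGroup.mk' B), fun h => hf ?_⟩
  exact DFunLike.congr_fun h m

variable {G : Type*} [Group G]

/-- A finite `p`-group acting on a nonzero finite `p`-primary group `M` fixes a nonzero element of
`Hom(M, 𝔽_p)`. -/
theorem exists_invariant_hom_of_finite (U : Subgroup G) [U.Normal] (hU : IsPGroup p (G ⧸ U))
    {M : Type*} [AddCommGroup M] [Finite M] [Nontrivial M] (n : ℕ) (hn : ∀ m : M, p ^ n • m = 0)
    (ρ : G →* AddMonoid.End M) (hρ : ∀ g ∈ U, ρ g = 1) :
    ∃ φ : M →+ ZMod p, φ ≠ 0 ∧ ∀ g m, φ (ρ g m) = φ m := by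
  have hp0 : NeZero p := ⟨(Fact.out : p.Prime).ne_zero⟩
  have hfin : Finite (M →+ ZMod p) := DFunLike.finite _
  let _ : MulAction G (M →+ ZMod p) :=
    { smul := fun g φ => φ.comp (ρ g⁻¹)
      one_smul := fun φ => by
        change φ.comp (ρ 1⁻¹) = φ
        rw [inv_one, map_one]
        exact AddMonoidHom.comp_id φ
      mul_smul := fun g h φ => by
        change φ.comp (ρ (g * h)⁻¹) = (φ.comp (ρ h⁻¹)).comp (ρ g⁻¹)
        rw [mul_inv_rev, map_mul]
        rfl }
  have hsmul : ∀ (g : G) (φ : M →+ ZMod p) (m : M), (g • φ) m = φ (ρ g⁻¹ m) := fun _ _ _ => rfl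
  let f : G →* Equiv.Perm (M →+ ZMod p) := MulAction.toPermHom G (M →+ ZMod p)
  have hf : IsPGroup p f.range := by
    rintro ⟨_, g, rfl⟩
    obtain ⟨k, hk⟩ := hU (QuotientGroup.mk g)
    rw [← QuotientGroup.mk_pow, QuotientGroup.eq_one_iff] at hk
    refine ⟨k, Subtype.ext ?_⟩
    change f g ^ p ^ k = 1
    rw [← map_pow]
    ext φ m
    change φ (ρ (g ^ p ^ k)⁻¹ m) = φ m
    rw [hρ _ (inv_mem hk)]
    rfl
  have hcard : p ∣ Nat.card (M →+ ZMod p) := by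
    have h1 : IsPGroup p (Multiplicative (M →+ ZMod p)) := fun φ => ⟨1, by
      change p ^ 1 • φ.toAdd = 0
      ext m
      simp⟩
    obtain ⟨φ, hφ⟩ := exists_ne_zero_hom_zmod p n hn
    have : Nontrivial (Multiplicative (M →+ ZMod p)) :=
      ⟨⟨Multiplicative.ofAdd φ, Multiplicative.ofAdd 0, fun h => hφ h⟩⟩
    obtain ⟨k, hk0, hk⟩ := h1.nontrivial_iff_card.1 this
    have hk' : Nat.card (M →+ ZMod p) = p ^ k := hk
    rw [hk']
    exact dvd_pow_self p hk0.ne'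
  obtain ⟨φ, hφ, h0⟩ := hf.exists_fixed_point_of_prime_dvd_card_of_fixed_point
    (M →+ ZMod p) hcard (a := 0) (by
      rintro ⟨_, g, rfl⟩
      ext m
      rfl)
  refine ⟨φ, fun h => h0 h.symm, fun g m => ?_⟩
  have := DFunLike.congr_fun (hφ ⟨f g⁻¹, ⟨g⁻¹, rfl⟩⟩) m
  change φ (ρ g⁻¹⁻¹ m) = φ m at this
  rwa [inv_inv] at this

variable [TopologicalSpace G] [IsTopologicalGroup G] [hG : IsProP p G]
  {A : Type*} [AddCommGroup A] [TopologicalSpace A] [IsProPAddCommGroup p A]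
  [DistribMulAction G A]

/-- The input from the pro-`p` property of `G`: a `G`-stable subgroup `C` not contained in an open
`G`-stable subgroup `B` has a nonzero invariant homomorphism to `𝔽_p` vanishing on `C ∩ B`. -/
theorem exists_invariant_hom_zmod {i : OpenNormalSubgroup G × ℕ} {B : AddSubgroup A}
    (hB : Controls i p B) (C : AddSubgroup A) (hC : ∀ (g : G) (a : A), a ∈ C → g • a ∈ C)
    (hCB : ¬ C ≤ B) :
    ∃ φ : C →+ ZMod p, φ ≠ 0 ∧ (∀ c : C, (c : A) ∈ B → φ c = 0) ∧
      ∀ (g : G) (c : C), φ ⟨g • (c : A), hC g c c.2⟩ = φ c := by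
  have := IsProPAddCommGroup.nonarchimedean p (A := A)
  have := IsProPAddCommGroup.compactSpace p (A := A)
  let B' : AddSubgroup C := B.addSubgroupOf C
  have hAB : Finite (A ⧸ B) := AddSubgroup.quotient_finite_of_isOpen B hB.isOpen
  have hfin : Finite (C ⧸ B') := by
    refine Finite.of_injective (QuotientAddGroup.map B' B C.subtype le_rfl) ?_
    rw [injective_iff_map_eq_zero]
    intro x hx
    obtain ⟨c, rfl⟩ := QuotientAddGroup.mk_surjective x
    exact (QuotientAddGroup.eq_zero_iff _).2 ((QuotientAddGroup.eq_zero_iff (c : A)).1 hx)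
  have hnt : Nontrivial (C ⧸ B') := by
    obtain ⟨c, hc, hcB⟩ := SetLike.not_le_iff_exists.1 hCB
    exact ⟨⟨QuotientAddGroup.mk ⟨c, hc⟩, 0, fun h =>
      hcB ((QuotientAddGroup.eq_zero_iff (⟨c, hc⟩ : C)).1 h)⟩⟩
  let act : G → C →+ C := fun g =>
    { toFun := fun c => ⟨g • (c : A), hC g c c.2⟩
      map_zero' := Subtype.ext (smul_zero g)
      map_add' := fun c d => Subtype.ext (smul_add g (c : A) d) }
  have hact : ∀ g, B' ≤ B'.comap (act g) := fun g c hc => hB.smul_mem g c hc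
  let ρ : G →* AddMonoid.End (C ⧸ B') :=
    { toFun := fun g => QuotientAddGroup.map B' B' (act g) (hact g)
      map_one' := by
        refine AddMonoidHom.ext fun x => ?_
        obtain ⟨c, rfl⟩ := QuotientAddGroup.mk_surjective x
        exact congrArg QuotientAddGroup.mk (Subtype.ext (one_smul G (c : A)))
      map_mul' := fun g h => by
        refine AddMonoidHom.ext fun x => ?_
        obtain ⟨c, rfl⟩ := QuotientAddGroup.mk_surjective x
        exact congrArg QuotientAddGroup.mk (Subtype.ext (mul_smul g h (c : A))) }
  obtain ⟨φ, hφ0, hφ⟩ := exists_invariant_hom_of_finite p i.1.toSubgroup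
    (hG.isPGroup_quotient i.1) (M := C ⧸ B') i.2 (fun x => by
      obtain ⟨c, rfl⟩ := QuotientAddGroup.mk_surjective x
      rw [← QuotientAddGroup.mk_nsmul, QuotientAddGroup.eq_zero_iff]
      exact hB.pow_mem c) ρ (fun g hg => by
      refine AddMonoidHom.ext fun x => ?_
      obtain ⟨c, rfl⟩ := QuotientAddGroup.mk_surjective x
      change QuotientAddGroup.mk (act g c) = QuotientAddGroup.mk c
      rw [eq_comm, QuotientAddGroup.eq, neg_add_eq_sub]
      exact hB.sub_mem g hg c)
  refine ⟨φ.comp (QuotientAddGroup.mk' B'), fun h => hφ0 ?_, fun c hc => ?_, fun g c => ?_⟩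
  · refine AddMonoidHom.ext fun x => ?_
    obtain ⟨c, rfl⟩ := QuotientAddGroup.mk_surjective x
    exact DFunLike.congr_fun h c
  · change φ (QuotientAddGroup.mk c) = 0
    rw [(QuotientAddGroup.eq_zero_iff c).2 hc, map_zero]
  · exact hφ g (QuotientAddGroup.mk c)

end Invariants

end ProPModules

/-! ### Lifting invariant homomorphisms through a presentation of `H^ab` -/

section Lifting

open CompletedGroupAlgebra

section ToAb

variable {G : Type*} [Group G] [TopologicalSpace G] [IsTopologicalGroup G] {H : Subgroup G}

/-- The class in `H^ab` of an element of `H`. -/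
def AbSubgroup.mk (h : H) : AbSubgroup H := Additive.ofMul (QuotientGroup.mk h)

theorem AbSubgroup.mk_mul (h h' : H) :
    AbSubgroup.mk (h * h') = AbSubgroup.mk h + AbSubgroup.mk h' := rfl

theorem AbSubgroup.mk_inv (h : H) : AbSubgroup.mk h⁻¹ = -AbSubgroup.mk h := rfl

theorem AbSubgroup.mk_one : AbSubgroup.mk (1 : H) = 0 := rfl

theorem AbSubgroup.mk_surjective : Function.Surjective (AbSubgroup.mk (H := H)) := fun x => by
  obtain ⟨h, hh⟩ := QuotientGroup.mk_surjective x.toMul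
  exact ⟨h, congrArg Additive.ofMul hh⟩

theorem AbSubgroup.mk_eq_zero {h : H} :
    AbSubgroup.mk h = 0 ↔ h ∈ (commutator H).topologicalClosure :=
  QuotientGroup.eq_one_iff h

theorem AbSubgroup.continuous_mk : Continuous (AbSubgroup.mk (H := H)) :=
  QuotientGroup.continuous_mk

theorem AbSubgroup.isOpenMap_mk : IsOpenMap (AbSubgroup.mk (H := H)) :=
  QuotientGroup.isOpenMap_coe

theorem AbSubgroup.mk_conj [H.Normal] (g : G) (h : H) :
    AbSubgroup.mk (MulAut.conjNormal g h) = (g : G ⧸ H) • AbSubgroup.mk h := rfl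

end ToAb

variable (p : ℕ) [Fact p.Prime] {G : Type*} [Group G] [TopologicalSpace G] [IsTopologicalGroup G]
  {H : Subgroup G} [H.Normal] {P : Type*} [AddCommGroup P] [TopologicalSpace P]
  [DistribMulAction (G ⧸ H) P] [ContinuousSMul (G ⧸ H) P]

/-- A `1`-cochain measuring a class in the kernel of a surjection `π : P → H^ab` modulo an open
stable subgroup `K` containing `ker π`: a locally constant function `q : G → P` such that `q h` is
congruent modulo `K` to the preimages of the class of `h`, for `h ∈ H`, and such that
`q (g g') - q g - g q(g')` only depends modulo `K` on the classes of `g` and `g'` in `G/H`. -/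
theorem exists_cochain_of_surjective [hG : IsProP p G] [hcl : IsClosed (H : Set G)]
    [hP : IsProPAddCommGroup p P] (π : P →+ AbSubgroup H) (hπc : Continuous π)
    (hπs : Function.Surjective π) (hπ : ∀ (g : G ⧸ H) (x : P), π (g • x) = g • π x)
    (K : AddSubgroup P) (hKo : IsOpen (K : Set P)) (hker : π.ker ≤ K)
    (hK : ∀ (g : G ⧸ H) (x : P), x ∈ K → g • x ∈ K) :
    ∃ (q : G → P) (c : G ⧸ H → G ⧸ H → P), IsLocallyConstant q ∧
      IsLocallyConstant (fun x : (G ⧸ H) × (G ⧸ H) => c x.1 x.2) ∧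
      (∀ (h : H) (x : P), π x = AbSubgroup.mk h → x - q h ∈ K) ∧
      ∀ g g' : G, q g + (g : G ⧸ H) • q g' - q (g * g') + c g g' ∈ K := by
  have := hG.compactSpace
  have := IsProPAddCommGroup.nonarchimedean p (A := P)
  have := IsProPAddCommGroup.compactSpace p (A := P)
  have := IsProPAddCommGroup.t2Space p (A := AbSubgroup H)
  have hdisc : DiscreteTopology (P ⧸ K) := QuotientAddGroup.discreteTopology hKo
  let ρ : G ⧸ H →* AddMonoid.End (P ⧸ K) :=
    { toFun := fun g => QuotientAddGroup.map K K (DistribMulAction.toAddMonoidEnd (G ⧸ H) P g)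
        fun x hx => hK g x hx
      map_one' := by
        refine AddMonoidHom.ext fun x => ?_
        obtain ⟨x, rfl⟩ := QuotientAddGroup.mk_surjective x
        exact congrArg QuotientAddGroup.mk (one_smul _ x)
      map_mul' := fun g g' => by
        refine AddMonoidHom.ext fun x => ?_
        obtain ⟨x, rfl⟩ := QuotientAddGroup.mk_surjective x
        exact congrArg QuotientAddGroup.mk (mul_smul g g' x) }
  have hρmk : ∀ (g : G ⧸ H) (x : P), ρ g (QuotientAddGroup.mk x) = QuotientAddGroup.mk (g • x) :=
    fun _ _ => rfl
  have hρ : ∀ a, IsLocallyConstant fun g => ρ g a := by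
    intro a
    obtain ⟨x, rfl⟩ := QuotientAddGroup.mk_surjective a
    refine (IsLocallyConstant.iff_continuous _).2 ?_
    have : Continuous fun g : G ⧸ H => g • x := continuous_id.smul continuous_const
    exact QuotientAddGroup.continuous_mk.comp this
  let σ : AbSubgroup H → P := Function.surjInv hπs
  let ψ : H → P ⧸ K := fun h => QuotientAddGroup.mk (σ (AbSubgroup.mk h))
  have hψ : ∀ (h : H) (x : P), π x = AbSubgroup.mk h → ψ h = QuotientAddGroup.mk x := by
    intro h x hx
    rw [QuotientAddGroup.eq]
    refine hker ?_
    rw [AddMonoidHom.mem_ker, map_add, map_neg, hx, Function.surjInv_eq hπs, neg_add_cancel]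
  have hσ : ∀ h : H, π (σ (AbSubgroup.mk h)) = AbSubgroup.mk h := fun h =>
    Function.surjInv_eq hπs _
  have hmul : ∀ h h', ψ (h * h') = ψ h + ψ h' := fun h h' =>
    hψ _ _ (by rw [map_add, hσ, hσ, AbSubgroup.mk_mul])
  have hlc : IsLocallyConstant ψ := by
    refine isLocallyConstant_of_eventually_eq_zero ψ hmul ?_
    have hquot : IsQuotientMap π := hπc.isClosedMap.isQuotientMap hπc hπs
    have hopen : IsOpen (π '' K) := by
      rw [← hquot.isOpen_preimage]
      convert hKo using 1
      ext x
      constructor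
      · rintro ⟨y, hy, hxy⟩
        have : x - y ∈ K := hker (by rw [AddMonoidHom.mem_ker, map_sub, hxy, sub_self])
        simpa using K.add_mem this hy
      · exact fun hx => ⟨x, hx, rfl⟩
    have h1 : AbSubgroup.mk (1 : H) ∈ π '' K := ⟨0, K.zero_mem, map_zero π⟩
    filter_upwards [AbSubgroup.continuous_mk.continuousAt (hopen.mem_nhds h1)] with h hh
    obtain ⟨y, hy, hyh⟩ := hh
    rw [hψ h y hyh]
    exact (QuotientAddGroup.eq_zero_iff y).2 hy
  obtain ⟨q, c, hq, hc, hqH, -, hqc⟩ := exists_cochain_extending p H ρ hρ ψ hlc hmul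
    (fun g h => hψ _ _ ((hπ g _).trans (by rw [hσ, AbSubgroup.mk_conj])))
  have hout : ∀ a : P ⧸ K, QuotientAddGroup.mk a.out = a := fun a => QuotientAddGroup.out_eq' a
  refine ⟨fun g => (q g).out, fun g g' => (c g g').out, hq.comp _, hc.comp _, fun h x hx => ?_,
    fun g g' => ?_⟩
  · rw [← QuotientAddGroup.eq_zero_iff, QuotientAddGroup.mk_sub, hout, hqH, hψ h x hx, sub_self]
  · rw [← QuotientAddGroup.eq_zero_iff, QuotientAddGroup.mk_add, QuotientAddGroup.mk_sub,
      QuotientAddGroup.mk_add, hout, hout, ← hρmk, hout, hout, hqc]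
    abel

/-- Let `φ` be a character of `P` whose restriction to the open stable subgroup `K ⊇ ker π` is
invariant and killed by `p`. The obstruction to making `φ` invariant on the fibre product of `P` and
`H` over `H^ab` is first a class in `H³(G/H, 𝔽_p) = 0`, then a class in `H²(G, ℚ_p/ℤ_p) = 0`. So
there is a locally constant function `θ` on `P × H` that restricts to an invariant character of the fibre
product and agrees with `φ` on `ker π`. -/
theorem exists_character_fibreProduct [hG : IsProP p G] [hcl : IsClosed (H : Set G)]
    [hP : IsProPAddCommGroup p P] (hcd : Subsingleton (trivialCohomology (G ⧸ H) (ZMod p) 3))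
    (hH₂ : Subsingleton (ProfiniteHomology p G 2)) (π : P →+ AbSubgroup H) (hπc : Continuous π)
    (hπs : Function.Surjective π) (hπ : ∀ (g : G ⧸ H) (x : P), π (g • x) = g • π x)
    (K : AddSubgroup P) (hKo : IsOpen (K : Set P)) (hker : π.ker ≤ K)
    (hK : ∀ (g : G ⧸ H) (x : P), x ∈ K → g • x ∈ K) (φ : P →+ QZ) (hφlc : IsLocallyConstant φ)
    (hφp : ∀ x ∈ K, p • φ x = 0) (hφ : ∀ (g : G ⧸ H), ∀ x ∈ K, φ (g • x) = φ x) :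
    ∃ θ : P → H → QZ, IsLocallyConstant (fun x : P × H => θ x.1 x.2) ∧
      (∀ x h y h', π x = AbSubgroup.mk h → π y = AbSubgroup.mk h' →
        θ (x + y) (h * h') = θ x h + θ y h') ∧
      (∀ x h (g : G), π x = AbSubgroup.mk h →
        θ ((g : G ⧸ H) • x) (MulAut.conjNormal g h) = θ x h) ∧
      ∀ x ∈ π.ker, θ x 1 = φ x := by
  have := IsProPAddCommGroup.nonarchimedean p (A := P)
  have := IsProP.quotient p H
  obtain ⟨q, c, hq, hc, hqH, hqc⟩ := exists_cochain_of_surjective p π hπc hπs hπ K hKo hker hK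
  have hqcont : Continuous q := hq.continuous
  have hccont : Continuous fun x : (G ⧸ H) × (G ⧸ H) => c x.1 x.2 := hc.continuous
  -- the coboundary of `c` takes values in `K`, as `c` is a coboundary on `G` modulo `K`
  let F : G → G → P := fun g g' => q g + (g : G ⧸ H) • q g' - q (g * g') + c g g'
  have hF : ∀ g g', F g g' ∈ K := hqc
  let δ : G ⧸ H → G ⧸ H → G ⧸ H → P := fun g h k =>
    g • c h k - c (g * h) k + c g (h * k) - c g h
  have hδF : ∀ g h k : G, δ g h k = (g : G ⧸ H) • F h k - F (g * h) k + F g (h * k) - F g h := by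
    intro g h k
    simp only [δ, F, smul_add, smul_sub, smul_smul, QuotientGroup.mk_mul, mul_assoc]
    abel
  have hδ : ∀ g h k, δ g h k ∈ K := by
    intro g h k
    obtain ⟨g, rfl⟩ := QuotientGroup.mk_surjective g
    obtain ⟨h, rfl⟩ := QuotientGroup.mk_surjective h
    obtain ⟨k, rfl⟩ := QuotientGroup.mk_surjective k
    rw [hδF]
    exact K.sub_mem (K.add_mem (K.sub_mem (hK _ _ (hF _ _)) (hF _ _)) (hF _ _)) (hF _ _)
  obtain ⟨b, hb, hbp, hbu⟩ := exists_coboundary_three_QZ p hcd (fun g h k => φ (δ g h k))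
    (hφlc.comp_continuous (f := fun x : (G ⧸ H) × (G ⧸ H) × (G ⧸ H) => δ x.1 x.2.1 x.2.2) (by
      have h1 : Continuous fun x : (G ⧸ H) × (G ⧸ H) × (G ⧸ H) => c x.2.1 x.2.2 :=
        hccont.comp continuous_snd
      have h2 : Continuous fun x : (G ⧸ H) × (G ⧸ H) × (G ⧸ H) => c (x.1 * x.2.1) x.2.2 :=
        hccont.comp (f := fun x : (G ⧸ H) × (G ⧸ H) × (G ⧸ H) => (x.1 * x.2.1, x.2.2))
          (by fun_prop)
      have h3 : Continuous fun x : (G ⧸ H) × (G ⧸ H) × (G ⧸ H) => c x.1 (x.2.1 * x.2.2) :=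
        hccont.comp (f := fun x : (G ⧸ H) × (G ⧸ H) × (G ⧸ H) => (x.1, x.2.1 * x.2.2))
          (by fun_prop)
      have h4 : Continuous fun x : (G ⧸ H) × (G ⧸ H) × (G ⧸ H) => c x.1 x.2.1 :=
        hccont.comp (f := fun x : (G ⧸ H) × (G ⧸ H) × (G ⧸ H) => (x.1, x.2.1)) (by fun_prop)
      exact (((continuous_fst.smul h1).sub h2).add h3).sub h4))
    (fun g h k => hφp _ (hδ g h k)) (fun g h k l => by
      rw [← hφ g (δ h k l) (hδ h k l), ← map_sub, ← map_add, ← map_sub, ← map_add, ← map_zero φ]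
      congr 1
      simp only [δ, smul_add, smul_sub, smul_smul, mul_assoc]
      abel)
  obtain ⟨a, ha, haf⟩ := exists_coboundary_two hH₂ 1
    (fun g h : G => φ (F g h) - b g h)
    (IsLocallyConstant.comp₂ (hφlc.comp_continuous (f := fun x : G × G => F x.1 x.2) (by
      have h1 : Continuous fun x : G × G => c x.1 x.2 :=
        hccont.comp (f := fun x : G × G => ((x.1 : G ⧸ H), (x.2 : G ⧸ H)))
          ((QuotientGroup.continuous_mk.comp continuous_fst).prodMk
            (QuotientGroup.continuous_mk.comp continuous_snd))
      have h2 : Continuous fun x : G × G => (x.1 : G ⧸ H) • q x.2 :=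
        (QuotientGroup.continuous_mk.comp continuous_fst).smul (hqcont.comp continuous_snd)
      exact (((hqcont.comp continuous_fst).add h2).sub (hqcont.comp continuous_mul)).add h1))
      (hb.comp_continuous (f := fun x : G × G => ((x.1 : G ⧸ H), (x.2 : G ⧸ H)))
          ((QuotientGroup.continuous_mk.comp continuous_fst).prodMk
            (QuotientGroup.continuous_mk.comp continuous_snd))) (· - ·))
    (fun g h => by rw [pow_one, smul_sub, hφp _ (hF g h), hbp, sub_zero])
    (fun g h k => by
      have h1 := hbu g h k
      rw [hδF, map_sub, map_add, map_sub, hφ _ _ (hF h k)] at h1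
      simp only [QuotientGroup.mk_mul]
      rw [← sub_eq_zero] at h1
      rw [← h1]
      abel)
  -- the multiplication rule of the extension of `G` by `P` defined by `c`
  have hΘ : ∀ (x y : P) (g g' : G), x - q g ∈ K → y - q g' ∈ K →
      φ (x + (g : G ⧸ H) • y + c g g' - q (g * g')) + a (g * g') =
        φ (x - q g) + a g + (φ (y - q g') + a g') + b g g' := by
    intro x y g g' hx hy
    have h1 : x + (g : G ⧸ H) • y + c g g' - q (g * g') =
        (x - q g) + (g : G ⧸ H) • (y - q g') + F g g' := by
      simp only [F, smul_sub]; abel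
    have h2 := haf g g'
    rw [h1, map_add, map_add, hφ _ _ hy]
    rw [sub_eq_iff_eq_add] at h2
    rw [h2]
    abel
  -- `c` and `b` are not normalized; the two cocycle identities give what is needed at `1`
  have hb1 : ∀ g : G ⧸ H, φ (c 1 g) - φ (c g 1) = b 1 g - b g 1 := by
    intro g
    have hc1 : c 1 1 ∈ K := by
      have h0 : -q 1 ∈ K := by simpa using hqH 1 0 (map_zero π)
      have h1 : q 1 + c 1 1 ∈ K := by simpa [F] using hF 1 1
      simpa using K.add_mem h0 h1
    have h1 := hbu 1 1 g
    have h2 := hbu g 1 1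
    simp only [δ, one_smul, one_mul, mul_one, map_add, map_sub, hφ g _ hc1] at h1 h2
    have h3 : φ (c 1 g) - φ (c g 1) = (φ (c 1 g) - φ (c 1 g) + φ (c 1 g) - φ (c 1 1)) +
      (φ (c 1 1) - φ (c g 1) + φ (c g 1) - φ (c g 1)) := by abel
    rw [h3, h1, h2]
    abel
  -- the constant that makes `θ` vanish at the neutral element
  let κ : QZ := b 1 1 - φ (c 1 1)
  let θ : P → H → QZ := fun x h => φ (x - q h) + a h + κ
  have hmul : ∀ x h y h', π x = AbSubgroup.mk h → π y = AbSubgroup.mk h' →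
      θ (x + y) (h * h') = θ x h + θ y h' := by
    intro x h y h' hx hy
    have h1 := hΘ x y h h' (hqH h x hx) (hqH h' y hy)
    have hone : ∀ h : H, ((h : G) : G ⧸ H) = 1 := fun h => (QuotientGroup.eq_one_iff _).2 h.2
    rw [hone, hone, one_smul] at h1
    have h2 : x + y + c 1 1 - q (h * h') = (x + y - q (h * h')) + c 1 1 := by abel
    rw [h2, map_add] at h1
    simp only [θ, κ, Subgroup.coe_mul]
    have h3 : φ (x + y - q (h * h')) + a (h * h') = φ (x - q h) + a h + (φ (y - q h') + a h') +
        b 1 1 - φ (c 1 1) := by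
      rw [← h1]; abel
    rw [h3]
    abel
  refine ⟨θ, ?_, hmul, ?_, ?_⟩
  · have h1 : Continuous fun x : P × H => x.1 - q x.2 :=
      continuous_fst.sub (hqcont.comp (continuous_subtype_val.comp continuous_snd))
    have h2 : IsLocallyConstant fun x : P × H => a x.2 :=
      ha.comp_continuous (continuous_subtype_val.comp continuous_snd)
    exact (hφlc.comp_continuous h1).comp₂ h2 fun u v => u + v + κ
  · intro x h g hx
    have hh : ((h : G) : G ⧸ H) = 1 := (QuotientGroup.eq_one_iff _).2 h.2
    have hh' : (((MulAut.conjNormal g h : H) : G) : G ⧸ H) = 1 :=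
      (QuotientGroup.eq_one_iff _).2 (MulAut.conjNormal g h).2
    have hx' : π ((g : G ⧸ H) • x) = AbSubgroup.mk (MulAut.conjNormal g h) := by
      rw [hπ, hx, AbSubgroup.mk_conj]
    have hqq : q g - q g ∈ K := by rw [sub_self]; exact K.zero_mem
    have h1 := hΘ (q g) x g h hqq (hqH h x hx)
    have h2 := hΘ ((g : G ⧸ H) • x) (q g) (MulAut.conjNormal g h : H) g (hqH _ _ hx') hqq
    have h3 : ((MulAut.conjNormal g h : H) : G) * g = g * h := by
      rw [MulAut.conjNormal_apply, inv_mul_cancel_right]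
    rw [hh] at h1
    rw [hh', h3, one_smul] at h2
    have h4 := hb1 g
    have e1 : q g + (g : G ⧸ H) • x + c g 1 - q (g * h) =
      (q g + (g : G ⧸ H) • x - q (g * h)) + c g 1 := by abel
    have e2 : (g : G ⧸ H) • x + q g + c 1 g - q (g * h) =
      (q g + (g : G ⧸ H) • x - q (g * h)) + c 1 g := by abel
    rw [e1, map_add, sub_self, map_zero, zero_add] at h1
    rw [e2, map_add, sub_self, map_zero, zero_add] at h2
    simp only [θ]
    rw [← sub_eq_zero] at h1 h2 h4 ⊢
    generalize φ ((g : G ⧸ H) • x - q (MulAut.conjNormal g h : H)) = A₁ at *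
    generalize φ (q g + (g : G ⧸ H) • x - q (g * h)) = A₂ at *
    calc _ = (φ (c 1 g) - φ (c g 1) - (b 1 g - b g 1)) + (A₂ + φ (c g 1) + a (g * h) -
          (a g + (φ (x - q h) + a h) + b g 1)) - (A₂ + φ (c 1 g) + a (g * h) -
          (A₁ + a (MulAut.conjNormal g h : H) + a g + b 1 g)) := by abel
      _ = 0 := by rw [h1, h2, h4]; simp
  · intro x hx
    have hx1 : π x = AbSubgroup.mk (1 : H) := hx
    have h0 : θ 0 1 = 0 := by
      have := hmul 0 1 0 1 (map_zero π) (map_zero π)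
      rw [add_zero, mul_one] at this
      exact left_eq_add.1 this
    have h1 : θ x 1 = φ x + θ 0 1 := by
      simp only [θ, map_sub, map_zero]; abel
    rw [h1, h0, add_zero]

end Lifting

/-! ### Presentations of `H^ab` with small kernel -/

section Injectivity

open CompletedGroupAlgebra

variable (p : ℕ) [Fact p.Prime] {G : Type*} [Group G] [TopologicalSpace G] [IsTopologicalGroup G]
  {H : Subgroup G} [H.Normal] {P : Type*} [AddCommGroup P] [TopologicalSpace P]
  [DistribMulAction (G ⧸ H) P]

/-- An invariant character of the fibre product of `P` and `H` over `H^ab` kills the commutators of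
`H`, because `P` is abelian; so it descends to `P`. -/
theorem exists_character_of_fibreProduct [IsTopologicalAddGroup P] (π : P →+ AbSubgroup H)
    (hπc : Continuous π) (hπs : Function.Surjective π)
    (hπ : ∀ (g : G ⧸ H) (x : P), π (g • x) = g • π x) (θ : P → H → QZ)
    (hθlc : IsLocallyConstant (fun x : P × H => θ x.1 x.2))
    (hmul : ∀ x h y h', π x = AbSubgroup.mk h → π y = AbSubgroup.mk h' →
      θ (x + y) (h * h') = θ x h + θ y h')
    (hconj : ∀ x h (g : G), π x = AbSubgroup.mk h →
      θ ((g : G ⧸ H) • x) (MulAut.conjNormal g h) = θ x h) :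
    ∃ Φ : P →+ QZ, IsLocallyConstant Φ ∧ (∀ (g : G ⧸ H) x, Φ (g • x) = Φ x) ∧
      ∀ x ∈ π.ker, Φ x = θ x 1 := by
  have h0 : θ 0 1 = 0 := by
    have := hmul 0 1 0 1 (map_zero π) (map_zero π)
    rw [add_zero, mul_one] at this
    exact left_eq_add.1 this
  have hneg : ∀ x h, π x = AbSubgroup.mk h → θ (-x) h⁻¹ = -θ x h := by
    intro x h hx
    have := hmul (-x) h⁻¹ x h (by rw [map_neg, hx, AbSubgroup.mk_inv]) hx
    rw [neg_add_cancel, inv_mul_cancel, h0] at this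
    exact (neg_eq_of_add_eq_zero_left this.symm).symm
  have hc0 : ∀ h : H, h ∈ (commutator H).topologicalClosure → θ 0 h = 0 := by
    let T : Subgroup H :=
      { carrier := {h | AbSubgroup.mk h = 0 ∧ θ 0 h = 0}
        one_mem' := ⟨AbSubgroup.mk_one, h0⟩
        mul_mem' := fun {h h'} hh hh' => by
          refine ⟨by rw [AbSubgroup.mk_mul, hh.1, hh'.1, add_zero], ?_⟩
          have := hmul 0 h 0 h' (by rw [hh.1, map_zero]) (by rw [hh'.1, map_zero])
          rwa [hh.2, hh'.2, add_zero, add_zero] at this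
        inv_mem' := fun {h} hh => by
          refine ⟨by rw [AbSubgroup.mk_inv, hh.1, neg_zero], ?_⟩
          have := hneg 0 h (by rw [hh.1, map_zero])
          rwa [hh.2, neg_zero] at this }
    have hT : (commutator H).topologicalClosure ≤ T := by
      refine Subgroup.topologicalClosure_minimal _ ?_ ?_
      · rw [commutator_def, Subgroup.commutator_le]
        intro h _ h' _
        obtain ⟨x, hx⟩ := hπs (AbSubgroup.mk h)
        obtain ⟨y, hy⟩ := hπs (AbSubgroup.mk h')
        refine ⟨AbSubgroup.mk_eq_zero.2 (Subgroup.le_topologicalClosure _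
          (Subgroup.commutator_mem_commutator (Subgroup.mem_top h) (Subgroup.mem_top h'))), ?_⟩
        have hx' : π (-x) = AbSubgroup.mk h⁻¹ := by rw [map_neg, hx, AbSubgroup.mk_inv]
        have hy' : π (-y) = AbSubgroup.mk h'⁻¹ := by rw [map_neg, hy, AbSubgroup.mk_inv]
        have e₁ := hmul x h y h' hx hy
        have e₂ := hmul (x + y) (h * h') (-x) h⁻¹ (by rw [map_add, hx, hy, AbSubgroup.mk_mul]) hx'
        have e₃ := hmul (x + y + -x) (h * h' * h⁻¹) (-y) h'⁻¹
          (by rw [map_add, map_add, hx, hy, hx', AbSubgroup.mk_mul, AbSubgroup.mk_mul]) hy'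
        rw [e₂, e₁, hneg x h hx, hneg y h' hy] at e₃
        have e₄ : x + y + -x + -y = 0 := by abel
        rw [e₄] at e₃
        rw [commutatorElement_def, e₃]
        abel
      · have h1 : IsClosed {h : H | θ 0 h = 0} :=
          (hθlc.comp_continuous (f := fun h : H => ((0 : P), h)) (by fun_prop)).isClosed_fiber 0
        have h2 : IsClosed {h : H | AbSubgroup.mk h = 0} := by
          simp only [AbSubgroup.mk_eq_zero]
          exact Subgroup.isClosed_topologicalClosure _
        exact h2.inter h1
    exact fun h hh => (hT hh).2
  have hindep : ∀ x h h', π x = AbSubgroup.mk h → π x = AbSubgroup.mk h' → θ x h = θ x h' := by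
    intro x h h' hx hx'
    have h1 := hmul x h (-x) h'⁻¹ hx (by rw [map_neg, hx', AbSubgroup.mk_inv])
    rw [hneg x h' hx', add_neg_cancel, hc0] at h1
    · exact (sub_eq_zero.1 (by rw [sub_eq_add_neg]; exact h1.symm))
    · rw [← AbSubgroup.mk_eq_zero, AbSubgroup.mk_mul, AbSubgroup.mk_inv, ← hx, ← hx',
        add_neg_cancel]
  choose η hη using fun x => AbSubgroup.mk_surjective (π x)
  have hΦ : ∀ x h, π x = AbSubgroup.mk h → θ x (η x) = θ x h := fun x h hx =>
    hindep x _ _ (hη x).symm hx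
  let Φ : P →+ QZ :=
    { toFun := fun x => θ x (η x)
      map_zero' := by rw [hΦ 0 1 (map_zero π), h0]
      map_add' := fun x y => by
        rw [hΦ (x + y) (η x * η y) (by rw [map_add, AbSubgroup.mk_mul, hη, hη])]
        exact hmul _ _ _ _ (hη x).symm (hη y).symm }
  refine ⟨Φ, ?_, fun g x => ?_, fun x hx => hΦ x 1 hx⟩
  · have h1 : ∀ᶠ y in 𝓝 ((0 : P), (1 : H)), θ y.1 y.2 = 0 := by
      filter_upwards [hθlc.eventually_eq ((0 : P), (1 : H))] with y hy
      exact hy.trans h0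
    rw [nhds_prod_eq, eventually_prod_iff] at h1
    obtain ⟨pa, hpa, pb, hpb, hθ0⟩ := h1
    have h2 : AbSubgroup.mk '' {h : H | pb h} ∈ 𝓝 (π 0) := by
      rw [map_zero]
      exact AbSubgroup.isOpenMap_mk.image_mem_nhds (x := 1) hpb
    have h3 : ∀ᶠ x in 𝓝 (0 : P), Φ x = 0 := by
      filter_upwards [hpa, hπc.continuousAt.preimage_mem_nhds h2] with x hx hx'
      obtain ⟨h, hh, hhx⟩ := hx'
      exact (hΦ x h hhx.symm).trans (hθ0 hx hh)
    exact isLocallyConstant_of_eventually_eq_zero (G := Multiplicative P) Φ (map_add Φ) h3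
  · obtain ⟨g, rfl⟩ := QuotientGroup.mk_surjective g
    have hx : π ((g : G ⧸ H) • x) = AbSubgroup.mk (MulAut.conjNormal g (η x)) := by
      rw [hπ, AbSubgroup.mk_conj, hη]
    exact (hΦ _ _ hx).trans (hconj x (η x) g (hη x).symm)

variable [ContinuousSMul (G ⧸ H) P]

/-- If the kernel of a surjection `π : P → H^ab` of pro-`p` `G/H`-modules becomes trivial in the
coinvariants of `P`, then `π` is an isomorphism. -/
theorem injective_of_ker_le_closedAugmentation [hG : IsProP p G] [hcl : IsClosed (H : Set G)]
    [hP : IsProPAddCommGroup p P] [IsTopologicalAddGroup P]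
    (hcd : Subsingleton (trivialCohomology (G ⧸ H) (ZMod p) 3))
    (hH₂ : Subsingleton (ProfiniteHomology p G 2)) (π : P →+ AbSubgroup H) (hπc : Continuous π)
    (hπs : Function.Surjective π) (hπ : ∀ (g : G ⧸ H) (x : P), π (g • x) = g • π x)
    (hle : π.ker ≤ closedAugmentation (G ⧸ H) P) : Function.Injective π := by
  have := IsProP.quotient p H
  have := hG.compactSpace
  have := IsProPAddCommGroup.t2Space p (A := P)
  have hp0 : NeZero p := ⟨(Fact.out : p.Prime).ne_zero⟩
  rw [injective_iff_map_eq_zero]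
  by_contra! hne
  obtain ⟨k, hk, hk0⟩ := hne
  obtain ⟨i, V, hV, hVk⟩ := exists_controls (p := p) (G := G ⧸ H)
    (isOpen_compl_singleton.mem_nhds (Ne.symm hk0))
  have hstab : ∀ (g : G ⧸ H) (x : P), x ∈ π.ker → g • x ∈ π.ker := fun g x hx => by
    rw [AddMonoidHom.mem_ker, hπ, hx, smul_zero]
  obtain ⟨φ, hφ0, hφV, hφ⟩ := exists_invariant_hom_zmod p hV π.ker hstab
    fun h => hVk (h hk) rfl
  -- extend `φ` to a character of `P / V`
  obtain ⟨φ₁, hφ₁⟩ := QZ.exists_factor ((QuotientAddGroup.mk' V).comp π.ker.subtype)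
    ((QZ.ofZMod p).comp φ) (fun x hx => by
      have : (x : P) ∈ V := (QuotientAddGroup.eq_zero_iff (x : P)).1 hx
      rw [AddMonoidHom.comp_apply, hφV x this, map_zero])
  let φ' : P →+ QZ := φ₁.comp (QuotientAddGroup.mk' V)
  have hφ'K : ∀ x : π.ker, φ' x = QZ.ofZMod p (φ x) := hφ₁
  have hφ'V : ∀ x ∈ V, φ' x = 0 := fun x hx => by
    change φ₁ (QuotientAddGroup.mk x) = 0
    rw [(QuotientAddGroup.eq_zero_iff x).2 hx, map_zero]
  have hlc : IsLocallyConstant φ' := by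
    have : DiscreteTopology (P ⧸ V) := QuotientAddGroup.discreteTopology hV.isOpen
    exact (IsLocallyConstant.of_discrete φ₁).comp_continuous QuotientAddGroup.continuous_mk
  obtain ⟨θ, hθlc, hθm, hθc, hθK⟩ := exists_character_fibreProduct p hcd hH₂ π hπc hπs hπ
    (π.ker ⊔ V) (AddSubgroup.isOpen_mono le_sup_right hV.isOpen) le_sup_left (fun g x hx => by
      obtain ⟨y, hy, v, hv, rfl⟩ := AddSubgroup.mem_sup.1 hx
      rw [smul_add]
      exact add_mem (AddSubgroup.mem_sup_left (hstab g y hy))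
        (AddSubgroup.mem_sup_right (hV.smul_mem g v hv)))
    φ' hlc (fun x hx => by
      obtain ⟨y, hy, v, hv, rfl⟩ := AddSubgroup.mem_sup.1 hx
      rw [map_add, hφ'V v hv, add_zero, hφ'K ⟨y, hy⟩, QZ.nsmul_ofZMod])
    (fun g x hx => by
      obtain ⟨y, hy, v, hv, rfl⟩ := AddSubgroup.mem_sup.1 hx
      rw [smul_add, map_add, map_add, hφ'V v hv, hφ'V _ (hV.smul_mem g v hv), hφ'K ⟨y, hy⟩,
        hφ'K ⟨g • y, hstab g y hy⟩]
      congr 2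
      exact hφ g ⟨y, hy⟩)
  obtain ⟨Φ, hΦlc, hΦ, hΦK⟩ := exists_character_of_fibreProduct π hπc hπs hπ θ hθlc hθm hθc
  have hI : closedAugmentation (G ⧸ H) P ≤ Φ.ker :=
    closedAugmentation_le (hΦlc.isClosed_fiber 0) fun g x => by
      rw [AddMonoidHom.mem_ker, map_sub, hΦ, sub_self]
  refine hφ0 (AddMonoidHom.ext fun x => QZ.ofZMod_injective p ?_)
  rw [← hφ'K, ← hθK x x.2, ← hΦK x x.2, AddMonoidHom.zero_apply, map_zero]
  exact hI (hle x.2)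

end Injectivity

/-! ### The completed group algebra as a pro-`p` module -/

section ProPCriterion

variable {p : ℕ} [Fact p.Prime]

theorem PadicInt.exists_pow_dvd_imp_mem {W : Set ℤ_[p]} (hW : W ∈ 𝓝 (0 : ℤ_[p])) :
    ∃ n : ℕ, ∀ x : ℤ_[p], (p : ℤ_[p]) ^ n ∣ x → x ∈ W := by
  obtain ⟨ε, hε, hεW⟩ := Metric.mem_nhds_iff.1 hW
  obtain ⟨n, hn⟩ := PadicInt.exists_pow_neg_lt p hε
  refine ⟨n, fun x hx => hεW ?_⟩
  rw [mem_ball_zero_iff]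
  exact ((PadicInt.norm_le_pow_iff_mem_span_pow x n).2 (Ideal.mem_span_singleton.2 hx)).trans_lt hn

theorem PadicInt.exists_finset_pow_dvd_imp_mem {I : Type*} {W : Set (I → ℤ_[p])}
    (hW : W ∈ 𝓝 (0 : I → ℤ_[p])) :
    ∃ (F : Finset I) (n : ℕ), ∀ x : I → ℤ_[p], (∀ i ∈ F, (p : ℤ_[p]) ^ n ∣ x i) → x ∈ W := by
  rw [nhds_pi, Filter.mem_pi] at hW
  obtain ⟨F, hF, t, ht, htW⟩ := hW
  choose n hn using fun i => PadicInt.exists_pow_dvd_imp_mem (ht i)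
  refine ⟨hF.toFinset, hF.toFinset.sup n, fun x hx => htW fun i hi => hn i _ ?_⟩
  have hi' : i ∈ hF.toFinset := hF.mem_toFinset.2 hi
  exact (pow_dvd_pow _ (Finset.le_sup (f := n) hi')).trans (hx i hi')

/-- A compact group with a continuous injective homomorphism to a power of `ℤ_p` is an abelian
pro-`p` group. -/
theorem IsProPAddCommGroup.of_injective {I A : Type*} [AddCommGroup A] [TopologicalSpace A]
    [CompactSpace A] (f : A →+ (I → ℤ_[p])) (hf : Continuous f) (hinj : Function.Injective f) :
    IsProPAddCommGroup p A := by
  have hT2 : T2Space A := T2Space.of_injective_continuous hinj hf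
  have hemb : IsClosedEmbedding f := hf.isClosedEmbedding hinj
  have hadd : IsTopologicalAddGroup A := hemb.isInducing.topologicalAddGroup f
  let B : Finset I → ℕ → AddSubgroup A := fun F n =>
    { carrier := {a | ∀ i ∈ F, (p : ℤ_[p]) ^ n ∣ f a i}
      zero_mem' := fun i _ => by simp
      add_mem' := fun ha hb i hi => by
        rw [map_add, Pi.add_apply]; exact dvd_add (ha i hi) (hb i hi)
      neg_mem' := fun ha i hi => by
        rw [map_neg, Pi.neg_apply]; exact (dvd_neg).2 (ha i hi) }
  have hBo : ∀ F n, IsOpen (B F n : Set A) := by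
    intro F n
    have : (B F n : Set A) = ⋂ i ∈ F, (fun a => f a i) ⁻¹' {x | (p : ℤ_[p]) ^ n ∣ x} := by
      ext a
      simp [B]
    rw [this]
    exact isOpen_biInter_finset fun i _ =>
      (PadicInt.isClopen_setOf_pow_dvd n).isOpen.preimage ((continuous_apply i).comp hf)
  have hB : ∀ W ∈ 𝓝 (0 : A), ∃ F n, (B F n : Set A) ⊆ W := by
    intro W hW
    rw [hemb.isInducing.nhds_eq_comap, map_zero, Filter.mem_comap] at hW
    obtain ⟨W', hW', hWW'⟩ := hW
    obtain ⟨F, n, h⟩ := PadicInt.exists_finset_pow_dvd_imp_mem hW'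
    exact ⟨F, n, fun a ha => hWW' (h _ ha)⟩
  refine ⟨⟨fun W hW => ?_⟩, inferInstance, hT2, fun V hV => ?_⟩
  · obtain ⟨F, n, h⟩ := hB W hW
    exact ⟨⟨B F n, hBo F n⟩, h⟩
  · obtain ⟨F, n, h⟩ := hB V (hV.mem_nhds V.zero_mem)
    refine ⟨n, fun a => h fun i _ => ?_⟩
    rw [map_nsmul, Pi.smul_apply, nsmul_eq_mul, Nat.cast_pow]
    exact dvd_mul_right _ _

end ProPCriterion

namespace CompletedGroupAlgebra

section Topology

variable {p : ℕ} [Fact p.Prime] {G : Type*} [Group G] [TopologicalSpace G]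

/-- The family of all the coefficients of an element of `Λ(G)`. -/
noncomputable def coeffs : CompletedGroupAlgebra p G →+
    ((Σ U : OpenNormalSubgroup G, G ⧸ U.toSubgroup) → ℤ_[p]) where
  toFun x s := (x.1 s.1).coeff s.2
  map_zero' := by
    funext s
    simp
  map_add' x y := by
    funext s
    simp

theorem coeffs_apply (x : CompletedGroupAlgebra p G) (U : OpenNormalSubgroup G)
    (q : G ⧸ U.toSubgroup) : coeffs x ⟨U, q⟩ = (x.1 U).coeff q := rfl

theorem coeffs_injective : Function.Injective (coeffs (p := p) (G := G)) := by
  intro x y h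
  refine Subtype.ext (funext fun U => MonoidAlgebra.ext (Finsupp.ext fun q => ?_))
  exact congrFun h ⟨U, q⟩

/-- The topology of `Λ(G)` as the inverse limit of the `ℤ_p[G/U]` with their `p`-adic topology, that
is, the topology of convergence of the coefficients. -/
noncomputable instance : TopologicalSpace (CompletedGroupAlgebra p G) :=
  TopologicalSpace.induced coeffs inferInstance

theorem isInducing_coeffs : IsInducing (coeffs (p := p) (G := G)) := ⟨rfl⟩

theorem continuous_coeff (U : OpenNormalSubgroup G) (q : G ⧸ U.toSubgroup) :
    Continuous fun x : CompletedGroupAlgebra p G => (x.1 U).coeff q :=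
  (continuous_apply (⟨U, q⟩ : Σ U : OpenNormalSubgroup G, G ⧸ U.toSubgroup)).comp
    isInducing_coeffs.continuous

instance : IsTopologicalAddGroup (CompletedGroupAlgebra p G) :=
  isInducing_coeffs.topologicalAddGroup coeffs

instance [IsTopologicalGroup G] [CompactSpace G] : CompactSpace (CompletedGroupAlgebra p G) := by
  have hfin : ∀ V : OpenNormalSubgroup G, Finite (G ⧸ V.toSubgroup) := fun V =>
    Subgroup.quotient_finite_of_isOpen _ V.isOpen
  refine ⟨?_⟩
  rw [isInducing_coeffs.isCompact_iff, Set.image_univ]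
  refine IsClosed.isCompact ?_
  let S := (Σ U : OpenNormalSubgroup G, G ⧸ U.toSubgroup) → ℤ_[p]
  let e : ∀ (_ : S) (U : OpenNormalSubgroup G), (G ⧸ U.toSubgroup) →₀ ℤ_[p] :=
    fun y U => (Finsupp.linearEquivFunOnFinite ℤ_[p] ℤ_[p] _).symm fun q => y ⟨U, q⟩
  have hcont : ∀ (V : OpenNormalSubgroup G)
      (m : ((G ⧸ V.toSubgroup) →₀ ℤ_[p]) →ₗ[ℤ_[p]] ℤ_[p]),
      Continuous fun y : S => m (e y V) := fun V m =>
    (LinearMap.continuous_on_pi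
      (m ∘ₗ (Finsupp.linearEquivFunOnFinite ℤ_[p] ℤ_[p] _).symm.toLinearMap)).comp
      (continuous_pi fun q => continuous_apply _)
  have hrange : Set.range (coeffs (p := p) (G := G)) =
      {y : S | ∀ (U V : OpenNormalSubgroup G) (h : U.toSubgroup ≤ V.toSubgroup)
        (q : G ⧸ V.toSubgroup), (e y U).mapDomain
          (QuotientGroup.map U.toSubgroup V.toSubgroup (MonoidHom.id G) h) q = e y V q} := by
    ext y
    constructor
    · rintro ⟨x, rfl⟩ U V h q
      have he : ∀ W, e (coeffs x) W = (x.1 W).coeff := fun W =>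
        Finsupp.ext fun q => rfl
      rw [he, he, ← x.2 U V h]
      rfl
    · intro hy
      refine ⟨⟨fun U => .ofCoeff (e y U), fun U V h => ?_⟩, ?_⟩
      · exact MonoidAlgebra.ext (Finsupp.ext fun q => hy U V h q)
      · funext s
        rfl
  rw [hrange]
  simp only [Set.ofPred_forall]
  refine isClosed_iInter fun U => isClosed_iInter fun V => isClosed_iInter fun h =>
    isClosed_iInter fun q => isClosed_eq ?_ ?_
  · exact hcont U (Finsupp.lapply q ∘ₗ Finsupp.lmapDomain ℤ_[p] ℤ_[p] _)
  · exact hcont V (Finsupp.lapply q)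

/-- The natural map `ℤ[G] → Λ(G)`. -/
noncomputable def ofGroupRing : MonoidAlgebra ℤ G →+* CompletedGroupAlgebra p G :=
  RingHom.codRestrict (RingHom.pi fun U => groupRingMap p U) (subring p G)
    fun r U V h => map_groupRingMap U V h r

theorem ofGroupRing_val (r : MonoidAlgebra ℤ G) (U : OpenNormalSubgroup G) :
    (ofGroupRing r : CompletedGroupAlgebra p G).1 U = groupRingMap p U r := rfl

/-- The action of `G` on `Λ(G)` by left multiplication. -/
noncomputable instance : DistribMulAction G (CompletedGroupAlgebra p G) :=
  DistribMulAction.compHom (CompletedGroupAlgebra p G)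
    ((ofGroupRing : MonoidAlgebra ℤ G →+* CompletedGroupAlgebra p G).toMonoidHom.comp
      (MonoidAlgebra.of ℤ G))

theorem group_smul_eq (g : G) (x : CompletedGroupAlgebra p G) :
    g • x = ofGroupRing (MonoidAlgebra.single g 1) * x := rfl

theorem coeff_group_smul (g : G) (x : CompletedGroupAlgebra p G) (U : OpenNormalSubgroup G)
    (q : G ⧸ U.toSubgroup) :
    ((g • x).1 U).coeff q = (x.1 U).coeff ((g : G ⧸ U.toSubgroup)⁻¹ * q) := by
  rw [group_smul_eq, Subring.coe_mul, Pi.mul_apply, ofGroupRing_val]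
  have : groupRingMap p U (MonoidAlgebra.single g 1) =
      MonoidAlgebra.single (g : G ⧸ U.toSubgroup) (1 : ℤ_[p]) := by
    simp [groupRingMap]
  rw [this, MonoidAlgebra.coeff_single_mul_apply, one_mul]

instance [IsTopologicalGroup G] : ContinuousSMul G (CompletedGroupAlgebra p G) := by
  refine ⟨isInducing_coeffs.continuous_iff.2 (continuous_pi ?_)⟩
  rintro ⟨U, q⟩
  change Continuous fun x : G × CompletedGroupAlgebra p G => ((x.1 • x.2).1 U).coeff q
  simp only [coeff_group_smul]
  rw [continuous_iff_continuousAt]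
  rintro ⟨g, x⟩
  have : DiscreteTopology (G ⧸ U.toSubgroup) := QuotientGroup.discreteTopology U.isOpen
  have hlc : IsLocallyConstant fun y : G × CompletedGroupAlgebra p G =>
      (y.1 : G ⧸ U.toSubgroup) :=
    (IsLocallyConstant.iff_continuous _).2 (QuotientGroup.continuous_mk.comp continuous_fst)
  have hc : ContinuousAt (fun y : G × CompletedGroupAlgebra p G =>
      (y.2.1 U).coeff ((g : G ⧸ U.toSubgroup)⁻¹ * q)) (g, x) :=
    ((continuous_coeff U _).comp continuous_snd).continuousAt
  refine hc.congr ?_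
  filter_upwards [hlc.eventually_eq (g, x)] with y hy
  rw [hy]

/-- A finitely generated free module over `Λ(G)` is a pro-`p` `G`-module. -/
instance [IsTopologicalGroup G] [CompactSpace G] (d : ℕ) :
    IsProPAddCommGroup p (Fin d → CompletedGroupAlgebra p G) :=
  IsProPAddCommGroup.of_injective
    (I := Fin d × (Σ U : OpenNormalSubgroup G, G ⧸ U.toSubgroup))
    { toFun := fun x s => coeffs (x s.1) s.2
      map_zero' := by funext s; simp
      map_add' := fun x y => by funext s; simp }
    (continuous_pi fun s => (continuous_coeff s.2.1 s.2.2).comp (continuous_apply s.1))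
    (fun x y h => funext fun i => coeffs_injective (funext fun s => congrFun h (i, s)))

instance [IsTopologicalGroup G] [CompactSpace G] :
    IsProPAddCommGroup p (CompletedGroupAlgebra p G) :=
  IsProPAddCommGroup.of_injective coeffs isInducing_coeffs.continuous coeffs_injective

end Topology

end CompletedGroupAlgebra

/-! ### The augmentation and linear combinations over `Λ(G)` -/

namespace CompletedGroupAlgebra

section Topology

variable {p : ℕ} [Fact p.Prime] {G : Type*} [Group G] [TopologicalSpace G]

theorem setOf_pow_dvd_coeff_mem_nhds [IsTopologicalGroup G] [CompactSpace G]
    (U : OpenNormalSubgroup G) (n : ℕ) :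
    {x : CompletedGroupAlgebra p G | ∀ q, (p : ℤ_[p]) ^ n ∣ (x.1 U).coeff q} ∈
      𝓝 (0 : CompletedGroupAlgebra p G) := by
  have : Finite (G ⧸ U.toSubgroup) := Subgroup.quotient_finite_of_isOpen _ U.isOpen
  refine IsOpen.mem_nhds ?_ fun q => by simp
  simp only [Set.ofPred_forall]
  exact isOpen_iInter_of_finite fun q =>
    (PadicInt.isClopen_setOf_pow_dvd n).isOpen.preimage (continuous_coeff U q)

theorem exists_pow_dvd_coeff_imp_mem {W : Set (CompletedGroupAlgebra p G)}
    (hW : W ∈ 𝓝 (0 : CompletedGroupAlgebra p G)) :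
    ∃ (U : OpenNormalSubgroup G) (n : ℕ), ∀ x : CompletedGroupAlgebra p G,
      (∀ q, (p : ℤ_[p]) ^ n ∣ (x.1 U).coeff q) → x ∈ W := by
  rw [isInducing_coeffs.nhds_eq_comap, map_zero, Filter.mem_comap] at hW
  obtain ⟨W', hW', hWW'⟩ := hW
  obtain ⟨F, n, h⟩ := PadicInt.exists_finset_pow_dvd_imp_mem hW'
  have hF : ∃ U : OpenNormalSubgroup G, ∀ s ∈ F, U.toSubgroup ≤ s.1.toSubgroup := by
    clear h
    classical
    induction F using Finset.induction_on with
    | empty => exact ⟨{ toSubgroup := ⊤, isOpen' := isOpen_univ }, by simp⟩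
    | insert s F _ ih =>
      obtain ⟨U, hU⟩ := ih
      refine ⟨U ⊓ s.1, fun t ht => ?_⟩
      rcases Finset.mem_insert.1 ht with rfl | ht
      · exact fun g hg => hg.2
      · exact fun g hg => hU t ht hg.1
  obtain ⟨U, hU⟩ := hF
  refine ⟨U, n, fun x hx => hWW' (h _ fun s hs => ?_)⟩
  rw [← Sigma.eta s, coeffs_apply, ← x.2 U s.1 (hU s hs)]
  exact Finsupp.dvd_mapDomain_apply _ _ hx _

/-- `ℤ[G]` is dense in `Λ(G)`; the approximation can be chosen so that its augmentation is also
correct modulo `p^n`. -/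
theorem exists_sub_ofGroupRing_mem (x : CompletedGroupAlgebra p G)
    {W : Set (CompletedGroupAlgebra p G)} (hW : W ∈ 𝓝 (0 : CompletedGroupAlgebra p G)) (n : ℕ) :
    ∃ r : MonoidAlgebra ℤ G, x - ofGroupRing r ∈ W ∧
      ∀ U : OpenNormalSubgroup G, U.toSubgroup = ⊤ → r ∈ approx x (U, n) := by
  obtain ⟨U, m, h⟩ := exists_pow_dvd_coeff_imp_mem hW
  obtain ⟨r, hr⟩ := approx_nonempty x (U, max m n)
  refine ⟨r, h _ fun q => ?_, fun V hV => approx_anti x (hV ▸ le_top) (le_max_right m n) hr⟩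
  obtain ⟨c, hc⟩ := approx_anti x le_rfl (le_max_left m n) hr
  refine ⟨c.coeff q, ?_⟩
  rw [AddSubgroupClass.coe_sub, Pi.sub_apply, hc, ofGroupRing_val, add_sub_cancel_left,
    MonoidAlgebra.coeff_smul, Finsupp.smul_apply, nsmul_eq_mul, Nat.cast_pow]

/-- The structure map `ℤ_p → Λ(G)`, as a homomorphism of additive groups. -/
noncomputable def const : ℤ_[p] →+ CompletedGroupAlgebra p G where
  toFun a := ⟨fun U => MonoidAlgebra.single 1 a, fun U V h => by simp⟩
  map_zero' := Subtype.ext (funext fun U => by simp)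
  map_add' a b := Subtype.ext (funext fun U => MonoidAlgebra.single_add _ _ _)

theorem const_one : const (p := p) (G := G) 1 = 1 := rfl

/-- The augmentation `Λ(G) → ℤ_p`, read off from the component `ℤ_p[G/G]`. -/
noncomputable def augmentation : CompletedGroupAlgebra p G →+ ℤ_[p] where
  toFun x := (x.1 { toSubgroup := ⊤, isOpen' := isOpen_univ }).coeff 1
  map_zero' := by simp
  map_add' x y := by simp

theorem continuous_augmentation : Continuous (augmentation (p := p) (G := G)) :=
  continuous_coeff _ _

theorem augmentation_const (a : ℤ_[p]) : augmentation (const (G := G) a) = a := by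
  change (MonoidAlgebra.single 1 a).coeff 1 = a
  simp

theorem augmentation_group_smul (g : G) (x : CompletedGroupAlgebra p G) :
    augmentation (g • x) = augmentation x := by
  change ((g • x).1 _).coeff _ = (x.1 _).coeff _
  rw [coeff_group_smul]
  congr 1
  exact (QuotientGroup.subsingleton_quotient_top (G := G)).elim _ _

theorem pow_dvd_augmentation_sub {x : CompletedGroupAlgebra p G} {r : MonoidAlgebra ℤ G} {n : ℕ}
    (h : ∀ U : OpenNormalSubgroup G, U.toSubgroup = ⊤ → r ∈ approx x (U, n)) :
    ∃ b, augmentation x - augmentation (ofGroupRing r : CompletedGroupAlgebra p G) =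
      p ^ n • b := by
  obtain ⟨c, hc⟩ := h { toSubgroup := ⊤, isOpen' := isOpen_univ } rfl
  refine ⟨c.coeff 1, ?_⟩
  change (x.1 _).coeff 1 - (groupRingMap p _ r).coeff 1 = _
  rw [hc, MonoidAlgebra.coeff_add, Finsupp.add_apply, add_sub_cancel_left,
    MonoidAlgebra.coeff_smul, Finsupp.smul_apply]

variable [IsTopologicalGroup G] [CompactSpace G]

/-- The kernel of the augmentation is topologically generated, as a group, by the `g • x - x`. -/
theorem sub_const_augmentation_mem (x : CompletedGroupAlgebra p G) :
    x - const (augmentation x) ∈ closedAugmentation G (CompletedGroupAlgebra p G) := by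
  have hr : ∀ r : MonoidAlgebra ℤ G, (ofGroupRing r : CompletedGroupAlgebra p G) -
      const (augmentation (ofGroupRing r)) ∈
        closedAugmentation G (CompletedGroupAlgebra p G) := by
    intro r
    induction r using MonoidAlgebra.induction_on with
    | of g =>
      have h1 : (ofGroupRing (MonoidAlgebra.of ℤ G g) : CompletedGroupAlgebra p G) = g • 1 := by
        rw [group_smul_eq, mul_one]; rfl
      have h2 := augmentation_const (p := p) (G := G) 1
      rw [const_one] at h2
      rw [h1, augmentation_group_smul, h2, const_one]
      exact smul_sub_mem_closedAugmentation g 1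
    | add r s hr hs =>
      have := add_mem hr hs
      rwa [sub_add_sub_comm, ← map_add, ← map_add, ← map_add, ← map_add] at this
    | smul n r hr =>
      have := zsmul_mem hr n
      rwa [smul_sub, ← map_zsmul, ← map_zsmul, ← map_zsmul, ← map_zsmul] at this
  refine IsProPAddCommGroup.mem_of_forall_open p isClosed_closedAugmentation fun V hV => ?_
  obtain ⟨n, hn⟩ := IsProPAddCommGroup.exists_pow_smul_mem (p := p) V hV
  obtain ⟨r, hrV, hrx⟩ := exists_sub_ofGroupRing_mem x (hV.mem_nhds V.zero_mem) n
  obtain ⟨b, hb⟩ := pow_dvd_augmentation_sub hrx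
  refine AddSubgroup.mem_sup.2 ⟨_, hr r, (x - ofGroupRing r) - p ^ n • const b,
    sub_mem hrV (hn _), ?_⟩
  rw [← map_nsmul, ← hb, map_sub]
  abel

theorem mem_closedAugmentation_of_augmentation_eq_zero {d : ℕ}
    {x : Fin d → CompletedGroupAlgebra p G} (hx : ∀ i, augmentation (x i) = 0) :
    x ∈ closedAugmentation G (Fin d → CompletedGroupAlgebra p G) := by
  classical
  rw [← Finset.univ_sum_single x]
  refine sum_mem fun i _ => ?_
  have h := sub_const_augmentation_mem (x i)
  rw [hx, map_zero, sub_zero] at h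
  let f : CompletedGroupAlgebra p G →+ (Fin d → CompletedGroupAlgebra p G) :=
    AddMonoidHom.single (fun _ : Fin d => CompletedGroupAlgebra p G) i
  have hf : Continuous f := by
    refine continuous_pi fun j => ?_
    change Continuous fun y : CompletedGroupAlgebra p G =>
      (Pi.single i y : Fin d → CompletedGroupAlgebra p G) j
    by_cases hij : j = i
    · subst hij
      simpa using continuous_id'
    · simpa [hij] using continuous_const
  have hfg : ∀ (g : G) (y : CompletedGroupAlgebra p G), f (g • y) = g • f y := by
    intro g y
    refine funext fun j => ?_
    change (Pi.single i (g • y) : Fin d → CompletedGroupAlgebra p G) j =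
      g • (Pi.single i y : Fin d → CompletedGroupAlgebra p G) j
    by_cases hij : j = i
    · subst hij
      rw [Pi.single_eq_same, Pi.single_eq_same]
    · rw [Pi.single_eq_of_ne hij, Pi.single_eq_of_ne hij, smul_zero]
  exact map_mem_closedAugmentation f hf hfg h

end Topology

section Radical

variable (p : ℕ) (G A : Type*) [Group G] [AddCommGroup A] [DistribMulAction G A]
  [TopologicalSpace A] [IsTopologicalAddGroup A]

/-- The subgroup `I A + p A`, where `I` is the augmentation ideal of `Λ(G)`. -/
def radicalSubgroup : AddSubgroup A :=
  closedAugmentation G A ⊔ (nsmulAddMonoidHom p : A →+ A).range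

variable {p G A}

theorem nsmul_mem_radicalSubgroup (a : A) : p • a ∈ radicalSubgroup p G A :=
  AddSubgroup.mem_sup_right ⟨a, rfl⟩

end Radical

section Modules

variable {p : ℕ} [Fact p.Prime] {G : Type*} [Group G] [TopologicalSpace G]
  [IsTopologicalGroup G] [CompactSpace G] {A : Type*} [AddCommGroup A] [TopologicalSpace A]
  [IsProPAddCommGroup p A] [DistribMulAction G A] [ContinuousSMul G A]
  [Module (CompletedGroupAlgebra p G) A]

/-- The actions of `G` on `Λ(G)` and on `A` are compatible. -/
theorem group_smul_smul (hact : ∀ (x : CompletedGroupAlgebra p G) (a : A), x • a = act x a)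
    (g : G) (x : CompletedGroupAlgebra p G) (a : A) : (g • x) • a = g • x • a := by
  rw [group_smul_eq, mul_smul, hact (ofGroupRing _)]
  refine eq_act_of_forall fun i V _ j => ⟨MonoidAlgebra.single g 1, ⟨0, ?_⟩, ?_⟩
  · rw [ofGroupRing_val, smul_zero, add_zero]
  · rw [groupRingAct_single, one_smul, sub_self]
    exact V.zero_mem

theorem continuous_smul_right
    (hact : ∀ (x : CompletedGroupAlgebra p G) (a : A), x • a = act x a) (a : A) :
    Continuous fun x : CompletedGroupAlgebra p G => x • a := by
  have := IsProPAddCommGroup.nonarchimedean p (A := A)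
  refine continuous_of_continuousAt_zero
    ((AddMonoidHom.flip (AddMonoidHom.smul (R := CompletedGroupAlgebra p G) (M := A))) a) ?_
  refine fun W hW => ?_
  rw [map_zero] at hW
  obtain ⟨i, V, hV, hVW⟩ := exists_controls (p := p) (G := G) hW
  refine mem_map.2 (mem_of_superset (setOf_pow_dvd_coeff_mem_nhds i.1 i.2) fun x hx => hVW ?_)
  change x • a ∈ V
  rw [hact]
  obtain ⟨j, hj⟩ := exists_approx_act x a (hV.isOpen.mem_nhds V.zero_mem)
  obtain ⟨r, hr⟩ := approx_nonempty x (i.1 ⊓ j.1, max i.2 j.2)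
  have h0 : 0 ∈ approx x i := by
    choose c hc using hx
    have : Finite (G ⧸ i.1.toSubgroup) := Subgroup.quotient_finite_of_isOpen _ i.1.isOpen
    refine ⟨.ofCoeff ((Finsupp.linearEquivFunOnFinite ℤ_[p] ℤ_[p] _).symm c), ?_⟩
    refine MonoidAlgebra.ext (Finsupp.ext fun q => ?_)
    rw [hc q, map_zero, zero_add, MonoidAlgebra.coeff_smul, Finsupp.smul_apply, nsmul_eq_mul,
      Nat.cast_pow]
    rfl
  have h1 := sub_mem (hV.sub_mem_of_approx (approx_inf_left x i j hr) h0 a)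
    (hj r (approx_inf_right x i j hr))
  simpa using h1

/-- The homomorphism `Λ(G)^d → A` given by `d` elements of `A`. -/
noncomputable def combination {d : ℕ} (ξ : Fin d → A) :
    (Fin d → CompletedGroupAlgebra p G) →+ A where
  toFun x := ∑ i, x i • ξ i
  map_zero' := by simp
  map_add' x y := by simp [add_smul, Finset.sum_add_distrib]

theorem continuous_combination
    (hact : ∀ (x : CompletedGroupAlgebra p G) (a : A), x • a = act x a) {d : ℕ} (ξ : Fin d → A) :
    Continuous (combination (p := p) (G := G) ξ) := by
  have := IsProPAddCommGroup.nonarchimedean p (A := A)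
  change Continuous fun x : Fin d → CompletedGroupAlgebra p G => ∑ i, x i • ξ i
  exact continuous_finsetSum _ fun i _ =>
    (continuous_smul_right hact (ξ i)).comp (continuous_apply i)

theorem combination_group_smul
    (hact : ∀ (x : CompletedGroupAlgebra p G) (a : A), x • a = act x a) {d : ℕ} (ξ : Fin d → A)
    (g : G) (x : Fin d → CompletedGroupAlgebra p G) :
    combination ξ (g • x) = g • combination ξ x := by
  change ∑ i, (g • x i) • ξ i = g • ∑ i, x i • ξ i
  rw [Finset.smul_sum]
  exact Finset.sum_congr rfl fun i _ => group_smul_smul hact g (x i) (ξ i)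

variable [IsTopologicalAddGroup A]

theorem combination_mem_closedAugmentation
    (hact : ∀ (x : CompletedGroupAlgebra p G) (a : A), x • a = act x a) {d : ℕ} (ξ : Fin d → A)
    {x : Fin d → CompletedGroupAlgebra p G} (hx : ∀ i, augmentation (x i) = 0) :
    combination ξ x ∈ closedAugmentation G A :=
  map_mem_closedAugmentation (combination ξ) (continuous_combination hact ξ)
    (combination_group_smul hact ξ) (mem_closedAugmentation_of_augmentation_eq_zero hx)

theorem exists_combination_eq_of_mem_closedAugmentation
    (hact : ∀ (x : CompletedGroupAlgebra p G) (a : A), x • a = act x a) {d : ℕ} {ξ : Fin d → A}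
    (hξ : Function.Surjective (combination (p := p) (G := G) ξ)) {a : A}
    (ha : a ∈ closedAugmentation G A) :
    ∃ x : Fin d → CompletedGroupAlgebra p G, (∀ i, augmentation (x i) = 0) ∧
      combination ξ x = a := by
  have := IsProPAddCommGroup.t2Space p (A := A)
  let E : AddSubgroup (Fin d → CompletedGroupAlgebra p G) :=
    { carrier := {x | ∀ i, augmentation (x i) = 0}
      zero_mem' := fun i => map_zero _
      add_mem' := fun hx hy i => by rw [Pi.add_apply, map_add, hx i, hy i, add_zero]
      neg_mem' := fun hx i => by rw [Pi.neg_apply, map_neg, hx i, neg_zero] }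
  have hE : IsClosed (E : Set (Fin d → CompletedGroupAlgebra p G)) := by
    change IsClosed {x : Fin d → CompletedGroupAlgebra p G | ∀ i, augmentation (x i) = 0}
    simp only [Set.ofPred_forall]
    exact isClosed_iInter fun i => isClosed_eq
      (continuous_augmentation.comp (continuous_apply i)) continuous_const
  have hle : closedAugmentation G A ≤ E.map (combination ξ) := by
    refine closedAugmentation_le ?_ fun g b => ?_
    · exact (hE.isCompact.image (continuous_combination hact ξ)).isClosed
    · obtain ⟨y, rfl⟩ := hξ b
      refine ⟨g • y - y, fun i => ?_, ?_⟩
      · rw [Pi.sub_apply, map_sub, Pi.smul_apply, augmentation_group_smul, sub_self]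
      · rw [map_sub, combination_group_smul hact]
  obtain ⟨x, hx, rfl⟩ := hle ha
  exact ⟨x, hx, rfl⟩

/-- `Λ(G)` acts on `A / (I A + p A)` through the residue field `𝔽_p`. -/
theorem exists_smul_sub_zsmul_mem_radicalSubgroup
    (hact : ∀ (x : CompletedGroupAlgebra p G) (a : A), x • a = act x a)
    (x : CompletedGroupAlgebra p G) :
    ∃ n : ℤ, (p : ℤ_[p]) ∣ augmentation x - n ∧ ∀ a : A, x • a - n • a ∈ radicalSubgroup p G A := by
  obtain ⟨b, hb⟩ := Ideal.mem_span_singleton'.1 (PadicInt.appr_spec 1 (augmentation x))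
  rw [pow_one] at hb
  refine ⟨(augmentation x).appr 1, ⟨b, ?_⟩, fun a => ?_⟩
  · rw [Int.cast_natCast, ← hb, mul_comm]
  · have h1 : (x - const (augmentation x)) • a ∈ closedAugmentation G A :=
      map_mem_closedAugmentation
        ((AddMonoidHom.smul (R := CompletedGroupAlgebra p G) (M := A)).flip a)
        (continuous_smul_right hact a) (fun g y => group_smul_smul hact g y a)
        (sub_const_augmentation_mem x)
    have h2 : augmentation x = (augmentation x).appr 1 • (1 : ℤ_[p]) + p • b := by
      rw [nsmul_eq_mul, nsmul_eq_mul, mul_one, mul_comm, hb]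
      ring
    have h3 : (const (augmentation x) : CompletedGroupAlgebra p G) =
        (augmentation x).appr 1 • 1 + p • const b := by
      conv_lhs => rw [h2]
      rw [map_add, map_nsmul, map_nsmul, const_one]
    have h4 : x • a - ((augmentation x).appr 1 : ℤ) • a =
        (x - const (augmentation x)) • a + p • (const b : CompletedGroupAlgebra p G) • a := by
      rw [sub_smul, h3, add_smul, smul_assoc, smul_assoc, one_smul, natCast_zsmul]
      abel
    rw [h4]
    exact add_mem (AddSubgroup.mem_sup_left h1) (nsmul_mem_radicalSubgroup _)

end Modules

section Nakayama

variable {p : ℕ} [Fact p.Prime] {G : Type*} [Group G] [TopologicalSpace G]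
  [IsTopologicalGroup G] [hG : IsProP p G] {A : Type*} [AddCommGroup A] [TopologicalSpace A]
  [IsProPAddCommGroup p A] [IsTopologicalAddGroup A] [DistribMulAction G A] [ContinuousSMul G A]

/-- A topological Nakayama lemma: a closed stable subgroup `Y` of `A` with `Y + I A + p A = A` is
all of `A`. -/
theorem mem_of_forall_mem_sup_radicalSubgroup {Y : AddSubgroup A} (hY : IsClosed (Y : Set A))
    (hstab : ∀ (g : G) (a : A), a ∈ Y → g • a ∈ Y) (h : ∀ a : A, a ∈ Y ⊔ radicalSubgroup p G A)
    (a : A) : a ∈ Y := by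
  have := hG.compactSpace
  refine IsProPAddCommGroup.mem_of_forall_open p hY fun V hV => ?_
  obtain ⟨i, V', hV', hle⟩ := exists_controls (p := p) (G := G) (hV.mem_nhds V.zero_mem)
  have hB : Controls i p (Y ⊔ V') :=
    { isOpen := AddSubgroup.isOpen_mono le_sup_right hV'.isOpen
      smul_mem := fun g b hb => by
        obtain ⟨y, hy, v, hv, rfl⟩ := AddSubgroup.mem_sup.1 hb
        rw [smul_add]
        exact AddSubgroup.add_mem_sup (hstab g y hy) (hV'.smul_mem g v hv)
      sub_mem := fun g hg b => AddSubgroup.mem_sup_right (hV'.sub_mem g hg b)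
      pow_mem := fun b => AddSubgroup.mem_sup_right (hV'.pow_mem b) }
  refine sup_le_sup_left (show V' ≤ V from hle) Y ?_
  by_contra haB
  obtain ⟨φ, hφ0, hφB, hφ⟩ := exists_invariant_hom_zmod p hB ⊤ (fun _ _ _ => trivial)
    fun hle => haB (hle trivial)
  refine hφ0 (AddMonoidHom.ext fun c => ?_)
  -- the kernel of `φ` contains `Y`, and also `I A + p A`
  let φ' : A →+ ZMod p := φ.comp (AddSubgroup.topEquiv (G := A)).symm.toAddMonoidHom
  have hker : Y ⊔ V' ≤ φ'.ker := fun b hb => hφB ⟨b, trivial⟩ hb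
  have hopen : IsOpen (φ'.ker : Set A) := AddSubgroup.isOpen_mono hker hB.isOpen
  have haug : closedAugmentation G A ≤ φ'.ker :=
    closedAugmentation_le (AddSubgroup.isClosed_of_isOpen _ hopen) fun g b => by
      rw [AddMonoidHom.mem_ker, map_sub, sub_eq_zero]
      exact hφ g ⟨b, trivial⟩
  have hp : (nsmulAddMonoidHom p : A →+ A).range ≤ φ'.ker := by
    rintro _ ⟨b, rfl⟩
    rw [AddMonoidHom.mem_ker, nsmulAddMonoidHom_apply, map_nsmul, nsmul_eq_mul, CharP.cast_eq_zero,
      zero_mul]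
  exact sup_le (le_sup_left.trans hker) (sup_le haug hp) (h c)

end Nakayama

end CompletedGroupAlgebra

/-! ### Minimal presentations and freeness -/

namespace CompletedGroupAlgebra

section Minimal

variable {p : ℕ} [Fact p.Prime] {G : Type*} [Group G] [TopologicalSpace G]
  [IsTopologicalGroup G] [hG : IsProP p G] {A : Type*} [AddCommGroup A] [TopologicalSpace A]
  [IsProPAddCommGroup p A] [IsTopologicalAddGroup A] [DistribMulAction G A] [ContinuousSMul G A]
  [Module (CompletedGroupAlgebra p G) A]

/-- If a relation `∑ x_i ξ_i = 0` between generators has a coefficient whose augmentation is prime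
to `p`, then the corresponding generator is superfluous. -/
theorem surjective_combination_succAbove
    (hact : ∀ (x : CompletedGroupAlgebra p G) (a : A), x • a = act x a) {d : ℕ}
    {ξ : Fin (d + 1) → A} (hξ : Function.Surjective (combination (p := p) (G := G) ξ))
    {x : Fin (d + 1) → CompletedGroupAlgebra p G} (hx : combination ξ x = 0) {j : Fin (d + 1)}
    (hj : ¬ (p : ℤ_[p]) ∣ augmentation (x j)) :
    Function.Surjective (combination (p := p) (G := G) fun i => ξ (j.succAbove i)) := by
  have := hG.compactSpace
  have := IsProPAddCommGroup.t2Space p (A := A)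
  let Y : AddSubgroup A := (combination (p := p) (G := G) fun i => ξ (j.succAbove i)).range
  have hsplit : ∀ y : Fin (d + 1) → CompletedGroupAlgebra p G, combination ξ y =
      y j • ξ j + combination (fun i => ξ (j.succAbove i)) fun i => y (j.succAbove i) :=
    fun y => Fin.sum_univ_succAbove (fun i => y i • ξ i) j
  have hξj : ξ j ∈ Y ⊔ radicalSubgroup p G A := by
    obtain ⟨n, hn, hna⟩ := exists_smul_sub_zsmul_mem_radicalSubgroup hact (A := A) (x j)
    have hpn : IsCoprime (p : ℤ) n := by
      refine (Nat.prime_iff_prime_int.1 (Fact.out : p.Prime)).irreducible.coprime_iff_not_dvd.2 ?_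
      rintro ⟨m, rfl⟩
      refine hj ((dvd_sub_left ?_).1 hn)
      exact ⟨m, by push_cast; rfl⟩
    obtain ⟨u, v, huv⟩ := hpn
    have h1 : n • ξ j ∈ Y ⊔ radicalSubgroup p G A := by
      have h2 : x j • ξ j ∈ Y := by
        rw [hsplit] at hx
        rw [eq_neg_of_add_eq_zero_left hx]
        exact neg_mem ⟨_, rfl⟩
      have := sub_mem (AddSubgroup.mem_sup_left h2) (AddSubgroup.mem_sup_right (hna (ξ j)))
        (H := Y ⊔ radicalSubgroup p G A)
      rwa [sub_sub_cancel] at this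
    have h3 : ξ j = u • p • ξ j + v • n • ξ j := by
      rw [← natCast_zsmul (ξ j) p, smul_smul, smul_smul, ← add_smul, huv, one_smul]
    rw [h3]
    exact add_mem (zsmul_mem (AddSubgroup.mem_sup_right (nsmul_mem_radicalSubgroup _)) u)
      (zsmul_mem h1 v)
  refine fun a => mem_of_forall_mem_sup_radicalSubgroup (p := p) (G := G) (Y := Y) ?_ ?_
    (fun b => ?_) a
  · exact (isCompact_range (continuous_combination hact _)).isClosed
  · rintro g _ ⟨y, rfl⟩
    exact ⟨g • y, combination_group_smul hact _ g y⟩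
  · obtain ⟨y, rfl⟩ := hξ b
    obtain ⟨n, -, hna⟩ := exists_smul_sub_zsmul_mem_radicalSubgroup hact (A := A) (y j)
    rw [hsplit, ← sub_add_cancel (y j • ξ j) (n • ξ j)]
    exact add_mem (add_mem (AddSubgroup.mem_sup_right (hna _)) (zsmul_mem hξj n))
      (AddSubgroup.mem_sup_left ⟨_, rfl⟩)

/-- If `A / I A` has no `p`-torsion, then the kernel of a minimal presentation `Λ(G)^d → A` lies in
`I Λ(G)^d`. -/
theorem exists_ker_combination_le_closedAugmentation
    (hact : ∀ (x : CompletedGroupAlgebra p G) (a : A), x • a = act x a)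
    [Module.Finite (CompletedGroupAlgebra p G) A]
    (hT : ∀ a : A, p • a ∈ closedAugmentation G A → a ∈ closedAugmentation G A) :
    ∃ (d : ℕ) (ξ : Fin d → A), Function.Surjective (combination (p := p) (G := G) ξ) ∧
      (combination (p := p) (G := G) ξ).ker ≤
        closedAugmentation G (Fin d → CompletedGroupAlgebra p G) := by
  classical
  have := hG.compactSpace
  have hex : ∃ (d : ℕ) (ξ : Fin d → A), Function.Surjective (combination (p := p) (G := G) ξ) := by
    obtain ⟨d, ξ, h⟩ := Module.Finite.exists_fin (R := CompletedGroupAlgebra p G) (M := A)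
    exact ⟨d, ξ, (span_range_eq_top_iff_surjective_fintypeLinearCombination ..).1 h⟩
  obtain ⟨ξ, hξ⟩ := Nat.find_spec hex
  have hmin := fun m => Nat.find_min hex (m := m)
  generalize Nat.find hex = d at ξ hξ hmin
  refine ⟨d, ξ, hξ, fun x hx => mem_closedAugmentation_of_augmentation_eq_zero fun i => ?_⟩
  have hbase : ∀ x : Fin d → CompletedGroupAlgebra p G, combination ξ x = 0 →
      ∀ i, (p : ℤ_[p]) ∣ augmentation (x i) := by
    intro x hx j
    by_contra hj
    cases d with
    | zero => exact j.elim0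
    | succ d =>
      exact hmin d (Nat.lt_succ_self d) ⟨_, surjective_combination_succAbove hact hξ hx hj⟩
  have hpow : ∀ (n : ℕ) (x : Fin d → CompletedGroupAlgebra p G), combination ξ x = 0 →
      ∀ i, (p : ℤ_[p]) ^ n ∣ augmentation (x i) := by
    intro n
    induction n with
    | zero => exact fun x _ i => by rw [pow_zero]; exact one_dvd _
    | succ n ih =>
      intro x hx
      -- `x = p v + y` with `y` of augmentation zero; by hypothesis `v` is, modulo elements of
      -- augmentation zero, again a relation
      choose v hv using hbase x hx
      let w : Fin d → CompletedGroupAlgebra p G := fun i => const (v i)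
      have hw : ∀ i, augmentation (x i - p • w i) = 0 := fun i => by
        rw [map_sub, map_nsmul, augmentation_const, hv, nsmul_eq_mul, sub_self]
      have h1 : p • combination ξ w ∈ closedAugmentation G A := by
        have := combination_mem_closedAugmentation hact ξ (x := x - p • w) hw
        rw [map_sub, hx, zero_sub, map_nsmul] at this
        exact neg_mem_iff.1 this
      obtain ⟨y, hy, hyw⟩ := exists_combination_eq_of_mem_closedAugmentation hact hξ (hT _ h1)
      intro i
      have h2 := ih (w - y) (by rw [map_sub, hyw, sub_self]) i
      rw [Pi.sub_apply, map_sub, hy, sub_zero, augmentation_const] at h2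
      rw [hv, pow_succ']
      exact mul_dvd_mul_left _ h2
  exact PadicInt.eq_zero_of_forall_pow_dvd fun n => hpow n x hx i

/-- For a finitely generated free module `A`, the quotient `A / I A` has no `p`-torsion. -/
theorem mem_closedAugmentation_of_nsmul_mem_of_free
    (hact : ∀ (x : CompletedGroupAlgebra p G) (a : A), x • a = act x a)
    [Module.Finite (CompletedGroupAlgebra p G) A] [Module.Free (CompletedGroupAlgebra p G) A]
    {a : A} (ha : p • a ∈ closedAugmentation G A) : a ∈ closedAugmentation G A := by
  have := hG.compactSpace
  have hnt : Nontrivial (CompletedGroupAlgebra p G) := by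
    refine ⟨⟨const 1, 0, fun h => ?_⟩⟩
    have := congrArg augmentation h
    rw [augmentation_const, map_zero] at this
    exact one_ne_zero this
  let b := (Module.Free.chooseBasis (CompletedGroupAlgebra p G) A).reindex (Fintype.equivFin _)
  have hb : ∀ x, combination (p := p) (G := G) b x = b.equivFun.symm x := fun x =>
    (b.equivFun_symm_apply x).symm
  have hs : Function.Surjective (combination (p := p) (G := G) b) := fun a =>
    ⟨b.equivFun a, by rw [hb, LinearEquiv.symm_apply_apply]⟩
  obtain ⟨x, hx, hxa⟩ := exists_combination_eq_of_mem_closedAugmentation hact hs ha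
  obtain ⟨y, rfl⟩ := hs a
  refine combination_mem_closedAugmentation hact _ fun i => ?_
  rw [← map_nsmul, hb, hb, b.equivFun.symm.injective.eq_iff] at hxa
  have h := hx i
  rw [hxa, Pi.smul_apply, map_nsmul, nsmul_eq_mul] at h
  exact (mul_eq_zero.1 h).resolve_left (Nat.cast_ne_zero.2 (Fact.out : p.Prime).ne_zero)

end Minimal

end CompletedGroupAlgebra

section Core

open CompletedGroupAlgebra

/-- If `H³(G/H, 𝔽_p) = 0` and `H_2(G, ℤ_p) = 0`, then a finitely generated `H^ab` is free over
`Λ(G/H)` if and only if its coinvariants under `G/H` have no `p`-torsion. -/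
theorem AbSubgroup.free_iff_forall_nsmul_mem (p : ℕ) [Fact p.Prime] {G : Type*} [Group G]
    [TopologicalSpace G] [IsTopologicalGroup G] [hG : IsProP p G] (H : Subgroup G) [H.Normal]
    [hcl : IsClosed (H : Set G)] [Module.Finite (CompletedGroupAlgebra p (G ⧸ H)) (AbSubgroup H)]
    (hcd : Subsingleton (trivialCohomology (G ⧸ H) (ZMod p) 3))
    (hH₂ : Subsingleton (ProfiniteHomology p G 2)) :
    Module.Free (CompletedGroupAlgebra p (G ⧸ H)) (AbSubgroup H) ↔
      ∀ a : AbSubgroup H, p • a ∈ closedAugmentation (G ⧸ H) (AbSubgroup H) →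
        a ∈ closedAugmentation (G ⧸ H) (AbSubgroup H) := by
  have := IsProP.quotient p H
  have := hG.compactSpace
  have hact : ∀ (x : CompletedGroupAlgebra p (G ⧸ H)) (a : AbSubgroup H), x • a = act x a :=
    fun _ _ => rfl
  constructor
  · intro _ a ha
    exact mem_closedAugmentation_of_nsmul_mem_of_free hact ha
  · intro hT
    obtain ⟨d, ξ, hξ, hker⟩ := exists_ker_combination_le_closedAugmentation hact hT
    have hinj := injective_of_ker_le_closedAugmentation p hcd hH₂ (combination ξ)
      (continuous_combination hact ξ) hξ (combination_group_smul hact ξ) hker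
    exact Module.Free.of_equiv (LinearEquiv.ofBijective
      (Fintype.linearCombination (CompletedGroupAlgebra p (G ⧸ H)) ξ) ⟨hinj, hξ⟩)

end Core

/-! ### Coinvariants of `H^ab` and torsion of `G^ab` -/

section Coinvariants

variable {G : Type*} [Group G] [TopologicalSpace G] [IsTopologicalGroup G] (H : Subgroup G)
  [H.Normal]

/-- An element of `H` whose class in the coinvariants of `H^ab` vanishes has trivial class in
`G^ab`. -/
theorem mem_commutator_closure_of_mk_mem_closedAugmentation {h : H}
    (hh : AbSubgroup.mk h ∈ closedAugmentation (G ⧸ H) (AbSubgroup H)) :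
    (h : G) ∈ (commutator G).topologicalClosure := by
  have : IsClosed ((commutator G).topologicalClosure : Set G) :=
    Subgroup.isClosed_topologicalClosure _
  let F : AbSubgroup H →+ Additive (TopologicalAbelianization G) :=
    (abelianizationMap H.subtype continuous_subtype_val).toAdditive
  have hF : Continuous F := by
    refine (QuotientGroup.isOpenQuotientMap_mk (G := H)
      (N := (commutator H).topologicalClosure)).isQuotientMap.continuous_iff.2 ?_
    change Continuous fun h : H => (QuotientGroup.mk (h : G) : TopologicalAbelianization G)
    exact QuotientGroup.continuous_mk.comp continuous_subtype_val
  have hT2 : T2Space (Additive (TopologicalAbelianization G)) :=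
    inferInstanceAs (T2Space (TopologicalAbelianization G))
  have hle : closedAugmentation (G ⧸ H) (AbSubgroup H) ≤ F.ker := by
    refine closedAugmentation_le (isClosed_singleton.preimage hF) fun g x => ?_
    obtain ⟨g, rfl⟩ := QuotientGroup.mk_surjective g
    obtain ⟨x, rfl⟩ := AbSubgroup.mk_surjective x
    rw [← AbSubgroup.mk_conj, AddMonoidHom.mem_ker, map_sub, sub_eq_zero]
    change Additive.ofMul (QuotientGroup.mk ((MulAut.conjNormal g x : H) : G) :
      TopologicalAbelianization G) = Additive.ofMul (QuotientGroup.mk (x : G))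
    rw [MulAut.conjNormal_apply]
    change Additive.ofMul ((QuotientGroup.mk g : TopologicalAbelianization G) *
      QuotientGroup.mk (x : G) * (QuotientGroup.mk g)⁻¹) = _
    rw [mul_comm, inv_mul_cancel_left]
  exact (QuotientGroup.eq_one_iff (h : G)).1 (congrArg Additive.toMul (hle hh))

/-- The kernel of `G^ab → (G/H)^ab` is the image of `H`. -/
theorem exists_mk_eq_of_mk_mem_commutator_closure [CompactSpace G]
    [hcl : IsClosed (H : Set G)] {g : G}
    (hg : (g : G ⧸ H) ∈ (commutator (G ⧸ H)).topologicalClosure) :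
    ∃ h : H, (QuotientGroup.mk (h : G) : TopologicalAbelianization G) = QuotientGroup.mk g := by
  have hle : (commutator (G ⧸ H)).topologicalClosure ≤
      (commutator G).topologicalClosure.map (QuotientGroup.mk' H) := by
    refine Subgroup.topologicalClosure_minimal _ ?_ ?_
    · rw [commutator_def, Subgroup.commutator_le]
      intro a _ b _
      obtain ⟨a, rfl⟩ := QuotientGroup.mk_surjective a
      obtain ⟨b, rfl⟩ := QuotientGroup.mk_surjective b
      exact ⟨a * b * a⁻¹ * b⁻¹, Subgroup.le_topologicalClosure _
        (Subgroup.commutator_mem_commutator (Subgroup.mem_top _) (Subgroup.mem_top _)), rfl⟩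
    · exact ((Subgroup.isClosed_topologicalClosure (commutator G)).isCompact.image
        QuotientGroup.continuous_mk).isClosed
  obtain ⟨c, hc, hcg⟩ := hle hg
  refine ⟨⟨c⁻¹ * g, QuotientGroup.eq.1 hcg⟩, ?_⟩
  change (QuotientGroup.mk c : TopologicalAbelianization G)⁻¹ * QuotientGroup.mk g = _
  rw [(QuotientGroup.eq_one_iff c).2 hc, inv_one, one_mul]

variable (p : ℕ) [Fact p.Prime] [hG : IsProP p G] [hcl : IsClosed (H : Set G)]

/-- If `H_2(G/H, ℤ_p) = 0`, then the coinvariants of `H^ab` under `G/H` embed into `G^ab`, as every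
invariant character of `H` vanishes on `H ∩ cl[G, G]`. -/
theorem mk_mem_closedAugmentation_iff (hH : Subsingleton (ProfiniteHomology p (G ⧸ H) 2)) {h : H} :
    AbSubgroup.mk h ∈ closedAugmentation (G ⧸ H) (AbSubgroup H) ↔
      (h : G) ∈ (commutator G).topologicalClosure := by
  refine ⟨mem_commutator_closure_of_mk_mem_closedAugmentation H, fun hh => ?_⟩
  refine IsProPAddCommGroup.mem_of_forall_open p isClosed_closedAugmentation fun V hV => ?_
  by_contra hmem
  set W := closedAugmentation (G ⧸ H) (AbSubgroup H) ⊔ V with hWdef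
  have hW : IsOpen (W : Set (AbSubgroup H)) := AddSubgroup.isOpen_mono le_sup_right hV
  have hdisc : DiscreteTopology (AbSubgroup H ⧸ W) := QuotientAddGroup.discreteTopology hW
  obtain ⟨χ, hχ⟩ := CharacterModule.exists_character_apply_ne_zero_of_ne_zero
    (A := AbSubgroup H ⧸ W) (a := QuotientAddGroup.mk (AbSubgroup.mk h))
    fun h0 => hmem ((QuotientAddGroup.eq_zero_iff _).1 h0)
  obtain ⟨k, hk⟩ := IsProPAddCommGroup.exists_pow_smul_mem (p := p) W hW
  refine hχ (eq_zero_of_mem_commutator_closure p H hH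
    (fun x => χ (QuotientAddGroup.mk (AbSubgroup.mk x))) ?_ (fun x y => ?_) (fun g x => ?_) k
    (fun x => ?_) h hh)
  · exact IsLocallyConstant.comp ((IsLocallyConstant.iff_continuous
      fun x : H => (QuotientAddGroup.mk (AbSubgroup.mk x) : AbSubgroup H ⧸ W)).2
      (QuotientAddGroup.continuous_mk.comp AbSubgroup.continuous_mk)) χ
  · rw [AbSubgroup.mk_mul, QuotientAddGroup.mk_add, map_add]
  · refine congrArg χ ?_
    rw [AbSubgroup.mk_conj, ← sub_eq_zero, ← QuotientAddGroup.mk_sub, QuotientAddGroup.eq_zero_iff]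
    exact AddSubgroup.mem_sup_left (smul_sub_mem_closedAugmentation _ _)
  · rw [← map_nsmul, ← QuotientAddGroup.mk_nsmul, (QuotientAddGroup.eq_zero_iff _).2 (hk _),
      map_zero]

/-- The coinvariants of `H^ab` under `G/H` have no `p`-torsion if and only if no torsion element of
`G^ab` other than `1` comes from `H`. -/
theorem forall_nsmul_mem_iff_injective_torsionMap
    (hH : Subsingleton (ProfiniteHomology p (G ⧸ H) 2)) :
    (∀ a : AbSubgroup H, p • a ∈ closedAugmentation (G ⧸ H) (AbSubgroup H) →
      a ∈ closedAugmentation (G ⧸ H) (AbSubgroup H)) ↔ Function.Injective (torsionMap p H) := by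
  have hpow : ∀ (h : H) (n : ℕ), n • AbSubgroup.mk h = AbSubgroup.mk (h ^ n) := fun _ _ => rfl
  have := hG.compactSpace
  rw [injective_iff_map_eq_one]
  constructor
  · rintro hT ⟨t, n, hn⟩ ht
    obtain ⟨g, rfl⟩ := QuotientGroup.mk_surjective t
    obtain ⟨h, hh⟩ := exists_mk_eq_of_mk_mem_commutator_closure H
      ((QuotientGroup.eq_one_iff (g : G ⧸ H)).1 ht)
    have hT' : ∀ (n : ℕ) (a : AbSubgroup H),
        p ^ n • a ∈ closedAugmentation (G ⧸ H) (AbSubgroup H) →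
          a ∈ closedAugmentation (G ⧸ H) (AbSubgroup H) := by
      intro n
      induction n with
      | zero => exact fun a ha => by simpa using ha
      | succ n ih => exact fun a ha => ih a (hT _ (by rwa [smul_smul, ← pow_succ']))
    have h1 : AbSubgroup.mk h ∈ closedAugmentation (G ⧸ H) (AbSubgroup H) := by
      refine hT' n _ ?_
      rw [hpow, mk_mem_closedAugmentation_iff H p hH, ← QuotientGroup.eq_one_iff]
      change (QuotientGroup.mk (h : G) : TopologicalAbelianization G) ^ p ^ n = 1
      rw [hh, hn]
    refine Subtype.ext ?_
    change QuotientGroup.mk g = 1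
    rw [← hh, QuotientGroup.eq_one_iff]
    exact (mk_mem_closedAugmentation_iff H p hH).1 h1
  · intro hinj a ha
    obtain ⟨h, rfl⟩ := AbSubgroup.mk_surjective a
    rw [hpow, mk_mem_closedAugmentation_iff H p hH, ← QuotientGroup.eq_one_iff] at ha
    rw [mk_mem_closedAugmentation_iff H p hH, ← QuotientGroup.eq_one_iff]
    have ht : (QuotientGroup.mk (h : G) : TopologicalAbelianization G) ∈
        zpTorsion p (TopologicalAbelianization G) := by
      refine ⟨1, ?_⟩
      rw [pow_one]
      exact ha
    refine congrArg Subtype.val (hinj ⟨_, ht⟩ ?_)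
    change (QuotientGroup.mk ((h : G) : G ⧸ H) : TopologicalAbelianization (G ⧸ H)) = 1
    rw [(QuotientGroup.eq_one_iff (h : G)).2 h.2]
    rfl

end Coinvariants

theorem mainTheorem4 (p : ℕ) [Fact p.Prime] (𝒢 : Type*) [Group 𝒢] [TopologicalSpace 𝒢]
    [IsTopologicalGroup 𝒢] [IsProP p 𝒢]
    (hfp : IsFinitelyPresentedProP p 𝒢) (hcd : CohomologicalDimensionLE p 𝒢 2)
    (ℋ : Subgroup 𝒢) [ℋ.Normal] [IsClosed (ℋ : Set 𝒢)]
    (hℋ : Subsingleton (trivialCohomology ℋ (QpModZp p) 2))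
    (hfg : Module.Finite (CompletedGroupAlgebra p (𝒢 ⧸ ℋ)) (AbSubgroup ℋ))
    (hcdG : CohomologicalDimensionLE p (𝒢 ⧸ ℋ) 2)
    (hH₂ : Subsingleton (ProfiniteHomology p 𝒢 2))
    (hH₂G : Subsingleton (ProfiniteHomology p (𝒢 ⧸ ℋ) 2)) :
    Module.Free (CompletedGroupAlgebra p (𝒢 ⧸ ℋ)) (AbSubgroup ℋ) ↔
      Function.Injective (torsionMap p ℋ) :=
  (AbSubgroup.free_iff_forall_nsmul_mem p ℋ (hcdG 3 (by norm_num)) hH₂).trans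
    (forall_nsmul_mem_iff_injective_torsionMap ℋ p hH₂G)
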